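/- Conventions. A $d$-polytope is the convex hull $P\subseteq\mathbb R^d$ of finitely many points whose affine span has dimension $d$. Its faces are $\emptyset$, $P$ and the intersections of $P$ with supporting hyperplanes; facets are the $(d-1)$-faces, edges the $1$-faces, vertices the $0$-faces, $V(P)$ is the vertex set and $f_0(P)=|V(P)|$. A $d$-polytope is *$j$-simplicial* if all its $j$-faces are simplices, and *$i$-simple* if each $(d-i-1)$-face lies in exactly $i+1$ facets. A vertex is *simple* if it lies in exactly $d$ facets. Merging. Let $P_1$ be a $d$-polytope with a simplex facet $F=[u_1,\dots,u_d]$ and $P_2$ a $d$-polytope with a simple vertex $v$ whose neighbors are ordered as $u_1',\dots,u_d'$. Let $H_j$ be the facet of $P_1$ with $H_j\cap F=\operatorname{conv}\{u_k:k\ne j\}$. Apply to $P_1$ a projective transformation $T$, defined on all of $P_1$, and to $P_2$ an affine automorphism $A$ of $\mathbb R^d$ such that $A(u_k')=T(u_k)$ for all $k$, the hyperplanes spanned by $T(F),T(H_1),\dots,T(H_d)$ are the facet hyperplanes of the simplex $\Sigma=\operatorname{conv}(A(v),T(u_1),\dots,T(u_d))$ (that of $T(H_j)$ being opposite to $T(u_j)$),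 and $T(P_1)\subseteq\Sigma$. The *merge* of $P_1$ and $P_2$ along $F$ and $v$ is $$P_1\rhd P_2 \;=\; T(P_1)\,\cup\,A\bigl(\operatorname{conv}(V(P_2)\setminus\{v\})\bigr).$$ It depends on the chosen orderings and on $T$ and $A$; the statement below holds for all choices. Statement. Let $d\ge 2$ and $1\le i\le d-1$. Let $P$ be a $(d-i)$-simplicial $i$-simple $d$-polytope that is not a simplex, with a simplex facet $F$ and a simple vertex $v\notin F$. Then: 1. For every ordering of the vertices of $F$ and of the neighbors of $v$, a merge $P\rhd P$ along $F$ and $v$ exists. 2. Every merge $P\rhd P$ along $F$ and $v$ is again a non-simplex $(d-i)$-simplicial $i$-simple $d$-polytope that has a simplex facet and a simple vertex not contained in that facet, and $f_0(P\rhd P)>f_0(P)$. 3. Consequently, iterated merging with $P$ yields an infinite family: there are non-simplex $(d-i)$-simplicial $i$-simple $d$-polytopes $R_0,R_1,R_2,\dots$, simplex facets $G_n$ of $R_n$ and simple vertices $w_n\notin G_n$ of $R_n$, with $(R_0,G_0,w_0)=(P,F,v)$, such that $R_{n+1}$ is a merge $R_n\rhd P$ along $G_n$ and $v$ for every $n\geq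 0$, and $f_0(R_0)<f_0(R_1)<f_0(R_2)<\cdots$. -/

import Mathlib

namespace Polytope

/-- The ambient space `ℝ^d`. -/
abbrev Space (d : ℕ) : Type := EuclideanSpace ℝ (Fin d)

/-- The dimension of the affine span of a nonempty set. It is only used for nonempty sets. -/
noncomputable def dim {d : ℕ} (G : Set (Space d)) : ℕ :=
  Module.finrank ℝ (vectorSpan ℝ G)

/-- `P ⊆ ℝ^d` is a `d`-polytope: the convex hull of finitely many points, of dimension `d`. -/
def IsDPolytope {d : ℕ} (P : Set (Space d)) : Prop :=
  (∃ s : Set (Space d), s.Finite ∧ P = convexHull ℝ s) ∧ P.Nonempty ∧ dim P = d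

/-- `G` is a `k`-simplex: the convex hull of `k + 1` affinely independent points. -/
def IsSimplex {d : ℕ} (k : ℕ) (G : Set (Space d)) : Prop :=
  ∃ p : Fin (k + 1) → Space d, AffineIndependent ℝ p ∧ G = convexHull ℝ (Set.range p)

/-- `G` is a `k`-dimensional face of `P`. Mathlib's `IsExposed ℝ P G` says that `G` is empty, or
the set of maximizers over `P` of a linear functional, i.e. `P` itself (zero functional) or the
intersection of `P` with a supporting hyperplane. -/
def IsFaceOfDim {d : ℕ} (P : Set (Space d)) (k : ℕ) (G : Set (Space d)) : Prop :=
  IsExposed ℝ P G ∧ G.Nonempty ∧ dim G = k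

/-- Facets of a `d`-polytope in `ℝ^d`. -/
def IsFacet {d : ℕ} (P G : Set (Space d)) : Prop :=
  IsFaceOfDim P (d - 1) G

/-- The vertex set `V(P)`: the points forming `0`-dimensional faces. -/
def vertexSet {d : ℕ} (P : Set (Space d)) : Set (Space d) :=
  {v | IsFaceOfDim P 0 {v}}

/-- The number `f₀(P)` of vertices. -/
noncomputable def numVertices {d : ℕ} (P : Set (Space d)) : ℕ :=
  (vertexSet P).ncard

/-- `P` is `j`-simplicial: all of its `j`-faces are simplices. -/
def IsSimplicial {d : ℕ} (j : ℕ) (P : Set (Space d)) : Prop :=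
  ∀ G, IsFaceOfDim P j G → IsSimplex j G

/-- A `d`-polytope `P` is `i`-simple (`1 ≤ i ≤ d - 1`): every `(d - i - 1)`-face lies in exactly
`i + 1` facets. -/
def IsSimple {d : ℕ} (i : ℕ) (P : Set (Space d)) : Prop :=
  ∀ G, IsFaceOfDim P (d - i - 1) G → {H | IsFacet P H ∧ G ⊆ H}.ncard = i + 1

/-- `v` is a simple vertex of the `d`-polytope `P`: a vertex that lies in exactly `d` facets. -/
def IsSimpleVertex {d : ℕ} (P : Set (Space d)) (v : Space d) : Prop :=
  v ∈ vertexSet P ∧ {H | IsFacet P H ∧ v ∈ H}.ncard = d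

/-- `F` is the simplex `[u₁, …, u_d]` with vertices listed in this order. -/
def IsSimplexWithOrder {d : ℕ} (F : Set (Space d)) (u : Fin d → Space d) : Prop :=
  AffineIndependent ℝ u ∧ F = convexHull ℝ (Set.range u)

/-- `u'` lists, without repetition, all neighbors of the vertex `v` of `P`, i.e. all points `w`
such that the segment `vw` is an edge of `P`. -/
def IsNeighborOrder {d : ℕ} (P : Set (Space d)) (v : Space d) (u' : Fin d → Space d) : Prop :=
  Function.Injective u' ∧ Set.range u' = {w | IsFaceOfDim P 1 (segment ℝ v w)}

/-- The projective transformation of `ℝ^d` induced by a linear automorphism `L` of `ℝ^d × ℝ`,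
in the affine chart `x ↦ (x, 1)`; it is `x ↦ (M x + b) / (c · x + δ)`. It is meaningful at the
points `x` for which `(L (x, 1)).2 = c · x + δ` is nonzero. -/
noncomputable def projMap {d : ℕ} (L : (Space d × ℝ) ≃ₗ[ℝ] (Space d × ℝ)) (x : Space d) :
    Space d :=
  (L (x, 1)).2⁻¹ • (L (x, 1)).1

/-- `Q` is a merge `P₁ ▹ P₂` along the simplex facet `F = [u₁, …, u_d]` of `P₁` and the simple
vertex `v` of `P₂` with neighbors `u'₁, …, u'_d`.

`H j` is the facet of `P₁` adjacent to `F` along the ridge `[u₁, …, û_j, …, u_d]`. The projective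
transformation `T = projMap L`, permissible for `P₁`, and the affine automorphism `A` bring `P₁`
and `P₂` into position: `A` maps `u'_k` to `T u_k`, the hyperplanes spanned by
`T(F), T(H 1), …, T(H d)` are the facet hyperplanes of the simplex
`Σ = [A v, T u₁, …, T u_d]`, and `Σ` contains `T(P₁)`. Then `Q` is the union of `T(P₁)` and
`A(P₂')`, where `P₂' = conv (V(P₂) \ {v})`. -/
def IsOrderedMerge {d : ℕ} (P₁ F : Set (Space d)) (u : Fin d → Space d)
    (P₂ : Set (Space d)) (v : Space d) (u' : Fin d → Space d) (Q : Set (Space d)) : Prop :=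
  IsFacet P₁ F ∧ IsSimplexWithOrder F u ∧ IsSimpleVertex P₂ v ∧ IsNeighborOrder P₂ v u' ∧
  ∃ (H : Fin d → Set (Space d)) (L : (Space d × ℝ) ≃ₗ[ℝ] (Space d × ℝ))
    (A : Space d ≃ᵃ[ℝ] Space d),
    (∀ j, IsFacet P₁ (H j) ∧ H j ∩ F = convexHull ℝ (u '' {k | k ≠ j})) ∧
    (∀ x ∈ P₁, (L (x, 1)).2 ≠ 0) ∧
    (∀ k, A (u' k) = projMap L (u k)) ∧
    (∀ j, affineSpan ℝ (projMap L '' H j) =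
      affineSpan ℝ (insert (A v) ((fun k => projMap L (u k)) '' {k | k ≠ j}))) ∧
    projMap L '' P₁ ⊆ convexHull ℝ (insert (A v) (Set.range fun k => projMap L (u k))) ∧
    Q = projMap L '' P₁ ∪ A '' convexHull ℝ (vertexSet P₂ \ {v})

/-- `Q` is a merge of `P₁` and `P₂` along `F` and `v`, for some ordering of the vertices of `F`
and of the neighbors of `v`. -/
def IsMerge {d : ℕ} (P₁ F P₂ : Set (Space d)) (v : Space d) (Q : Set (Space d)) : Prop :=
  ∃ u u' : Fin d → Space d, IsOrderedMerge P₁ F u P₂ v u' Q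

end Polytope

/-!
A polytope in `ℝ^d` is studied through the embedding `x ↦ (x, 1)` of `ℝ^d` into `ℝ^d × ℝ`: affine
functions become linear functionals, projective transformations become linear automorphisms, and
a `k`-face spans a linear subspace of dimension `k + 1`. A polytope is described by an irredundant
finite set `Φ` of functionals, one for each facet (`IsFacetSystem`). A nonempty face is cut out by
the functionals of `Φ` that vanish on it, and their rank is its codimension; hence counting facets
through a face is counting functionals.

Projective images have the same faces (`IsProjImage`), so a merge may be studied for polytopes `K₁`
and `K₂` that already are in position (`IsMergePosition`). Let `β₀, …, β_d` be the barycentric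
coordinates of the simplex spanned by the apex `v` and its neighbors. All of them are facet
functionals of `K₁`, the facet of the wall `β₀ = 0` being the one to be glued, while `β₁, …, β_d`
are the facet functionals of `K₂` at `v`. Every other facet functional of `K₁` is negative at `v`,
since otherwise it would be a nonnegative combination of the `β`s; every other facet functional of
`K₂` is positive at `v`. So each of them is nonnegative on the other piece, and vanishes there only
in the wall. Consequently the merge is a polytope whose facets are those of `K₁` and `K₂` without
the wall, with the two copies of `β₁, …, β_d` identified (`IsMergePosition.facetSystem`).

A face of the merge is therefore of one of three kinds (`IsMergePosition.face_cases`). If a facet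
through it belongs to one piece only, it is a face of that piece. Otherwise it is cut out by some of
`β₁, …, β_d`, which are independent, so that the number of facets through it is its codimension, as
`i`-simplicity demands. In that case, if its dimension is `d - i`, then the corresponding face of
`K₂` is a simplex spanned by `v` and some neighbors; nothing of it is left beyond the wall, and the
face is one of `K₁`. For `i`-simplicity of faces in the wall, the count in `K₁` consists of the wall
and `i` of the `β`s already, so that such a face lies on no facet belonging to `K₁` only.

A merge exists because `d` facets surround a simplex facet (`IsFacetSystem.exists_adjacent`), and
taking their functionals and that of the simplex facet as barycentric coordinates defines the
required projective transformation. The copy in the merge of the given facet of `K₂` and that of the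
given vertex of `K₁` allow the construction to be iterated.
-/

namespace Polytope

variable {d : ℕ}

/-! ### Polytopes in homogeneous coordinates -/

/-- The embedding `x ↦ (x, 1)` of `ℝ^d` as the affine hyperplane of height one. Affine functions
on `ℝ^d` are linear functionals on `ℝ^d × ℝ` composed with it. -/
def lift (x : Space d) : Space d × ℝ := (x, 1)

@[simp] lemma lift_fst (x : Space d) : (lift x).1 = x := rfl
@[simp] lemma lift_snd (x : Space d) : (lift x).2 = 1 := rfl

lemma lift_injective : Function.Injective (lift (d := d)) := fun _ _ h => congrArg Prod.fst h

lemma lift_ne_zero (x : Space d) : lift x ≠ 0 := fun h => by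
  simpa using congrArg Prod.snd h

/-- The linear span of the embedded set; it is one dimension larger than the affine span. -/
def liftSpan (G : Set (Space d)) : Submodule ℝ (Space d × ℝ) := Submodule.span ℝ (lift '' G)

/-- The part of `P` where the affine function given by `φ` vanishes: a face when `φ` is nonnegative
on `P`. -/
def zeroFace (P : Set (Space d)) (φ : Module.Dual ℝ (Space d × ℝ)) : Set (Space d) :=
  {x ∈ P | φ (lift x) = 0}

lemma finrank_lift_space : Module.finrank ℝ (Space d × ℝ) = d + 1 := by simp

lemma lift_mem_liftSpan {G : Set (Space d)} {x : Space d} (hx : x ∈ G) : lift x ∈ liftSpan G :=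
  Submodule.subset_span ⟨x, hx, rfl⟩

lemma liftSpan_mono {G G' : Set (Space d)} (h : G ⊆ G') : liftSpan G ≤ liftSpan G' :=
  Submodule.span_mono (Set.image_mono h)

lemma liftSpan_le {G : Set (Space d)} {W : Submodule ℝ (Space d × ℝ)} :
    liftSpan G ≤ W ↔ ∀ x ∈ G, lift x ∈ W := by
  rw [liftSpan, Submodule.span_le]
  exact ⟨fun h x hx => h ⟨x, hx, rfl⟩, by rintro h _ ⟨x, hx, rfl⟩; exact h x hx⟩

lemma liftSpan_le_ker {G : Set (Space d)} {φ : Module.Dual ℝ (Space d × ℝ)} :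
    liftSpan G ≤ LinearMap.ker φ ↔ ∀ x ∈ G, φ (lift x) = 0 := by
  simp [liftSpan_le, LinearMap.mem_ker]

/-- The linear span of the embedded set consists of the multiples of a base point plus a direction
of the affine span. -/
lemma mem_liftSpan_iff {G : Set (Space d)} {x₀ : Space d} (h₀ : x₀ ∈ G) (y : Space d × ℝ) :
    y ∈ liftSpan G ↔ y.1 - y.2 • x₀ ∈ vectorSpan ℝ G := by
  constructor
  · intro hy
    induction hy using Submodule.span_induction with
    | mem y hy =>
      obtain ⟨x, hx, rfl⟩ := hy
      simpa using vsub_mem_vectorSpan ℝ hx h₀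
    | zero => simp
    | add y z _ _ hy hz =>
      convert add_mem hy hz using 1
      simp only [Prod.fst_add, Prod.snd_add]; module
    | smul c y _ hy =>
      convert Submodule.smul_mem _ c hy using 1
      simp only [Prod.smul_fst, Prod.smul_snd, smul_eq_mul]; module
  · intro hy
    have key : ∀ w ∈ vectorSpan ℝ G, (w, (0 : ℝ)) ∈ liftSpan G := by
      intro w hw
      rw [vectorSpan_eq_span_vsub_set_right ℝ h₀] at hw
      induction hw using Submodule.span_induction with
      | mem w hw =>
        obtain ⟨x, hx, rfl⟩ := hw
        have := sub_mem (lift_mem_liftSpan hx) (lift_mem_liftSpan h₀)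
        simpa [lift] using this
      | zero => exact zero_mem _
      | add w z _ _ hw hz => simpa using add_mem hw hz
      | smul c w _ hw => simpa using Submodule.smul_mem _ c hw
    have h := add_mem (key _ hy) (Submodule.smul_mem _ y.2 (lift_mem_liftSpan h₀))
    convert h using 1
    ext1 <;> simp

lemma finrank_liftSpan {G : Set (Space d)} (hG : G.Nonempty) :
    Module.finrank ℝ (liftSpan G) = dim G + 1 := by
  obtain ⟨x₀, h₀⟩ := hG
  let e : (vectorSpan ℝ G × ℝ) ≃ₗ[ℝ] liftSpan G :=
    { toFun := fun p => ⟨(p.1 + p.2 • x₀, p.2), by rw [mem_liftSpan_iff h₀]; simp⟩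
      map_add' := fun p q => by
        apply Subtype.ext; ext1
        · simp only [Prod.fst_add, Prod.snd_add, Submodule.coe_add]; module
        · simp
      map_smul' := fun c p => by
        apply Subtype.ext; ext1
        · simp only [Prod.smul_fst, Prod.smul_snd, Submodule.coe_smul, smul_eq_mul,
            RingHom.id_apply]; module
        · simp
      invFun := fun y => (⟨y.1.1 - y.1.2 • x₀, (mem_liftSpan_iff h₀ _).1 y.2⟩, y.1.2)
      left_inv := fun p => by ext1 <;> simp
      right_inv := fun y => by apply Subtype.ext; ext1 <;> simp }
  rw [← e.finrank_eq]
  simp [dim]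

lemma mem_affineSpan_iff {S : Set (Space d)} (hS : S.Nonempty) (x : Space d) :
    x ∈ affineSpan ℝ S ↔ lift x ∈ liftSpan S := by
  obtain ⟨x₀, h₀⟩ := hS
  rw [mem_liftSpan_iff h₀]
  have h := AffineSubspace.vsub_left_mem_direction_iff_mem (subset_affineSpan ℝ S h₀) x
  rw [direction_affineSpan] at h
  rw [← h, ← neg_mem_iff]
  simp

lemma affineIndependent_iff_lift {ι : Type*} {p : ι → Space d} :
    AffineIndependent ℝ p ↔ LinearIndependent ℝ (fun i => lift (p i)) := by
  rw [affineIndependent_iff, linearIndependent_iff']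
  refine forall_congr' fun s => forall_congr' fun w => ?_
  have h1 : (∑ i ∈ s, w i • lift (p i)) = (∑ i ∈ s, w i • p i, ∑ i ∈ s, w i) := by
    ext1
    · simp [Prod.fst_sum]
    · simp [Prod.snd_sum]
  rw [h1, Prod.mk_eq_zero]
  tauto

lemma lift_combo {a b : ℝ} (hab : a + b = 1) (x y : Space d) :
    lift (a • x + b • y) = a • lift x + b • lift y := by
  ext1
  · simp
  · simp [hab]

lemma lift_sum {ι : Type*} (s : Finset ι) (w : ι → ℝ) (hw : ∑ i ∈ s, w i = 1) (p : ι → Space d) :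
    lift (∑ i ∈ s, w i • p i) = ∑ i ∈ s, w i • lift (p i) := by
  ext1
  · simp [Prod.fst_sum]
  · simp [Prod.snd_sum, hw]

lemma convex_lift_nonneg (φ : Module.Dual ℝ (Space d × ℝ)) :
    Convex ℝ {x : Space d | 0 ≤ φ (lift x)} := by
  intro x hx y hy a b ha hb hab
  simp only [Set.mem_ofPred_eq] at *
  rw [lift_combo hab, map_add, map_smul, map_smul, smul_eq_mul, smul_eq_mul]
  positivity

lemma nonneg_on_convexHull {s : Set (Space d)} {φ : Module.Dual ℝ (Space d × ℝ)}
    (h : ∀ x ∈ s, 0 ≤ φ (lift x)) : ∀ x ∈ convexHull ℝ s, 0 ≤ φ (lift x) :=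
  fun _ hx => convexHull_min (t := {x | 0 ≤ φ (lift x)}) h (convex_lift_nonneg φ) hx

lemma zero_on_convexHull {s : Set (Space d)} {φ : Module.Dual ℝ (Space d × ℝ)}
    (h : ∀ x ∈ s, φ (lift x) = 0) : ∀ x ∈ convexHull ℝ s, φ (lift x) = 0 := fun x hx =>
  le_antisymm
    (by simpa using nonneg_on_convexHull (φ := -φ) (fun x hx => by simp [h x hx]) x hx)
    (nonneg_on_convexHull (fun x hx => (h x hx).ge) x hx)

lemma liftSpan_convexHull (s : Set (Space d)) : liftSpan (convexHull ℝ s) = liftSpan s := by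
  apply le_antisymm _ (liftSpan_mono (subset_convexHull ℝ s))
  rw [liftSpan_le]
  refine convexHull_min (t := {x | lift x ∈ liftSpan s}) (fun x hx => lift_mem_liftSpan hx) ?_
  intro x hx y hy a b _ _ hab
  simp only [Set.mem_ofPred_eq] at *
  rw [lift_combo hab]
  exact add_mem (Submodule.smul_mem _ _ hx) (Submodule.smul_mem _ _ hy)

/-- A face of a convex hull is the convex hull of the generators that it contains. -/
lemma zeroFace_convexHull {s : Set (Space d)} {φ : Module.Dual ℝ (Space d × ℝ)}
    (h : ∀ x ∈ s, 0 ≤ φ (lift x)) :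
    zeroFace (convexHull ℝ s) φ = convexHull ℝ {x ∈ s | φ (lift x) = 0} := by
  apply Set.Subset.antisymm
  · rintro x ⟨hx, hx0⟩
    obtain ⟨ι, _, w, z, hw, hw1, hz, rfl⟩ := mem_convexHull_iff_exists_fintype.1 hx
    rw [lift_sum _ _ hw1, map_sum] at hx0
    simp only [map_smul, smul_eq_mul] at hx0
    rw [Finset.sum_eq_zero_iff_of_nonneg
      (fun i _ => mul_nonneg (hw i) (h _ (hz i)))] at hx0
    classical
    have hsum : ∑ i, w i • z i = ∑ i with w i ≠ 0, w i • z i := by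
      rw [Finset.sum_filter]
      refine Finset.sum_congr rfl fun i _ => ?_
      split_ifs with hi
      · rfl
      · simp [not_not.1 hi]
    rw [hsum]
    refine (convex_convexHull ℝ _).sum_mem (fun i _ => hw i) ?_ ?_
    · rw [Finset.sum_filter_ne_zero, hw1]
    · intro i hi
      apply subset_convexHull
      exact ⟨hz i, (mul_eq_zero.1 (hx0 i (Finset.mem_univ i))).resolve_left
        (Finset.mem_filter.1 hi).2⟩
  · refine fun x hx => ⟨convexHull_mono (fun y hy => hy.1) hx, ?_⟩
    exact zero_on_convexHull (fun y hy => hy.2) x hx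

/-- A nonempty exposed face is where a functional on `ℝ^d × ℝ` that is nonnegative on `P` vanishes:
the difference between the maximum of the exposing functional and its value. -/
lemma exists_dual_of_isExposed {P G : Set (Space d)} (hG : IsExposed ℝ P G) (hne : G.Nonempty) :
    ∃ φ : Module.Dual ℝ (Space d × ℝ), (∀ x ∈ P, 0 ≤ φ (lift x)) ∧ G = zeroFace P φ := by
  obtain ⟨l, hl⟩ := hG hne
  obtain ⟨x₀, h₀⟩ := hne
  have h₀' := h₀
  rw [hl] at h₀'
  refine ⟨(l x₀) • LinearMap.snd ℝ _ _ - (l : Space d →ₗ[ℝ] ℝ) ∘ₗ LinearMap.fst ℝ _ _, ?_, ?_⟩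
  · intro x hx
    simpa using h₀'.2 x hx
  · rw [hl]
    ext x
    simp only [zeroFace, Set.mem_ofPred_eq, LinearMap.sub_apply, LinearMap.smul_apply,
      LinearMap.snd_apply, LinearMap.comp_apply, LinearMap.fst_apply, lift_fst, lift_snd,
      smul_eq_mul, mul_one, sub_eq_zero, ContinuousLinearMap.coe_coe]
    refine and_congr_right fun hx => ⟨fun h => ?_, fun h y hy => ?_⟩
    · exact le_antisymm (h _ h₀'.1) (h₀'.2 _ hx)
    · rw [← h]; exact h₀'.2 _ hy

lemma isExposed_zeroFace {P : Set (Space d)} {φ : Module.Dual ℝ (Space d × ℝ)}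
    (h : ∀ x ∈ P, 0 ≤ φ (lift x)) : IsExposed ℝ P (zeroFace P φ) := by
  rintro ⟨x₀, h₀⟩
  refine ⟨LinearMap.toContinuousLinearMap (-(φ ∘ₗ LinearMap.inl ℝ (Space d) ℝ)), ?_⟩
  have hφ : ∀ x : Space d, φ (lift x) = φ (x, 0) + φ (0, 1) := fun x => by
    rw [← map_add]; simp [lift]
  ext x
  simp only [zeroFace, Set.mem_ofPred_eq, LinearMap.coe_toContinuousLinearMap',
    LinearMap.neg_apply, LinearMap.comp_apply, LinearMap.inl_apply, neg_le_neg_iff]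
  refine and_congr_right fun hx => ⟨fun hx0 y hy => ?_, fun hy => ?_⟩
  · linarith [hφ x, hφ y, h y hy]
  · have := hy x₀ h₀.1
    linarith [hφ x, hφ x₀, h x hx, h₀.2]

/-- Faces in homogeneous terms. Nonemptiness is implied by the positive rank. -/
lemma isFaceOfDim_iff {P G : Set (Space d)} {k : ℕ} :
    IsFaceOfDim P k G ↔ (∃ φ : Module.Dual ℝ (Space d × ℝ), (∀ x ∈ P, 0 ≤ φ (lift x)) ∧
      G = zeroFace P φ) ∧ Module.finrank ℝ (liftSpan G) = k + 1 := by
  constructor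
  · rintro ⟨h1, h2, h3⟩
    exact ⟨exists_dual_of_isExposed h1 h2, by rw [finrank_liftSpan h2, h3]⟩
  · rintro ⟨⟨φ, h1, h2⟩, h3⟩
    have hne : G.Nonempty := by
      rw [Set.nonempty_iff_ne_empty]
      rintro rfl
      rw [liftSpan, Set.image_empty, Submodule.span_empty, finrank_bot] at h3
      omega
    refine ⟨by rw [h2]; exact isExposed_zeroFace h1, hne, ?_⟩
    rw [finrank_liftSpan hne] at h3
    omega

lemma liftSpan_singleton (x : Space d) : liftSpan {x} = Submodule.span ℝ {lift x} := by
  simp [liftSpan]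

lemma finrank_liftSpan_singleton (x : Space d) : Module.finrank ℝ (liftSpan {x}) = 1 := by
  rw [liftSpan_singleton, finrank_span_singleton (lift_ne_zero x)]

lemma mem_vertexSet_iff {P : Set (Space d)} {v : Space d} :
    v ∈ vertexSet P ↔ ∃ φ : Module.Dual ℝ (Space d × ℝ), (∀ x ∈ P, 0 ≤ φ (lift x)) ∧
      {v} = zeroFace P φ := by
  rw [vertexSet, Set.mem_ofPred_eq, isFaceOfDim_iff, finrank_liftSpan_singleton]
  simp

/-! ### Facet systems -/

/-- `φ` is nonnegative on `P` and vanishes on a facet of `P`. That the zero face spans the kernel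
of `φ` says that this face has dimension `d - 1`. -/
structure IsFacetFunctional (P : Set (Space d)) (φ : Module.Dual ℝ (Space d × ℝ)) : Prop where
  ne_zero : φ ≠ 0
  nonneg : ∀ x ∈ P, 0 ≤ φ (lift x)
  liftSpan_eq : liftSpan (zeroFace P φ) = LinearMap.ker φ

/-- `Φ` is an irredundant description of `P` by finitely many inequalities, with one functional for
each facet of `P`. -/
structure IsFacetSystem (P : Set (Space d)) (Φ : Set (Module.Dual ℝ (Space d × ℝ))) : Prop where
  finite : Φ.Finite
  mem_iff : ∀ x, x ∈ P ↔ ∀ φ ∈ Φ, 0 ≤ φ (lift x)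
  facet : ∀ φ ∈ Φ, IsFacetFunctional P φ
  inj : ∀ φ ∈ Φ, ∀ ψ ∈ Φ, LinearMap.ker φ = LinearMap.ker ψ → φ = ψ

/-- The functionals in `Φ` that vanish on `G`. -/
def vanishing (Φ : Set (Module.Dual ℝ (Space d × ℝ))) (G : Set (Space d)) :
    Set (Module.Dual ℝ (Space d × ℝ)) :=
  {φ ∈ Φ | ∀ x ∈ G, φ (lift x) = 0}

lemma finrank_ker_of_ne_zero {φ : Module.Dual ℝ (Space d × ℝ)} (h : φ ≠ 0) :
    Module.finrank ℝ (LinearMap.ker φ) = d := by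
  have := Module.Dual.finrank_ker_add_one_of_ne_zero h
  rw [finrank_lift_space] at this
  omega

lemma IsDPolytope.liftSpan_eq_top {P : Set (Space d)} (hP : IsDPolytope P) : liftSpan P = ⊤ := by
  apply Submodule.eq_top_of_finrank_eq
  rw [finrank_liftSpan hP.2.1, hP.2.2, finrank_lift_space]

lemma zeroFace_congr {P : Set (Space d)} {φ ψ : Module.Dual ℝ (Space d × ℝ)}
    (h : LinearMap.ker φ = LinearMap.ker ψ) : zeroFace P φ = zeroFace P ψ := by
  ext x
  have := congrArg (fun W => lift x ∈ W) h
  simp only [LinearMap.mem_ker, eq_iff_iff] at this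
  exact and_congr_right fun _ => this

lemma IsDPolytope.exists_pos {P : Set (Space d)} (hP : IsDPolytope P)
    {φ : Module.Dual ℝ (Space d × ℝ)} (hφ : φ ≠ 0) (h : ∀ x ∈ P, 0 ≤ φ (lift x)) :
    ∃ x ∈ P, 0 < φ (lift x) := by
  by_contra! hcon
  apply hφ
  have : liftSpan P ≤ LinearMap.ker φ :=
    liftSpan_le_ker.2 fun x hx => le_antisymm (hcon x hx) (h x hx)
  rw [hP.liftSpan_eq_top, top_le_iff, LinearMap.ker_eq_top] at this
  exact this

/-- Two nonnegative functionals on a full-dimensional polytope with the same kernel differ by a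
positive factor. -/
lemma IsDPolytope.exists_pos_smul {P : Set (Space d)} (hP : IsDPolytope P)
    {φ ψ : Module.Dual ℝ (Space d × ℝ)} (hφ : φ ≠ 0) (h : ∀ x ∈ P, 0 ≤ φ (lift x))
    (h' : ∀ x ∈ P, 0 ≤ ψ (lift x)) (hker : LinearMap.ker φ = LinearMap.ker ψ) :
    ∃ a : ℝ, 0 < a ∧ ψ = a • φ := by
  obtain ⟨x, hx, hpos⟩ := hP.exists_pos hφ h
  have hne : ψ (lift x) ≠ 0 := fun h0 => by
    rw [← LinearMap.mem_ker, ← hker, LinearMap.mem_ker] at h0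
    exact hpos.ne' h0
  refine ⟨ψ (lift x) / φ (lift x), div_pos ((h' x hx).lt_of_ne' hne) hpos, ?_⟩
  refine LinearMap.ext fun y => ?_
  have : y - (φ y / φ (lift x)) • lift x ∈ LinearMap.ker ψ := by
    rw [← hker, LinearMap.mem_ker, map_sub, map_smul, smul_eq_mul]
    field_simp
    ring
  rw [LinearMap.mem_ker, map_sub, map_smul, smul_eq_mul, sub_eq_zero] at this
  rw [this, LinearMap.smul_apply, smul_eq_mul]
  field_simp

/-- A point outside a full-dimensional polytope violates a facet inequality: among the separating
functionals, tilt one until its zero set spans a hyperplane. -/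
lemma IsDPolytope.exists_facetFunctional_neg {P : Set (Space d)} (hP : IsDPolytope P)
    {y : Space d} (hy : y ∉ P) : ∃ φ, IsFacetFunctional P φ ∧ φ (lift y) < 0 := by
  have htop := hP.liftSpan_eq_top
  obtain ⟨⟨s, hs, rfl⟩, -, -⟩ := hP
  rw [liftSpan_convexHull] at htop
  have key : ∀ n : ℕ, ∀ ψ : Module.Dual ℝ (Space d × ℝ), (∀ x ∈ s, 0 ≤ ψ (lift x)) →
      ψ (lift y) < 0 → d ≤ Module.finrank ℝ (liftSpan {x ∈ s | ψ (lift x) = 0}) + n →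
      ∃ φ, IsFacetFunctional (convexHull ℝ s) φ ∧ φ (lift y) < 0 := by
    intro n
    induction n with
    | zero =>
      intro ψ hψ hψy hrank
      have hne : ψ ≠ 0 := by rintro rfl; simp at hψy
      refine ⟨ψ, ⟨hne, nonneg_on_convexHull hψ, ?_⟩, hψy⟩
      rw [zeroFace_convexHull hψ, liftSpan_convexHull]
      apply Submodule.eq_of_le_of_finrank_le
      · exact liftSpan_le_ker.2 fun x hx => hx.2
      · rw [finrank_ker_of_ne_zero hne]; exact hrank
    | succ n ih =>
      intro ψ hψ hψy hrank
      set W := liftSpan {x ∈ s | ψ (lift x) = 0} with hW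
      by_cases hlt : d ≤ Module.finrank ℝ W
      · exact ih ψ hψ hψy (by rw [← hW]; exact hlt.trans (Nat.le_add_right _ _))
      have hproper : W ⊔ Submodule.span ℝ {lift y} < ⊤ := by
        apply Submodule.lt_top_of_finrank_lt_finrank
        rw [finrank_lift_space]
        have h1 := Submodule.finrank_add_le_finrank_add_finrank W (Submodule.span ℝ {lift y})
        rw [finrank_span_singleton (lift_ne_zero y)] at h1
        omega
      obtain ⟨χ₀, hχ₀, hχ₀le⟩ := Submodule.exists_le_ker_of_lt_top _ hproper
      obtain ⟨χ, hχle, x', hx's, hx'⟩ : ∃ χ : Module.Dual ℝ (Space d × ℝ),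
          W ⊔ Submodule.span ℝ {lift y} ≤ LinearMap.ker χ ∧ ∃ x ∈ s, χ (lift x) < 0 := by
        by_contra! hcon
        apply hχ₀
        rw [← LinearMap.ker_eq_top, ← top_le_iff, ← htop, liftSpan_le_ker]
        intro x hx
        have h2 := hcon (-χ₀) (by rwa [LinearMap.ker_neg]) x hx
        have h1 := hcon χ₀ hχ₀le x hx
        simp only [LinearMap.neg_apply] at h2
        linarith
      have hχW : W ≤ LinearMap.ker χ := le_sup_left.trans hχle
      have hχy : χ (lift y) = 0 :=
        hχle (Submodule.mem_sup_right (Submodule.mem_span_singleton_self _))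
      obtain ⟨x₁, hx₁, hmin⟩ := Set.exists_min_image {x ∈ s | χ (lift x) < 0}
        (fun x => ψ (lift x) / (-χ (lift x))) (hs.subset fun x hx => hx.1) ⟨x', hx's, hx'⟩
      have hx₁neg : 0 < -χ (lift x₁) := by linarith [hx₁.2]
      set t := ψ (lift x₁) / (-χ (lift x₁)) with ht
      have ht0 : 0 ≤ t := div_nonneg (hψ _ hx₁.1) hx₁neg.le
      refine ih (ψ + t • χ) ?_ ?_ ?_
      · intro x hx
        simp only [LinearMap.add_apply, LinearMap.smul_apply, smul_eq_mul]
        rcases lt_or_ge (χ (lift x)) 0 with hneg | hpos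
        · have h1 := hmin x ⟨hx, hneg⟩
          rw [le_div_iff₀ (by linarith)] at h1
          linarith
        · have := hψ x hx
          positivity
      · simpa [hχy] using hψy
      · have hlt' : W < liftSpan {x ∈ s | (ψ + t • χ) (lift x) = 0} := by
          refine lt_of_le_of_ne (liftSpan_mono fun x hx => ⟨hx.1, ?_⟩) fun heq => ?_
          · have hx0 : χ (lift x) = 0 := hχW (lift_mem_liftSpan hx)
            simp [hx.2, hx0]
          · have h1 : lift x₁ ∈ liftSpan {x ∈ s | (ψ + t • χ) (lift x) = 0} := by
              refine lift_mem_liftSpan ⟨hx₁.1, ?_⟩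
              have h2 : t * (-χ (lift x₁)) = ψ (lift x₁) := div_mul_cancel₀ _ hx₁neg.ne'
              simp only [LinearMap.add_apply, LinearMap.smul_apply, smul_eq_mul]
              linarith
            rw [← heq] at h1
            have h2 : χ (lift x₁) = 0 := hχW h1
            linarith
        have := Submodule.finrank_lt_finrank_of_lt hlt'
        omega
  obtain ⟨l, u, h1, h2⟩ := geometric_hahn_banach_point_closed (convex_convexHull ℝ s)
    (hs.isClosed_convexHull ℝ) hy
  -- The separating affine function `l - u`; the value `d` bounds the missing rank.
  refine key d ((l : Space d →ₗ[ℝ] ℝ) ∘ₗ LinearMap.fst ℝ _ _ - u • LinearMap.snd ℝ _ _)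
    (fun x hx => ?_) ?_ (by omega)
  · have := h2 x (subset_convexHull ℝ s hx)
    simp only [LinearMap.sub_apply, LinearMap.comp_apply, LinearMap.fst_apply, lift_fst,
      LinearMap.smul_apply, LinearMap.snd_apply, lift_snd, smul_eq_mul, mul_one,
      ContinuousLinearMap.coe_coe]
    linarith
  · simp only [LinearMap.sub_apply, LinearMap.comp_apply, LinearMap.fst_apply, lift_fst,
      LinearMap.smul_apply, LinearMap.snd_apply, lift_snd, smul_eq_mul, mul_one,
      ContinuousLinearMap.coe_coe]
    linarith

/-- Every `d`-polytope has a facet system, which may be chosen to contain prescribed pairwise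
nonproportional facet functionals. -/
lemma IsDPolytope.exists_facetSystem {P : Set (Space d)} (hP : IsDPolytope P)
    (B : Set (Module.Dual ℝ (Space d × ℝ))) (hB : ∀ φ ∈ B, IsFacetFunctional P φ)
    (hinj : ∀ φ ∈ B, ∀ ψ ∈ B, LinearMap.ker φ = LinearMap.ker ψ → φ = ψ) :
    ∃ Φ, B ⊆ Φ ∧ IsFacetSystem P Φ := by
  classical
  set 𝓕 : Set (Set (Space d)) := {G | ∃ φ, IsFacetFunctional P φ ∧ G = zeroFace P φ} with h𝓕
  have hfin : 𝓕.Finite := by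
    obtain ⟨⟨s, hs, hPs⟩, -, -⟩ := hP
    refine (hs.powerset.image (fun t => convexHull ℝ t)).subset ?_
    rintro _ ⟨φ, hφ, rfl⟩
    refine ⟨{x ∈ s | φ (lift x) = 0}, fun x hx => hx.1, ?_⟩
    have := hφ.nonneg
    subst hPs
    exact (zeroFace_convexHull fun x hx => this x (subset_convexHull ℝ s hx)).symm
  have hchoice : ∀ G ∈ 𝓕, ∃ φ, IsFacetFunctional P φ ∧ G = zeroFace P φ ∧
      ((∃ b ∈ B, G = zeroFace P b) → φ ∈ B) := by
    rintro G ⟨φ, hφ, hG⟩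
    by_cases h : ∃ b ∈ B, G = zeroFace P b
    · obtain ⟨b, hb, hGb⟩ := h
      exact ⟨b, hB b hb, hGb, fun _ => hb⟩
    · exact ⟨φ, hφ, hG, fun h' => (h h').elim⟩
  -- One functional for each facet, from `B` where possible.
  choose! c hc1 hc2 hc3 using hchoice
  have hker : ∀ φ, IsFacetFunctional P φ →
      LinearMap.ker (c (zeroFace P φ)) = LinearMap.ker φ := by
    intro φ hφ
    have hmem : zeroFace P φ ∈ 𝓕 := ⟨φ, hφ, rfl⟩
    rw [← hφ.liftSpan_eq, ← (hc1 _ hmem).liftSpan_eq, ← hc2 _ hmem]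
  refine ⟨c '' 𝓕, ?_, hfin.image c, ?_, ?_, ?_⟩
  · intro b hb
    have hmem : zeroFace P b ∈ 𝓕 := ⟨b, hB b hb, rfl⟩
    exact ⟨_, hmem, hinj _ (hc3 _ hmem ⟨b, hb, rfl⟩) _ hb (hker b (hB b hb))⟩
  · intro x
    constructor
    · rintro hx _ ⟨G, hG, rfl⟩
      exact (hc1 G hG).nonneg x hx
    · intro h
      by_contra hx
      obtain ⟨φ, hφ, hneg⟩ := hP.exists_facetFunctional_neg hx
      have hmem : zeroFace P φ ∈ 𝓕 := ⟨φ, hφ, rfl⟩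
      obtain ⟨a, ha, hca⟩ := hP.exists_pos_smul hφ.ne_zero hφ.nonneg (hc1 _ hmem).nonneg
        (hker φ hφ).symm
      have h1 := h _ ⟨_, hmem, rfl⟩
      rw [hca, LinearMap.smul_apply, smul_eq_mul] at h1
      exact absurd h1 (not_le.2 (mul_neg_of_pos_of_neg ha hneg))
  · rintro _ ⟨G, hG, rfl⟩
    exact hc1 G hG
  · rintro _ ⟨G, hG, rfl⟩ _ ⟨G', hG', rfl⟩ h
    rw [hc2 G hG, hc2 G' hG', zeroFace_congr h]

lemma IsDPolytope.convex {P : Set (Space d)} (hP : IsDPolytope P) : Convex ℝ P := by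
  obtain ⟨⟨s, -, rfl⟩, -⟩ := hP
  exact convex_convexHull ℝ s

lemma convex_zeroFace {P : Set (Space d)} (hP : Convex ℝ P)
    (φ : Module.Dual ℝ (Space d × ℝ)) : Convex ℝ (zeroFace P φ) := by
  rintro x ⟨hx, hx0⟩ y ⟨hy, hy0⟩ a b ha hb hab
  refine ⟨hP hx hy ha hb hab, ?_⟩
  rw [lift_combo hab, map_add, map_smul, map_smul, hx0, hy0]
  simp

/-- From a point of `P` one can move a little in each direction of the homogeneous space that
respects the inequalities tight at that point. -/
lemma exists_perturb {Φ : Set (Module.Dual ℝ (Space d × ℝ))} (hfin : Φ.Finite) {x₀ : Space d}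
    (h₀ : ∀ φ ∈ Φ, 0 ≤ φ (lift x₀)) {y : Space d × ℝ}
    (hy : ∀ φ ∈ Φ, φ (lift x₀) = 0 → 0 ≤ φ y) :
    ∃ ε : ℝ, 0 < ε ∧ ∃ c : ℝ, 0 < c ∧ ∃ x, (∀ φ ∈ Φ, 0 ≤ φ (lift x)) ∧
      c • lift x = lift x₀ + ε • y := by
  have hev : ∀ a b : ℝ, 0 < a → ∀ᶠ ε : ℝ in nhdsWithin 0 (Set.Ioi 0), 0 < a + ε * b := by
    intro a b ha
    have hc : Filter.Tendsto (fun ε : ℝ => a + ε * b) (nhdsWithin 0 (Set.Ioi 0))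
        (nhds (a + 0 * b)) :=
      (Continuous.tendsto (by fun_prop) 0).mono_left nhdsWithin_le_nhds
    exact hc.eventually (lt_mem_nhds (by simpa using ha))
  have h1 : ∀ᶠ ε : ℝ in nhdsWithin 0 (Set.Ioi 0), ∀ φ ∈ Φ, 0 ≤ φ (lift x₀) + ε * φ y := by
    rw [Filter.eventually_all_finite hfin]
    intro φ hφ
    rcases (h₀ φ hφ).eq_or_lt with h | h
    · filter_upwards [self_mem_nhdsWithin] with ε hε
      rw [← h, zero_add]
      exact mul_nonneg (le_of_lt hε) (hy φ hφ h.symm)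
    · exact (hev _ _ h).mono fun ε h => h.le
  obtain ⟨ε, hε1, hε2, hε3⟩ :=
    (h1.and ((hev 1 y.2 one_pos).and self_mem_nhdsWithin)).exists
  set c := 1 + ε * y.2
  have hx : c • lift (c⁻¹ • (x₀ + ε • y.1)) = lift x₀ + ε • y := by
    ext1
    · simp [smul_smul, ← mul_assoc, mul_inv_cancel₀ hε2.ne']
    · simp [c]
  refine ⟨ε, hε3, c, hε2, c⁻¹ • (x₀ + ε • y.1), fun φ hφ => ?_, hx⟩
  have h2 : 0 ≤ φ (c • lift (c⁻¹ • (x₀ + ε • y.1))) := by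
    rw [hx, map_add, map_smul, smul_eq_mul]
    exact hε1 φ hφ
  rw [map_smul, smul_eq_mul] at h2
  exact nonneg_of_mul_nonneg_right h2 hε2

namespace IsFacetSystem

variable {P : Set (Space d)} {Φ : Set (Module.Dual ℝ (Space d × ℝ))}

lemma vanishing_finite (hΦ : IsFacetSystem P Φ) (G : Set (Space d)) : (vanishing Φ G).Finite :=
  hΦ.finite.subset fun _ h => h.1

lemma nonneg (hΦ : IsFacetSystem P Φ) {φ : Module.Dual ℝ (Space d × ℝ)} (hφ : φ ∈ Φ)
    {x : Space d} (hx : x ∈ P) : 0 ≤ φ (lift x) := (hΦ.mem_iff x).1 hx φ hφ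

lemma convex (hΦ : IsFacetSystem P Φ) : Convex ℝ P := by
  have : P = ⋂ φ ∈ Φ, {x | 0 ≤ φ (lift x)} := by
    ext x
    simp [hΦ.mem_iff x]
  rw [this]
  exact convex_iInter₂ fun φ _ => convex_lift_nonneg φ

/-- A convex subset of `P` has a point at which only those facet inequalities are tight that are
tight on the whole subset. -/
lemma exists_generic (hΦ : IsFacetSystem P Φ) {G : Set (Space d)} (hG : Convex ℝ G)
    (hGP : G ⊆ P) (hne : G.Nonempty) :
    ∃ x₀ ∈ G, ∀ φ ∈ Φ, φ (lift x₀) = 0 → φ ∈ vanishing Φ G := by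
  suffices h : ∀ T : Set (Module.Dual ℝ (Space d × ℝ)), T.Finite → T ⊆ Φ →
      ∃ x₀ ∈ G, ∀ φ ∈ T, φ (lift x₀) = 0 → φ ∈ vanishing Φ G from h Φ hΦ.finite subset_rfl
  intro T hT
  induction T, hT using Set.Finite.induction_on with
  | empty => exact fun _ => ⟨hne.some, hne.some_mem, by simp⟩
  | @insert ψ T _ _ ih =>
    intro hsub
    obtain ⟨x₀, hx₀, h₀⟩ := ih ((Set.subset_insert _ _).trans hsub)
    have hψ : ψ ∈ Φ := hsub (Set.mem_insert _ _)
    by_cases hv : ψ ∈ vanishing Φ G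
    · refine ⟨x₀, hx₀, ?_⟩
      rintro φ (rfl | hφ) h
      exacts [hv, h₀ φ hφ h]
    · obtain ⟨x₁, hx₁, h₁⟩ : ∃ x₁ ∈ G, ψ (lift x₁) ≠ 0 := by
        by_contra! hcon
        exact hv ⟨hψ, hcon⟩
      have hab : (1 / 2 : ℝ) + 1 / 2 = 1 := by norm_num
      refine ⟨(1 / 2 : ℝ) • x₀ + (1 / 2 : ℝ) • x₁,
        hG hx₀ hx₁ (by norm_num) (by norm_num) hab, ?_⟩
      intro φ hφ h
      rw [lift_combo hab, map_add, map_smul, map_smul, smul_eq_mul, smul_eq_mul] at h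
      have hn0 := hΦ.nonneg (hsub hφ) (hGP hx₀)
      have hn1 := hΦ.nonneg (hsub hφ) (hGP hx₁)
      rcases hφ with rfl | hφ
      · exact (h₁ (by linarith)).elim
      · exact h₀ φ hφ (by linarith)

/-- A face spans the common kernel of the facet functionals vanishing on it. -/
lemma mem_liftSpan_zeroFace_iff (hΦ : IsFacetSystem P Φ) {ψ : Module.Dual ℝ (Space d × ℝ)}
    (hψ : ∀ x ∈ P, 0 ≤ ψ (lift x)) (hne : (zeroFace P ψ).Nonempty) {y : Space d × ℝ} :
    y ∈ liftSpan (zeroFace P ψ) ↔ ∀ φ ∈ vanishing Φ (zeroFace P ψ), φ y = 0 := by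
  constructor
  · intro hy φ hφ
    exact liftSpan_le_ker.2 hφ.2 hy
  · intro hy
    obtain ⟨x₀, hx₀, h₀⟩ := hΦ.exists_generic (convex_zeroFace hΦ.convex ψ) (fun x hx => hx.1) hne
    have hx₀P := (hΦ.mem_iff x₀).1 hx₀.1
    obtain ⟨ε, hε, c, hc, x, hx, hcx⟩ := exists_perturb hΦ.finite hx₀P (y := y)
      fun φ hφ h => (hy φ (h₀ φ hφ h)).ge
    obtain ⟨ε', hε', c', hc', x', hx', hcx'⟩ := exists_perturb hΦ.finite hx₀P (y := -y)
      fun φ hφ h => by rw [map_neg, hy φ (h₀ φ hφ h), neg_zero]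
    have h1 := hψ x ((hΦ.mem_iff x).2 hx)
    have h2 := hψ x' ((hΦ.mem_iff x').2 hx')
    have e1 := congrArg ψ hcx
    have e2 := congrArg ψ hcx'
    simp only [map_smul, map_add, smul_eq_mul, hx₀.2, zero_add, map_neg] at e1 e2
    have h3 : 0 ≤ ψ y := nonneg_of_mul_nonneg_right (e1 ▸ mul_nonneg hc.le h1) hε
    have h4 : 0 ≤ -ψ y := nonneg_of_mul_nonneg_right (e2 ▸ mul_nonneg hc'.le h2) hε'
    have h5 : ψ y = 0 := by linarith
    have hxG : x ∈ zeroFace P ψ := by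
      refine ⟨(hΦ.mem_iff x).2 hx, ?_⟩
      rw [h5, mul_zero] at e1
      exact (mul_eq_zero.1 e1).resolve_left hc.ne'
    have h6 : y = ε⁻¹ • (c • lift x - lift x₀) := by
      rw [hcx, add_sub_cancel_left, smul_smul, inv_mul_cancel₀ hε.ne', one_smul]
    rw [h6]
    exact Submodule.smul_mem _ _ (sub_mem (Submodule.smul_mem _ _ (lift_mem_liftSpan hxG))
      (lift_mem_liftSpan hx₀))

/-- A nonempty face is cut out by the facet functionals vanishing on it. -/
lemma mem_zeroFace_iff (hΦ : IsFacetSystem P Φ) {ψ : Module.Dual ℝ (Space d × ℝ)}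
    (hψ : ∀ x ∈ P, 0 ≤ ψ (lift x)) (hne : (zeroFace P ψ).Nonempty) {x : Space d} :
    x ∈ zeroFace P ψ ↔ x ∈ P ∧ ∀ φ ∈ vanishing Φ (zeroFace P ψ), φ (lift x) = 0 := by
  constructor
  · exact fun hx => ⟨hx.1, fun φ hφ => hφ.2 x hx⟩
  · rintro ⟨hx, h⟩
    have := (hΦ.mem_liftSpan_zeroFace_iff hψ hne).2 h
    exact ⟨hx, liftSpan_le_ker.2 (fun x hx => hx.2) this⟩

/-- The codimension of a face is the rank of the facet functionals vanishing on it. -/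
lemma finrank_add (hΦ : IsFacetSystem P Φ) {ψ : Module.Dual ℝ (Space d × ℝ)}
    (hψ : ∀ x ∈ P, 0 ≤ ψ (lift x)) (hne : (zeroFace P ψ).Nonempty) :
    Module.finrank ℝ (Submodule.span ℝ (vanishing Φ (zeroFace P ψ))) +
      Module.finrank ℝ (liftSpan (zeroFace P ψ)) = d + 1 := by
  have h : liftSpan (zeroFace P ψ) =
      (Submodule.span ℝ (vanishing Φ (zeroFace P ψ))).dualCoannihilator := by
    ext y
    rw [hΦ.mem_liftSpan_zeroFace_iff hψ hne, Submodule.mem_dualCoannihilator]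
    constructor
    · intro h φ hφ
      induction hφ using Submodule.span_induction with
      | mem φ hφ => exact h φ hφ
      | zero => simp
      | add a b _ _ ha hb => simp [ha, hb]
      | smul c a _ ha => simp [ha]
    · exact fun h φ hφ => h φ (Submodule.subset_span hφ)
  rw [h, Subspace.finrank_add_finrank_dualCoannihilator_eq, finrank_lift_space]

lemma isFacet_zeroFace (hΦ : IsFacetSystem P Φ) (hd : 0 < d)
    {φ : Module.Dual ℝ (Space d × ℝ)} (hφ : φ ∈ Φ) : IsFacet P (zeroFace P φ) := by
  rw [IsFacet, isFaceOfDim_iff]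
  have h := hΦ.facet φ hφ
  refine ⟨⟨φ, h.nonneg, rfl⟩, ?_⟩
  rw [h.liftSpan_eq, finrank_ker_of_ne_zero h.ne_zero]
  omega

lemma exists_of_isFacet (hΦ : IsFacetSystem P Φ) (hd : 0 < d) {H : Set (Space d)}
    (hH : IsFacet P H) : ∃ φ ∈ Φ, H = zeroFace P φ := by
  have hne := hH.2.1
  rw [IsFacet, isFaceOfDim_iff] at hH
  obtain ⟨⟨ψ, hψ, rfl⟩, hrank⟩ := hH
  have hadd := hΦ.finrank_add hψ hne
  have hvne : (vanishing Φ (zeroFace P ψ)).Nonempty := by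
    rw [Set.nonempty_iff_ne_empty]
    intro h0
    rw [h0, Submodule.span_empty, finrank_bot] at hadd
    omega
  obtain ⟨φ, hφ⟩ := hvne
  refine ⟨φ, hφ.1, ?_⟩
  have hker : liftSpan (zeroFace P ψ) = LinearMap.ker φ := by
    apply Submodule.eq_of_le_of_finrank_le (liftSpan_le_ker.2 hφ.2)
    rw [finrank_ker_of_ne_zero (hΦ.facet φ hφ.1).ne_zero]
    omega
  apply Set.Subset.antisymm
  · exact fun x hx => ⟨hx.1, hφ.2 x hx⟩
  · rintro x ⟨hx, hx0⟩
    have : lift x ∈ liftSpan (zeroFace P ψ) := by rw [hker]; exact hx0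
    exact ⟨hx, liftSpan_le_ker.2 (fun x hx => hx.2) this⟩

/-- Facets containing a set correspond to the functionals of a facet system vanishing on it. -/
lemma ncard_facets (hΦ : IsFacetSystem P Φ) (hd : 0 < d) {G : Set (Space d)} (hG : G ⊆ P) :
    {H | IsFacet P H ∧ G ⊆ H}.ncard = (vanishing Φ G).ncard := by
  have h : {H | IsFacet P H ∧ G ⊆ H} = zeroFace P '' vanishing Φ G := by
    ext H
    constructor
    · rintro ⟨hH, hGH⟩
      obtain ⟨φ, hφ, rfl⟩ := hΦ.exists_of_isFacet hd hH
      exact ⟨φ, ⟨hφ, fun x hx => (hGH hx).2⟩, rfl⟩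
    · rintro ⟨φ, hφ, rfl⟩
      exact ⟨hΦ.isFacet_zeroFace hd hφ.1, fun x hx => ⟨hG hx, hφ.2 x hx⟩⟩
  rw [h]
  apply Set.InjOn.ncard_image
  intro φ hφ ψ hψ heq
  apply hΦ.inj φ hφ.1 ψ hψ.1
  rw [← (hΦ.facet φ hφ.1).liftSpan_eq, ← (hΦ.facet ψ hψ.1).liftSpan_eq, heq]

lemma ncard_facets_mem (hΦ : IsFacetSystem P Φ) (hd : 0 < d) {v : Space d} (hv : v ∈ P) :
    {H | IsFacet P H ∧ v ∈ H}.ncard = (vanishing Φ {v}).ncard := by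
  simpa using hΦ.ncard_facets hd (G := {v}) (by simpa using hv)

end IsFacetSystem

/-- The points of `P` where finitely many nonnegative functionals vanish form a face. -/
lemma exists_sum_functional {P : Set (Space d)} {S : Set (Module.Dual ℝ (Space d × ℝ))}
    (hS : S.Finite) (h : ∀ φ ∈ S, ∀ x ∈ P, 0 ≤ φ (lift x)) :
    ∃ ψ : Module.Dual ℝ (Space d × ℝ), (∀ x ∈ P, 0 ≤ ψ (lift x)) ∧
      zeroFace P ψ = {x ∈ P | ∀ φ ∈ S, φ (lift x) = 0} := by
  refine ⟨∑ φ ∈ hS.toFinset, φ, fun x hx => ?_, ?_⟩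
  · rw [LinearMap.sum_apply]
    exact Finset.sum_nonneg fun φ hφ => h φ (hS.mem_toFinset.1 hφ) x hx
  · ext x
    refine and_congr_right fun hx => ?_
    rw [LinearMap.sum_apply, Finset.sum_eq_zero_iff_of_nonneg
      fun φ hφ => h φ (hS.mem_toFinset.1 hφ) x hx]
    simp

lemma vertexSet_subset_extremePoints (P : Set (Space d)) :
    vertexSet P ⊆ P.extremePoints ℝ := fun _ hv =>
  isExtreme_singleton.1 (IsExposed.isExtreme hv.1)

/-- In a polytope, extreme points are exposed: the facet inequalities tight at an extreme point have
no other common solution. -/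
lemma extremePoints_subset_vertexSet {P : Set (Space d)} (hP : IsDPolytope P) :
    P.extremePoints ℝ ⊆ vertexSet P := by
  obtain ⟨Φ, -, hΦ⟩ := hP.exists_facetSystem ∅ (by simp) (by simp)
  intro v hv
  rw [mem_extremePoints] at hv
  obtain ⟨ψ, hψ, hz⟩ := exists_sum_functional (hΦ.vanishing_finite {v})
    (fun φ hφ x hx => hΦ.nonneg hφ.1 hx)
  refine mem_vertexSet_iff.2 ⟨ψ, hψ, ?_⟩
  rw [hz]
  apply Set.Subset.antisymm
  · rintro _ rfl
    exact ⟨hv.1, fun φ hφ => hφ.2 _ rfl⟩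
  · rintro x ⟨hx, hx0⟩
    obtain ⟨ε, hε, c, hc, x', hx', hcx⟩ := exists_perturb hΦ.finite ((hΦ.mem_iff v).1 hv.1)
      (y := lift v - lift x) fun φ hφ h => by
        rw [map_sub, h, hx0 φ ⟨hφ, by simpa using h⟩, sub_zero]
    have hc1 : c = 1 := by simpa using congrArg Prod.snd hcx
    have hx'v : x' = v + ε • (v - x) := by simpa [hc1] using congrArg Prod.fst hcx
    have hseg : v ∈ openSegment ℝ x x' := by
      refine ⟨ε / (1 + ε), 1 / (1 + ε), by positivity, by positivity, ?_, ?_⟩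
      · field_simp
        ring
      · rw [hx'v]
        have : (1 + ε) ≠ 0 := by positivity
        have h1 : v = (1 / (1 + ε)) • ((1 + ε) • v) := by
          rw [smul_smul]; field_simp; simp
        nth_rw 3 [h1]
        module
    exact (hv.2 x hx x' ((hΦ.mem_iff x').2 hx') hseg).1

lemma IsDPolytope.vertexSet_eq {P : Set (Space d)} (hP : IsDPolytope P) :
    vertexSet P = P.extremePoints ℝ :=
  (vertexSet_subset_extremePoints P).antisymm (extremePoints_subset_vertexSet hP)

lemma IsDPolytope.vertexSet_finite {P : Set (Space d)} (hP : IsDPolytope P) :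
    (vertexSet P).Finite := by
  rw [hP.vertexSet_eq]
  obtain ⟨⟨s, hs, rfl⟩, -⟩ := hP
  exact hs.subset extremePoints_convexHull_subset

lemma IsDPolytope.convexHull_vertexSet {P : Set (Space d)} (hP : IsDPolytope P) :
    convexHull ℝ (vertexSet P) = P := by
  have hfin := hP.vertexSet_finite
  have h := (hfin.isClosed_convexHull ℝ).closure_eq
  rw [← h, hP.vertexSet_eq]
  have hP' := hP
  obtain ⟨⟨s, hs, rfl⟩, -⟩ := hP'
  exact closure_convexHull_extremePoints (hs.isCompact_convexHull ℝ) (convex_convexHull ℝ s)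

lemma vertexSet_subset (P : Set (Space d)) : vertexSet P ⊆ P :=
  fun _ hv => (vertexSet_subset_extremePoints P hv).1

/-! ### Polytopes in position for merging -/

/-- `β₀, β₁, …, β_d` are the barycentric coordinates, as linear functionals on `ℝ^d × ℝ`, of the
`d`-simplex with vertices `v, u₁, …, u_d`. -/
structure IsBarycentric (v : Space d) (u : Fin d → Space d) (β₀ : Module.Dual ℝ (Space d × ℝ))
    (β : Fin d → Module.Dual ℝ (Space d × ℝ)) : Prop where
  zero_apex : β₀ (lift v) = 1
  zero_base : ∀ k, β₀ (lift (u k)) = 0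
  apex : ∀ j, β j (lift v) = 0
  base : ∀ j k, β j (lift (u k)) = if j = k then 1 else 0
  decomp : ∀ y, y = β₀ y • lift v + ∑ k, β k y • lift (u k)

lemma exists_barycentric {v : Space d} {u : Fin d → Space d}
    (h : LinearIndependent ℝ (fun o : Option (Fin d) => lift (o.elim v u))) :
    ∃ β₀ β, IsBarycentric v u β₀ β := by
  let b := basisOfLinearIndependentOfCardEqFinrank h (by simp)
  have hb : ∀ o : Option (Fin d), b o = lift (o.elim v u) := fun o => by
    simp [b]
  have hv : lift v = b none := (hb none).symm
  have hu : ∀ k, lift (u k) = b (some k) := fun k => (hb (some k)).symm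
  refine ⟨b.coord none, fun k => b.coord (some k), ?_, ?_, ?_, ?_, ?_⟩
  · simp [hv]
  · intro k; simp [hu]
  · intro j; simp [hv]
  · intro j k
    simp only [hu, Module.Basis.coord_apply, Module.Basis.repr_self, Finsupp.single_apply,
      Option.some.injEq, eq_comm]
  · intro y
    conv_lhs => rw [← b.sum_repr y, Fintype.sum_option]
    simp [hv, hu]

namespace IsBarycentric

variable {v : Space d} {u : Fin d → Space d} {β₀ : Module.Dual ℝ (Space d × ℝ)}
  {β : Fin d → Module.Dual ℝ (Space d × ℝ)}

lemma apply (h : IsBarycentric v u β₀ β) (φ : Module.Dual ℝ (Space d × ℝ)) (y : Space d × ℝ) :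
    φ y = β₀ y * φ (lift v) + ∑ k, β k y * φ (lift (u k)) := by
  conv_lhs => rw [h.decomp y]
  simp

lemma sum_eq_one (h : IsBarycentric v u β₀ β) (x : Space d) :
    β₀ (lift x) + ∑ k, β k (lift x) = 1 := by
  have := h.apply (LinearMap.snd ℝ _ _) (lift x)
  simpa using this.symm

lemma point_eq (h : IsBarycentric v u β₀ β) (x : Space d) :
    x = β₀ (lift x) • v + ∑ k, β k (lift x) • u k := by
  have := congrArg Prod.fst (h.decomp (lift x))
  simpa [Prod.fst_sum] using this

lemma linearIndependent_coords (h : IsBarycentric v u β₀ β) : LinearIndependent ℝ β := by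
  rw [Fintype.linearIndependent_iff]
  intro g hg k
  have := congrArg (fun φ : Module.Dual ℝ (Space d × ℝ) => φ (lift (u k))) hg
  simpa [LinearMap.sum_apply, h.base] using this

lemma finrank_span_eq_ncard (h : IsBarycentric v u β₀ β)
    {S : Set (Module.Dual ℝ (Space d × ℝ))} (hS : S ⊆ Set.range β) :
    Module.finrank ℝ (Submodule.span ℝ S) = S.ncard := by
  have hfin : S.Finite := (Set.finite_range β).subset hS
  have := hfin.fintype
  rw [finrank_span_set_eq_card, Set.ncard_eq_toFinset_card']
  exact h.linearIndependent_coords.linearIndepOn_id.mono hS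

lemma linearIndependent_vertices (h : IsBarycentric v u β₀ β) :
    LinearIndependent ℝ (fun o : Option (Fin d) => lift (o.elim v u)) := by
  rw [Fintype.linearIndependent_iff]
  intro g hg o
  rw [Fintype.sum_option] at hg
  cases o with
  | none =>
    have := congrArg β₀ hg
    simpa [h.zero_apex, h.zero_base] using this
  | some k =>
    have := congrArg (β k) hg
    simpa [h.apex, h.base] using this

lemma linearIndependent_base (h : IsBarycentric v u β₀ β) :
    LinearIndependent ℝ (fun k => lift (u k)) :=
  h.linearIndependent_vertices.comp some (Option.some_injective _)

lemma base_injective (h : IsBarycentric v u β₀ β) : Function.Injective u := fun _ _ hjk =>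
  h.linearIndependent_base.injective (congrArg lift hjk)

lemma base_ne_apex (h : IsBarycentric v u β₀ β) (k : Fin d) : u k ≠ v := fun hk => by
  have := h.zero_base k
  rw [hk, h.zero_apex] at this
  exact one_ne_zero this

lemma mem_convexHull_base (h : IsBarycentric v u β₀ β) {x : Space d} (h0 : β₀ (lift x) = 0)
    (hx : ∀ k, 0 ≤ β k (lift x)) : x ∈ convexHull ℝ (Set.range u) := by
  have h1 := h.sum_eq_one x
  rw [h0, zero_add] at h1
  rw [h.point_eq x, h0, zero_smul, zero_add]
  exact (convex_convexHull ℝ _).sum_mem (fun k _ => hx k) h1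
    fun k _ => subset_convexHull ℝ _ ⟨k, rfl⟩

lemma mem_convexHull_insert (h : IsBarycentric v u β₀ β) {x : Space d} :
    x ∈ convexHull ℝ (insert v (Set.range u)) ↔ 0 ≤ β₀ (lift x) ∧ ∀ k, 0 ≤ β k (lift x) := by
  constructor
  · intro hx
    refine ⟨nonneg_on_convexHull (φ := β₀) ?_ x hx, fun j => nonneg_on_convexHull ?_ x hx⟩
    · rintro _ (rfl | ⟨k, rfl⟩)
      · simp [h.zero_apex]
      · simp [h.zero_base]
    · rintro _ (rfl | ⟨k, rfl⟩)
      · simp [h.apex]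
      · rw [h.base]; split_ifs <;> norm_num
  · rintro ⟨h0, hk⟩
    have h1 := h.sum_eq_one x
    have h2 : x = ∑ o : Option (Fin d), (o.elim (β₀ (lift x)) fun k => β k (lift x)) •
        (o.elim v u : Space d) := by
      rw [Fintype.sum_option]
      exact h.point_eq x
    rw [h2]
    refine (convex_convexHull ℝ _).sum_mem (fun o _ => ?_) ?_ (fun o _ => ?_)
    · cases o
      exacts [h0, hk _]
    · rw [Fintype.sum_option]; exact h1
    · apply subset_convexHull
      cases o
      exacts [Set.mem_insert _ _, Set.mem_insert_of_mem _ ⟨_, rfl⟩]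

lemma isSimplex_convexHull (h : IsBarycentric v u β₀ β) :
    IsSimplex d (convexHull ℝ (insert v (Set.range u))) := by
  let e : Fin (d + 1) ≃ Option (Fin d) := finSuccEquiv d
  refine ⟨fun i => (e i).elim v u, ?_, ?_⟩
  · rw [affineIndependent_iff_lift]
    exact h.linearIndependent_vertices.comp e e.injective
  · congr 1
    ext x
    constructor
    · rintro (rfl | ⟨k, rfl⟩)
      · exact ⟨e.symm none, by simp⟩
      · exact ⟨e.symm (some k), by simp⟩
    · rintro ⟨i, rfl⟩
      dsimp only
      cases e i
      exacts [Set.mem_insert _ _, Set.mem_insert_of_mem _ ⟨_, rfl⟩]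

end IsBarycentric

/-- A vertex of `P` that lies in the convex hull of a set of points of `P` is one of them. -/
lemma mem_of_mem_vertexSet_of_mem_convexHull {P s : Set (Space d)} {x : Space d}
    (hx : x ∈ vertexSet P) (hs : convexHull ℝ s ⊆ P) (hxs : x ∈ convexHull ℝ s) : x ∈ s :=
  extremePoints_convexHull_subset
    (inter_extremePoints_subset_extremePoints_of_subset hs
      ⟨hxs, vertexSet_subset_extremePoints P hx⟩)

/-- Two polytopes in position for merging: `K₁` lies in the simplex with vertices
`v, u₁, …, u_d`, of which all the facet hyperplanes support facets of `K₁`, while `K₂` has the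
simple vertex `v` with neighbors `u₁, …, u_d`. The facet systems are normalized so that
they share the barycentric coordinates `β`. -/
structure IsMergePosition (v : Space d) (u : Fin d → Space d)
    (β₀ : Module.Dual ℝ (Space d × ℝ)) (β : Fin d → Module.Dual ℝ (Space d × ℝ))
    (K₁ K₂ : Set (Space d)) (Φ₁ Φ₂ : Set (Module.Dual ℝ (Space d × ℝ))) : Prop where
  bary : IsBarycentric v u β₀ β
  poly₁ : IsDPolytope K₁
  poly₂ : IsDPolytope K₂
  sys₁ : IsFacetSystem K₁ Φ₁
  sys₂ : IsFacetSystem K₂ Φ₂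
  zero_mem₁ : β₀ ∈ Φ₁
  mem₁ : ∀ j, β j ∈ Φ₁
  mem₂ : ∀ j, β j ∈ Φ₂
  base_mem₁ : ∀ k, u k ∈ K₁
  apex_vertex : v ∈ vertexSet K₂
  base_vertex : ∀ k, u k ∈ vertexSet K₂
  eq_of_apex : ∀ φ ∈ Φ₂, φ (lift v) = 0 → φ ∈ Set.range β

/-- The merge of two polytopes that are already in position: `K₂` with its vertex `v` cut off,
glued to `K₁`. -/
def mergedBody (v : Space d) (K₁ K₂ : Set (Space d)) : Set (Space d) :=
  K₁ ∪ convexHull ℝ (vertexSet K₂ \ {v})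

namespace IsMergePosition

variable {v : Space d} {u : Fin d → Space d} {β₀ : Module.Dual ℝ (Space d × ℝ)}
  {β : Fin d → Module.Dual ℝ (Space d × ℝ)} {K₁ K₂ : Set (Space d)}
  {Φ₁ Φ₂ : Set (Module.Dual ℝ (Space d × ℝ))}

/-- Cutting off the apex of `K₂` amounts to intersecting `K₂` with a half-space. -/
lemma mem_cap_iff (h : IsMergePosition v u β₀ β K₁ K₂ Φ₁ Φ₂) {x : Space d} :
    x ∈ convexHull ℝ (vertexSet K₂ \ {v}) ↔ x ∈ K₂ ∧ β₀ (lift x) ≤ 0 := by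
  have hsub : convexHull ℝ (vertexSet K₂ \ {v}) ⊆ K₂ :=
    convexHull_min (fun x hx => vertexSet_subset _ hx.1) h.poly₂.convex
  have hle : ∀ x ∈ convexHull ℝ (vertexSet K₂ \ {v}), β₀ (lift x) ≤ 0 := by
    intro x hx
    suffices 0 ≤ (-β₀) (lift x) by simpa using this
    refine nonneg_on_convexHull ?_ x hx
    rintro w ⟨hw, hwv⟩
    -- A vertex on the side of `v` would lie in the simplex, hence would be one of its vertices.
    by_contra hneg
    have hpos : 0 < β₀ (lift w) := by simpa using hneg
    have hmem := mem_of_mem_vertexSet_of_mem_convexHull hw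
      (convexHull_min (s := insert v (Set.range u)) ?_ h.poly₂.convex)
      (h.bary.mem_convexHull_insert.2 ⟨hpos.le,
        fun k => h.sys₂.nonneg (h.mem₂ k) (vertexSet_subset _ hw)⟩)
    · rcases hmem with rfl | ⟨k, rfl⟩
      · exact hwv rfl
      · exact hpos.ne' (h.bary.zero_base k)
    · rintro _ (rfl | ⟨k, rfl⟩)
      exacts [vertexSet_subset _ h.apex_vertex, vertexSet_subset _ (h.base_vertex k)]
  refine ⟨fun hx => ⟨hsub hx, hle x hx⟩, ?_⟩
  rintro ⟨hx, hx0⟩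
  rcases Nat.eq_zero_or_pos d with rfl | hd
  · have : x = v := Subsingleton.elim _ _
    rw [this, h.bary.zero_apex] at hx0
    norm_num at hx0
  have hbase : ∀ k, u k ∈ vertexSet K₂ \ {v} := fun k =>
    ⟨h.base_vertex k, h.bary.base_ne_apex k⟩
  rw [← h.poly₂.convexHull_vertexSet, ← Set.insert_eq_of_mem h.apex_vertex,
    ← Set.insert_sdiff_singleton, convexHull_insert ⟨_, hbase ⟨0, hd⟩⟩, mem_convexJoin] at hx
  obtain ⟨v', hv', y, hy, a, b, ha, hb, hab, rfl⟩ := hx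
  obtain rfl : v = v' := (Set.mem_singleton_iff.1 hv').symm
  have hy0 := hle y hy
  rw [lift_combo hab, map_add, map_smul, map_smul, h.bary.zero_apex, smul_eq_mul, mul_one,
    smul_eq_mul] at hx0
  -- The segment from the apex to `y` crosses the wall at `z`.
  set c := β₀ (lift y) with hc
  have h1c : 0 < 1 - c := by linarith
  have hts : -c / (1 - c) + 1 / (1 - c) = 1 := by field_simp; ring
  have hz : (-c / (1 - c)) • v + (1 / (1 - c)) • y ∈ convexHull ℝ (vertexSet K₂ \ {v}) := by
    refine convexHull_mono (Set.range_subset_iff.2 hbase) (h.bary.mem_convexHull_base ?_ ?_)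
    · rw [lift_combo hts, map_add, map_smul, map_smul, h.bary.zero_apex, ← hc]
      simp only [smul_eq_mul]
      field_simp
      ring
    · intro k
      rw [lift_combo hts, map_add, map_smul, map_smul, h.bary.apex]
      have := h.sys₂.nonneg (h.mem₂ k) (hsub hy)
      simp only [smul_eq_mul, mul_zero, zero_add]
      positivity
  rcases hy0.eq_or_lt with h0 | hlt
  · rw [h0] at hx0
    have : a = 0 := by linarith
    subst this
    rw [zero_add] at hab
    subst hab
    simpa using hy
  · have hcomb : a • v + b • y = (a * (1 - c) / (-c)) • ((-c / (1 - c)) • v + (1 / (1 - c)) • y)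
        + (1 - a * (1 - c) / (-c)) • y := by
      have hcne : c ≠ 0 := hlt.ne
      have h1ne : 1 - c ≠ 0 := h1c.ne'
      have e1 : a * (1 - c) / (-c) * (-c / (1 - c)) = a := by field_simp
      have e2 : a * (1 - c) / (-c) * (1 / (1 - c)) + (1 - a * (1 - c) / (-c)) = b := by
        rw [← sub_eq_iff_eq_add'.2 hab.symm]
        field_simp
        ring
      rw [smul_add, smul_smul, smul_smul, e1, add_assoc, ← add_smul, e2]
    rw [hcomb]
    refine (convex_convexHull ℝ _) hz hy ?_ ?_ (by ring)
    · exact div_nonneg (mul_nonneg ha h1c.le) (by linarith)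
    · rw [sub_nonneg, div_le_one (by linarith)]
      have : b = 1 - a := by linarith
      rw [this] at hx0
      linarith

/-- The apex violates each inequality of `K₁` that is not one of the simplex. Otherwise the
functional would be a nonnegative combination of the barycentric coordinates, and its zero set on
`K₁` would have too small a dimension. -/
lemma neg_apex (h : IsMergePosition v u β₀ β K₁ K₂ Φ₁ Φ₂) {φ : Module.Dual ℝ (Space d × ℝ)}
    (hφ : φ ∈ Φ₁) (h0 : φ ≠ β₀) (hβ : φ ∉ Set.range β) : φ (lift v) < 0 := by
  by_contra! hv
  have hu : ∀ k, 0 ≤ φ (lift (u k)) := fun k => h.sys₁.nonneg hφ (h.base_mem₁ k)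
  have hf := h.sys₁.facet φ hφ
  -- A coordinate entering `φ` with a positive coefficient vanishes wherever `φ` does on `K₁`.
  have key : ∀ ψ ∈ Φ₁, (∀ x ∈ zeroFace K₁ φ, ψ (lift x) = 0) → φ = ψ := by
    intro ψ hψ hz
    apply h.sys₁.inj φ hφ ψ hψ
    apply Submodule.eq_of_le_of_finrank_le
    · rw [← hf.liftSpan_eq]; exact liftSpan_le_ker.2 hz
    · rw [finrank_ker_of_ne_zero hf.ne_zero,
        finrank_ker_of_ne_zero (h.sys₁.facet ψ hψ).ne_zero]
  have hterms : ∀ x ∈ zeroFace K₁ φ, β₀ (lift x) * φ (lift v) = 0 ∧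
      ∀ k, β k (lift x) * φ (lift (u k)) = 0 := by
    rintro x ⟨hx, hx0⟩
    rw [h.bary.apply φ] at hx0
    have n0 := mul_nonneg (h.sys₁.nonneg h.zero_mem₁ hx) hv
    have nk : ∀ k ∈ Finset.univ, 0 ≤ β k (lift x) * φ (lift (u k)) := fun k _ =>
      mul_nonneg (h.sys₁.nonneg (h.mem₁ k) hx) (hu k)
    have ns := Finset.sum_nonneg nk
    refine ⟨by linarith, fun k => ?_⟩
    exact (Finset.sum_eq_zero_iff_of_nonneg nk).1 (by linarith) k (Finset.mem_univ k)
  have hv0 : φ (lift v) = 0 := by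
    by_contra hne
    exact h0 (key β₀ h.zero_mem₁ fun x hx => (mul_eq_zero.1 (hterms x hx).1).resolve_right hne)
  have hu0 : ∀ k, φ (lift (u k)) = 0 := by
    intro k
    by_contra hne
    exact hβ ⟨k, (key (β k) (h.mem₁ k) fun x hx =>
      (mul_eq_zero.1 ((hterms x hx).2 k)).resolve_right hne).symm⟩
  apply hf.ne_zero
  refine LinearMap.ext fun y => ?_
  rw [h.bary.apply φ y]
  simp [hv0, hu0]

lemma pos_apex (h : IsMergePosition v u β₀ β K₁ K₂ Φ₁ Φ₂) {φ : Module.Dual ℝ (Space d × ℝ)}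
    (hφ : φ ∈ Φ₂) (hβ : φ ∉ Set.range β) : 0 < φ (lift v) :=
  (h.sys₂.nonneg hφ (vertexSet_subset _ h.apex_vertex)).lt_of_ne'
    fun h0 => hβ (h.eq_of_apex φ hφ h0)

/-- Beyond the wall `β₀ = 0`, the inequalities of `K₁` hold, and they are strict off the wall. -/
lemma nonneg_beyond (h : IsMergePosition v u β₀ β K₁ K₂ Φ₁ Φ₂)
    {φ : Module.Dual ℝ (Space d × ℝ)} (hφ : φ ∈ Φ₁) (h0 : φ ≠ β₀) (hβ : φ ∉ Set.range β)
    {x : Space d} (hx : ∀ k, 0 ≤ β k (lift x)) (hx0 : β₀ (lift x) ≤ 0) :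
    0 ≤ φ (lift x) ∧ (φ (lift x) = 0 → β₀ (lift x) = 0) := by
  have hv := h.neg_apex hφ h0 hβ
  have ns : 0 ≤ ∑ k, β k (lift x) * φ (lift (u k)) := Finset.sum_nonneg fun k _ =>
    mul_nonneg (hx k) (h.sys₁.nonneg hφ (h.base_mem₁ k))
  have n0 := mul_nonneg_of_nonpos_of_nonpos hx0 hv.le
  rw [h.bary.apply φ]
  refine ⟨by linarith, fun hz => ?_⟩
  exact (mul_eq_zero.1 (by linarith : β₀ (lift x) * φ (lift v) = 0)).resolve_right hv.ne

/-- Inside the simplex, the inequalities of `K₂` hold, and those not tight at the apex are strict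
off the wall. -/
lemma nonneg_inside (h : IsMergePosition v u β₀ β K₁ K₂ Φ₁ Φ₂)
    {φ : Module.Dual ℝ (Space d × ℝ)} (hφ : φ ∈ Φ₂) (hβ : φ ∉ Set.range β)
    {x : Space d} (hx : ∀ k, 0 ≤ β k (lift x)) (hx0 : 0 ≤ β₀ (lift x)) :
    0 ≤ φ (lift x) ∧ (φ (lift x) = 0 → β₀ (lift x) = 0) := by
  have hv := h.pos_apex hφ hβ
  have ns : 0 ≤ ∑ k, β k (lift x) * φ (lift (u k)) := Finset.sum_nonneg fun k _ =>
    mul_nonneg (hx k) (h.sys₂.nonneg hφ (vertexSet_subset _ (h.base_vertex k)))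
  have n0 := mul_nonneg hx0 hv.le
  rw [h.bary.apply φ]
  refine ⟨by linarith, fun hz => ?_⟩
  exact (mul_eq_zero.1 (by linarith : β₀ (lift x) * φ (lift v) = 0)).resolve_right hv.ne'

lemma wall_mem₁ (h : IsMergePosition v u β₀ β K₁ K₂ Φ₁ Φ₂) {x : Space d}
    (hx : ∀ k, 0 ≤ β k (lift x)) (hx0 : β₀ (lift x) = 0) : x ∈ K₁ :=
  convexHull_min (Set.range_subset_iff.2 h.base_mem₁) h.poly₁.convex
    (h.bary.mem_convexHull_base hx0 hx)

lemma wall_mem₂ (h : IsMergePosition v u β₀ β K₁ K₂ Φ₁ Φ₂) {x : Space d}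
    (hx : ∀ k, 0 ≤ β k (lift x)) (hx0 : β₀ (lift x) = 0) : x ∈ K₂ :=
  convexHull_min (Set.range_subset_iff.2 fun k => vertexSet_subset _ (h.base_vertex k))
    h.poly₂.convex (h.bary.mem_convexHull_base hx0 hx)

/-- The merged body satisfies the inequalities of both polytopes, except for the wall, and no others
are needed. -/
lemma mem_mergedBody_iff (h : IsMergePosition v u β₀ β K₁ K₂ Φ₁ Φ₂) {x : Space d} :
    x ∈ mergedBody v K₁ K₂ ↔ ∀ φ ∈ Φ₁ \ {β₀} ∪ Φ₂, 0 ≤ φ (lift x) := by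
  constructor
  · rintro (hx | hx) φ hφ
    · rcases hφ with hφ | hφ
      · exact h.sys₁.nonneg hφ.1 hx
      · by_cases hβ : φ ∈ Set.range β
        · obtain ⟨j, rfl⟩ := hβ
          exact h.sys₁.nonneg (h.mem₁ j) hx
        · exact (h.nonneg_inside hφ hβ (fun k => h.sys₁.nonneg (h.mem₁ k) hx)
            (h.sys₁.nonneg h.zero_mem₁ hx)).1
    · rw [h.mem_cap_iff] at hx
      rcases hφ with hφ | hφ
      · by_cases hβ : φ ∈ Set.range β
        · obtain ⟨j, rfl⟩ := hβ
          exact h.sys₂.nonneg (h.mem₂ j) hx.1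
        · exact (h.nonneg_beyond hφ.1 hφ.2 hβ (fun k => h.sys₂.nonneg (h.mem₂ k) hx.1) hx.2).1
      · exact h.sys₂.nonneg hφ hx.1
  · intro hx
    rcases le_total 0 (β₀ (lift x)) with h0 | h0
    · left
      rw [h.sys₁.mem_iff]
      intro φ hφ
      by_cases hφ0 : φ = β₀
      · rwa [hφ0]
      · exact hx φ (Or.inl ⟨hφ, hφ0⟩)
    · right
      rw [h.mem_cap_iff]
      exact ⟨(h.sys₂.mem_iff x).2 fun φ hφ => hx φ (Or.inr hφ), h0⟩

lemma mergedBody_coord_nonneg (h : IsMergePosition v u β₀ β K₁ K₂ Φ₁ Φ₂) {x : Space d}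
    (hx : x ∈ mergedBody v K₁ K₂) (k : Fin d) : 0 ≤ β k (lift x) :=
  h.mem_mergedBody_iff.1 hx _ (Or.inr (h.mem₂ k))

/-- On the merged body, a facet functional of `K₁` off the simplex vanishes only on `K₁`. -/
lemma mem₁_of_zero (h : IsMergePosition v u β₀ β K₁ K₂ Φ₁ Φ₂)
    {φ : Module.Dual ℝ (Space d × ℝ)} (hφ : φ ∈ Φ₁) (h0 : φ ≠ β₀) (hβ : φ ∉ Set.range β)
    {x : Space d} (hx : x ∈ mergedBody v K₁ K₂) (hx0 : φ (lift x) = 0) : x ∈ K₁ := by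
  have hk := h.mergedBody_coord_nonneg hx
  rcases hx with hx | hx
  · exact hx
  · exact h.wall_mem₁ hk ((h.nonneg_beyond hφ h0 hβ hk (h.mem_cap_iff.1 hx).2).2 hx0)

/-- On the merged body, a facet functional of `K₂` that is not tight at the apex vanishes only
on `K₂`. -/
lemma mem₂_of_zero (h : IsMergePosition v u β₀ β K₁ K₂ Φ₁ Φ₂)
    {φ : Module.Dual ℝ (Space d × ℝ)} (hφ : φ ∈ Φ₂) (hβ : φ ∉ Set.range β)
    {x : Space d} (hx : x ∈ mergedBody v K₁ K₂) (hx0 : φ (lift x) = 0) : x ∈ K₂ := by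
  have hk := h.mergedBody_coord_nonneg hx
  rcases hx with hx | hx
  · exact h.wall_mem₂ hk ((h.nonneg_inside hφ hβ hk (h.sys₁.nonneg h.zero_mem₁ hx)).2 hx0)
  · exact (h.mem_cap_iff.1 hx).1

/-- The facets of `K₂` off the apex survive in the merged body. -/
lemma zeroFace_mergedBody₂ (h : IsMergePosition v u β₀ β K₁ K₂ Φ₁ Φ₂)
    {φ : Module.Dual ℝ (Space d × ℝ)} (hφ : φ ∈ Φ₂) (hβ : φ ∉ Set.range β) :
    zeroFace (mergedBody v K₁ K₂) φ = zeroFace K₂ φ := by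
  apply Set.Subset.antisymm
  · rintro x ⟨hx, hx0⟩
    exact ⟨h.mem₂_of_zero hφ hβ hx hx0, hx0⟩
  · rintro x ⟨hx, hx0⟩
    refine ⟨Or.inr (h.mem_cap_iff.2 ⟨hx, ?_⟩), hx0⟩
    by_contra! hpos
    exact hpos.ne' ((h.nonneg_inside hφ hβ (fun k => h.sys₂.nonneg (h.mem₂ k) hx) hpos.le).2 hx0)

lemma facet_mergedBody (h : IsMergePosition v u β₀ β K₁ K₂ Φ₁ Φ₂)
    {φ : Module.Dual ℝ (Space d × ℝ)} (hφ : φ ∈ Φ₁ \ {β₀} ∪ Φ₂) :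
    IsFacetFunctional (mergedBody v K₁ K₂) φ := by
  have hnn : ∀ x ∈ mergedBody v K₁ K₂, 0 ≤ φ (lift x) := fun x hx =>
    h.mem_mergedBody_iff.1 hx φ hφ
  have key : φ ∈ Φ₁ → IsFacetFunctional (mergedBody v K₁ K₂) φ := by
    intro hφ₁
    have hf := h.sys₁.facet φ hφ₁
    refine ⟨hf.ne_zero, hnn, le_antisymm (liftSpan_le_ker.2 fun x hx => hx.2) ?_⟩
    rw [← hf.liftSpan_eq]
    exact liftSpan_mono fun x hx => ⟨Or.inl hx.1, hx.2⟩
  rcases hφ with hφ | hφ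
  · exact key hφ.1
  · by_cases hβ : φ ∈ Set.range β
    · obtain ⟨j, rfl⟩ := hβ
      exact key (h.mem₁ j)
    · have hf := h.sys₂.facet φ hφ
      exact ⟨hf.ne_zero, hnn, by rw [h.zeroFace_mergedBody₂ hφ hβ, hf.liftSpan_eq]⟩

/-- The facets of the merged body are those of the two polytopes without the wall, where the facets
of `K₂` at the apex are identified with the facets of `K₁` on the same hyperplanes. -/
lemma facetSystem (h : IsMergePosition v u β₀ β K₁ K₂ Φ₁ Φ₂) :
    IsFacetSystem (mergedBody v K₁ K₂) (Φ₁ \ {β₀} ∪ Φ₂) := by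
  refine ⟨(h.sys₁.finite.subset Set.sdiff_subset).union h.sys₂.finite,
    fun x => h.mem_mergedBody_iff, fun φ hφ => h.facet_mergedBody hφ, ?_⟩
  have cross : ∀ φ ∈ Φ₁ \ {β₀}, ∀ ψ ∈ Φ₂, LinearMap.ker φ = LinearMap.ker ψ → φ = ψ := by
    intro φ hφ ψ hψ hker
    by_cases hφβ : φ ∈ Set.range β
    · obtain ⟨j, rfl⟩ := hφβ
      exact h.sys₂.inj _ (h.mem₂ j) _ hψ hker
    by_cases hψβ : ψ ∈ Set.range β
    · obtain ⟨j, rfl⟩ := hψβ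
      exact h.sys₁.inj _ hφ.1 _ (h.mem₁ j) hker
    -- The common facet would lie in the wall, so that `φ` would be proportional to `β₀`.
    exfalso
    apply hφ.2
    have hf := h.sys₁.facet φ hφ.1
    apply h.sys₁.inj φ hφ.1 β₀ h.zero_mem₁
    apply Submodule.eq_of_le_of_finrank_le
    · rw [← hf.liftSpan_eq, liftSpan_le_ker]
      rintro x ⟨hx, hx0⟩
      have hψ0 : ψ (lift x) = 0 := by
        rw [← LinearMap.mem_ker, ← hker]; exact hx0
      exact (h.nonneg_inside hψ hψβ (fun k => h.sys₁.nonneg (h.mem₁ k) hx)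
        (h.sys₁.nonneg h.zero_mem₁ hx)).2 hψ0
    · rw [finrank_ker_of_ne_zero hf.ne_zero,
        finrank_ker_of_ne_zero (h.sys₁.facet β₀ h.zero_mem₁).ne_zero]
  rintro φ (hφ | hφ) ψ (hψ | hψ) hker
  · exact h.sys₁.inj φ hφ.1 ψ hψ.1 hker
  · exact cross φ hφ ψ hψ hker
  · exact (cross ψ hψ φ hφ hker.symm).symm
  · exact h.sys₂.inj φ hφ ψ hψ hker

lemma isDPolytope (h : IsMergePosition v u β₀ β K₁ K₂ Φ₁ Φ₂) :
    IsDPolytope (mergedBody v K₁ K₂) := by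
  have hne : (mergedBody v K₁ K₂).Nonempty := h.poly₁.2.1.mono Set.subset_union_left
  refine ⟨⟨vertexSet K₁ ∪ (vertexSet K₂ \ {v}), h.poly₁.vertexSet_finite.union
    (h.poly₂.vertexSet_finite.subset Set.sdiff_subset), ?_⟩, hne, ?_⟩
  · apply Set.Subset.antisymm
    · rintro x (hx | hx)
      · rw [← h.poly₁.convexHull_vertexSet] at hx
        exact convexHull_mono Set.subset_union_left hx
      · exact convexHull_mono Set.subset_union_right hx
    · refine convexHull_min ?_ h.facetSystem.convex
      rintro x (hx | hx)
      · exact Or.inl (vertexSet_subset _ hx)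
      · exact Or.inr (subset_convexHull ℝ _ hx)
  · have h1 := finrank_liftSpan hne
    have h2 : liftSpan (mergedBody v K₁ K₂) = ⊤ := by
      rw [← top_le_iff, ← h.poly₁.liftSpan_eq_top]
      exact liftSpan_mono Set.subset_union_left
    rw [h2, finrank_top, finrank_lift_space] at h1
    omega

end IsMergePosition

/-! ### Faces of the merged body -/

/-- A `k`-simplex in `P` that contains at least `k + 1` vertices of `P` is their convex hull. -/
lemma IsSimplex.eq_convexHull {P G T : Set (Space d)} {k : ℕ} (hG : IsSimplex k G) (hGP : G ⊆ P)
    (hT : T ⊆ vertexSet P) (hTG : T ⊆ G) (hcard : k + 1 ≤ T.ncard) : G = convexHull ℝ T := by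
  obtain ⟨p, -, rfl⟩ := hG
  have hsub : T ⊆ Set.range p := fun x hx =>
    mem_of_mem_vertexSet_of_mem_convexHull (hT hx) hGP (hTG hx)
  have : T = Set.range p := by
    refine Set.eq_of_subset_of_ncard_le hsub (le_trans ?_ hcard) (Set.finite_range p)
    rw [← Set.image_univ]
    exact (Set.ncard_image_le (Set.finite_univ)).trans (by simp [Set.ncard_univ])
  rw [this]

lemma zeroFace_mergedBody_eq {v : Space d} {K₁ K₂ : Set (Space d)}
    {ψ : Module.Dual ℝ (Space d × ℝ)} (hsub : zeroFace (mergedBody v K₁ K₂) ψ ⊆ K₁) :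
    zeroFace (mergedBody v K₁ K₂) ψ = zeroFace K₁ ψ :=
  Set.Subset.antisymm (fun _ hx => ⟨hsub hx, hx.2⟩) fun _ hx => ⟨Or.inl hx.1, hx.2⟩

namespace IsMergePosition

variable {v : Space d} {u : Fin d → Space d} {β₀ : Module.Dual ℝ (Space d × ℝ)}
  {β : Fin d → Module.Dual ℝ (Space d × ℝ)} {K₁ K₂ : Set (Space d)}
  {Φ₁ Φ₂ : Set (Module.Dual ℝ (Space d × ℝ))}

/-- A nonempty face of the merged body is a face of `K₁`, or a face of `K₂`, or it is cut out by
hyperplanes through the apex only. -/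
lemma face_cases (h : IsMergePosition v u β₀ β K₁ K₂ Φ₁ Φ₂)
    {ψ : Module.Dual ℝ (Space d × ℝ)} (hψ : ∀ x ∈ mergedBody v K₁ K₂, 0 ≤ ψ (lift x))
    (hne : (zeroFace (mergedBody v K₁ K₂) ψ).Nonempty) :
    let G := zeroFace (mergedBody v K₁ K₂) ψ
    let S := vanishing (Φ₁ \ {β₀} ∪ Φ₂) G
    ((∃ φ ∈ S, φ ∈ Φ₁ ∧ φ ≠ β₀ ∧ φ ∉ Set.range β) ∧ G ⊆ K₁) ∨
    (S ⊆ Φ₂ ∧ ∃ ψ' : Module.Dual ℝ (Space d × ℝ), (∀ x ∈ K₂, 0 ≤ ψ' (lift x)) ∧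
      G = zeroFace K₂ ψ') ∨
    S ⊆ Set.range β := by
  intro G S
  by_cases hA : ∃ φ ∈ S, φ ∈ Φ₁ ∧ φ ≠ β₀ ∧ φ ∉ Set.range β
  · obtain ⟨φ, hφS, hφ, h0, hβ⟩ := hA
    exact Or.inl ⟨⟨φ, hφS, hφ, h0, hβ⟩, fun x hx => h.mem₁_of_zero hφ h0 hβ hx.1 (hφS.2 x hx)⟩
  right
  by_cases hC : S ⊆ Set.range β
  · exact Or.inr hC
  left
  have hS : S ⊆ Φ₂ := by
    intro φ hφ
    rcases hφ.1 with hφ₁ | hφ₂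
    · by_cases hβ : φ ∈ Set.range β
      · obtain ⟨j, rfl⟩ := hβ
        exact h.mem₂ j
      · exact (hA ⟨φ, hφ, hφ₁.1, hφ₁.2, hβ⟩).elim
    · exact hφ₂
  refine ⟨hS, ?_⟩
  obtain ⟨φ, hφS, hβ⟩ := Set.not_subset.1 hC
  obtain ⟨ψ', hψ', hz⟩ := exists_sum_functional (h.facetSystem.vanishing_finite G) (P := K₂)
    (fun φ hφ x hx => h.sys₂.nonneg (hS hφ) hx)
  refine ⟨ψ', hψ', ?_⟩
  rw [hz]
  ext x
  constructor
  · exact fun hx => ⟨h.mem₂_of_zero (hS hφS) hβ hx.1 (hφS.2 x hx), fun χ hχ => hχ.2 x hx⟩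
  · rintro ⟨hx, hx0⟩
    have hxQ : x ∈ zeroFace (mergedBody v K₁ K₂) φ := by
      rw [h.zeroFace_mergedBody₂ (hS hφS) hβ]
      exact ⟨hx, hx0 φ hφS⟩
    exact (h.facetSystem.mem_zeroFace_iff hψ hne).2 ⟨hxQ.1, hx0⟩

/-- If a `k`-face of the merged body is cut out by hyperplanes through the apex and all `k`-faces
of `K₂` are simplices, then the face does not reach beyond the wall: the corresponding `k`-face of
`K₂` is spanned by the apex and some of its neighbors. -/
lemma face_subset_of_apex (h : IsMergePosition v u β₀ β K₁ K₂ Φ₁ Φ₂) {k : ℕ}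
    (hs₂ : IsSimplicial k K₂) {ψ : Module.Dual ℝ (Space d × ℝ)}
    (hψ : ∀ x ∈ mergedBody v K₁ K₂, 0 ≤ ψ (lift x))
    (hne : (zeroFace (mergedBody v K₁ K₂) ψ).Nonempty)
    (hrank : Module.finrank ℝ (liftSpan (zeroFace (mergedBody v K₁ K₂) ψ)) = k + 1)
    (hS : vanishing (Φ₁ \ {β₀} ∪ Φ₂) (zeroFace (mergedBody v K₁ K₂) ψ) ⊆ Set.range β) :
    zeroFace (mergedBody v K₁ K₂) ψ ⊆ K₁ := by
  set G := zeroFace (mergedBody v K₁ K₂) ψ with hG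
  set S := vanishing (Φ₁ \ {β₀} ∪ Φ₂) G with hSdef
  have hadd := h.facetSystem.finrank_add hψ hne
  rw [← hG, ← hSdef, hrank, h.bary.finrank_span_eq_ncard hS] at hadd
  have hS₂ : S ⊆ Φ₂ := fun φ hφ => by
    obtain ⟨j, rfl⟩ := hS hφ
    exact h.mem₂ j
  obtain ⟨ψ', hψ', hz⟩ := exists_sum_functional (h.facetSystem.vanishing_finite G) (P := K₂)
    (fun φ hφ x hx => h.sys₂.nonneg (hS₂ hφ) hx)
  have hv : v ∈ zeroFace K₂ ψ' := by
    rw [hz]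
    refine ⟨vertexSet_subset _ h.apex_vertex, fun φ hφ => ?_⟩
    obtain ⟨j, rfl⟩ := hS hφ
    exact h.bary.apex j
  have hu : ∀ j, β j ∉ S → u j ∈ zeroFace K₂ ψ' := by
    intro j hj
    rw [hz]
    refine ⟨vertexSet_subset _ (h.base_vertex j), fun φ hφ => ?_⟩
    obtain ⟨l, rfl⟩ := hS hφ
    rw [h.bary.base, if_neg]
    rintro rfl
    exact hj hφ
  have hvan : vanishing Φ₂ (zeroFace K₂ ψ') = S := by
    apply Set.Subset.antisymm
    · intro φ hφ
      obtain ⟨j, rfl⟩ := h.eq_of_apex φ hφ.1 (hφ.2 v hv)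
      by_contra hj
      have := hφ.2 _ (hu j hj)
      rw [h.bary.base, if_pos rfl] at this
      exact one_ne_zero this
    · refine fun φ hφ => ⟨hS₂ hφ, fun x hx => ?_⟩
      rw [hz] at hx
      exact hx.2 φ hφ
  have hadd₂ := h.sys₂.finrank_add hψ' ⟨v, hv⟩
  rw [hvan, h.bary.finrank_span_eq_ncard hS] at hadd₂
  have hsimp : IsSimplex k (zeroFace K₂ ψ') :=
    hs₂ _ (isFaceOfDim_iff.2 ⟨⟨ψ', hψ', rfl⟩, by omega⟩)
  set J := {j | β j ∉ S} with hJ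
  have hcard : S.ncard + J.ncard = d := by
    have h1 : S = β '' Jᶜ := by
      ext φ
      constructor
      · intro hφ
        obtain ⟨j, rfl⟩ := hS hφ
        exact ⟨j, fun hj => hj hφ, rfl⟩
      · rintro ⟨j, hj, rfl⟩
        exact not_not.1 hj
    rw [h1, Set.ncard_image_of_injective _ h.bary.linearIndependent_coords.injective, add_comm,
      Set.ncard_add_ncard_compl, Nat.card_fin]
  have hT := hsimp.eq_convexHull (P := K₂) (T := insert v (u '' J)) (fun x hx => hx.1) ?_ ?_ ?_
  · intro x hx
    rcases hx.1 with hx₁ | hx₂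
    · exact hx₁
    · have hx₂' := h.mem_cap_iff.1 hx₂
      have hxT : x ∈ zeroFace K₂ ψ' := by
        rw [hz]; exact ⟨hx₂'.1, fun φ hφ => hφ.2 x hx⟩
      have hpos : 0 ≤ β₀ (lift x) := by
        rw [hT] at hxT
        refine nonneg_on_convexHull ?_ x hxT
        rintro _ (rfl | ⟨j, -, rfl⟩)
        · rw [h.bary.zero_apex]; exact zero_le_one
        · rw [h.bary.zero_base]
      exact h.wall_mem₁ (h.mergedBody_coord_nonneg hx.1) (le_antisymm hx₂'.2 hpos)
  · rintro _ (rfl | ⟨j, -, rfl⟩)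
    exacts [h.apex_vertex, h.base_vertex j]
  · rintro _ (rfl | ⟨j, hj, rfl⟩)
    exacts [hv, hu j hj]
  · rw [Set.ncard_insert_of_notMem, Set.ncard_image_of_injective _ h.bary.base_injective]
    · omega
    · rintro ⟨j, -, hj⟩
      exact h.bary.base_ne_apex j hj

lemma isSimplicial (h : IsMergePosition v u β₀ β K₁ K₂ Φ₁ Φ₂) {k : ℕ}
    (hs₁ : IsSimplicial k K₁) (hs₂ : IsSimplicial k K₂) :
    IsSimplicial k (mergedBody v K₁ K₂) := by
  intro G hG
  have hne := hG.2.1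
  rw [isFaceOfDim_iff] at hG
  obtain ⟨⟨ψ, hψ, rfl⟩, hrank⟩ := hG
  have of_subset : zeroFace (mergedBody v K₁ K₂) ψ ⊆ K₁ →
      IsSimplex k (zeroFace (mergedBody v K₁ K₂) ψ) := by
    intro hsub
    rw [zeroFace_mergedBody_eq hsub] at hrank ⊢
    exact hs₁ _ (isFaceOfDim_iff.2 ⟨⟨ψ, fun x hx => hψ x (Or.inl hx), rfl⟩, hrank⟩)
  rcases h.face_cases hψ hne with ⟨-, hsub⟩ | ⟨-, ψ', hψ', hG⟩ | hS
  · exact of_subset hsub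
  · rw [hG] at hrank ⊢
    exact hs₂ _ (isFaceOfDim_iff.2 ⟨⟨ψ', hψ', rfl⟩, hrank⟩)
  · exact of_subset (h.face_subset_of_apex hs₂ hψ hne hrank hS)

/-- Off the wall, the facets of the merged body at a subset of `K₁` are those of `K₁`. -/
lemma vanishing_eq_of_off_wall (h : IsMergePosition v u β₀ β K₁ K₂ Φ₁ Φ₂) {G : Set (Space d)}
    {x : Space d} (hxG : x ∈ G) (hx : x ∈ K₁) (hx0 : β₀ (lift x) ≠ 0) :
    vanishing (Φ₁ \ {β₀} ∪ Φ₂) G = vanishing Φ₁ G := by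
  ext φ
  constructor
  · rintro ⟨hφ | hφ, hφG⟩
    · exact ⟨hφ.1, hφG⟩
    · by_cases hβ : φ ∈ Set.range β
      · obtain ⟨j, rfl⟩ := hβ
        exact ⟨h.mem₁ j, hφG⟩
      · exact (hx0 ((h.nonneg_inside hφ hβ (fun k => h.sys₁.nonneg (h.mem₁ k) hx)
          (h.sys₁.nonneg h.zero_mem₁ hx)).2 (hφG x hxG))).elim
  · rintro ⟨hφ, hφG⟩
    refine ⟨Or.inl ⟨hφ, ?_⟩, hφG⟩
    rintro rfl
    exact hx0 (hφG x hxG)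

/-- A face of `K₁` of dimension `m` in the wall lies in the wall and in `d - m - 1` of the other
facets of the simplex. -/
lemma ncard_vanishing_of_wall (h : IsMergePosition v u β₀ β K₁ K₂ Φ₁ Φ₂)
    {ψ : Module.Dual ℝ (Space d × ℝ)} (hψ : ∀ x ∈ K₁, 0 ≤ ψ (lift x))
    (hwall : ∀ x ∈ zeroFace K₁ ψ, β₀ (lift x) = 0) :
    {φ ∈ Set.range β | ∀ x ∈ zeroFace K₁ ψ, φ (lift x) = 0}.ncard +
      Module.finrank ℝ (liftSpan (zeroFace K₁ ψ)) = d := by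
  set J := {k | ψ (lift (u k)) = 0} with hJ
  have hG : zeroFace K₁ ψ = convexHull ℝ (u '' J) := by
    have h1 : zeroFace K₁ ψ = zeroFace (convexHull ℝ (Set.range u)) ψ := by
      ext x
      constructor
      · intro hx
        exact ⟨h.bary.mem_convexHull_base (hwall x hx)
          (fun k => h.sys₁.nonneg (h.mem₁ k) hx.1), hx.2⟩
      · intro hx
        exact ⟨convexHull_min (Set.range_subset_iff.2 h.base_mem₁) h.poly₁.convex hx.1, hx.2⟩
    rw [h1, zeroFace_convexHull]
    · congr 1
      ext x
      constructor
      · rintro ⟨⟨k, rfl⟩, hk⟩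
        exact ⟨k, hk, rfl⟩
      · rintro ⟨k, hk, rfl⟩
        exact ⟨⟨k, rfl⟩, hk⟩
    · rintro _ ⟨k, rfl⟩
      exact hψ _ (h.base_mem₁ k)
  have hrank : Module.finrank ℝ (liftSpan (zeroFace K₁ ψ)) = J.ncard := by
    have hfin : (lift '' (u '' J)).Finite := Set.toFinite _
    have := hfin.fintype
    rw [hG, liftSpan_convexHull, liftSpan, finrank_span_set_eq_card,
      ← Set.ncard_eq_toFinset_card', Set.ncard_image_of_injective _ lift_injective,
      Set.ncard_image_of_injective _ h.bary.base_injective]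
    refine h.bary.linearIndependent_base.linearIndepOn_id.mono ?_
    rintro _ ⟨_, ⟨k, -, rfl⟩, rfl⟩
    exact ⟨k, rfl⟩
  have hset : {φ ∈ Set.range β | ∀ x ∈ zeroFace K₁ ψ, φ (lift x) = 0} = β '' Jᶜ := by
    ext φ
    constructor
    · rintro ⟨⟨j, rfl⟩, hj⟩
      refine ⟨j, fun hjJ => ?_, rfl⟩
      have := hj (u j) ⟨h.base_mem₁ j, hjJ⟩
      rw [h.bary.base, if_pos rfl] at this
      exact one_ne_zero this
    · rintro ⟨j, hj, rfl⟩
      refine ⟨⟨j, rfl⟩, ?_⟩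
      rw [hG]
      apply zero_on_convexHull
      rintro _ ⟨k, hk, rfl⟩
      rw [h.bary.base, if_neg]
      rintro rfl
      exact hj hk
  rw [hset, hrank, Set.ncard_image_of_injective _ h.bary.linearIndependent_coords.injective,
    add_comm, Set.ncard_add_ncard_compl, Nat.card_fin]

/-- The facet count at a face carries over from the polytope that the face comes from. For a face
cut out by hyperplanes through the apex, it is the codimension, as these are independent. -/
lemma isSimple (h : IsMergePosition v u β₀ β K₁ K₂ Φ₁ Φ₂) {i : ℕ} (hid : i < d)
    (hs₁ : IsSimple i K₁) (hs₂ : IsSimple i K₂) : IsSimple i (mergedBody v K₁ K₂) := by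
  have hd : 0 < d := by omega
  intro G hG
  have hne := hG.2.1
  rw [isFaceOfDim_iff] at hG
  obtain ⟨⟨ψ, hψ, rfl⟩, hrank⟩ := hG
  rw [h.facetSystem.ncard_facets hd fun x hx => hx.1]
  rcases h.face_cases hψ hne with ⟨⟨φ, hφS, hφ, hφ0, hβ⟩, hsub⟩ | ⟨hS, ψ', hψ', hG⟩ | hS
  · have hψ₁ : ∀ x ∈ K₁, 0 ≤ ψ (lift x) := fun x hx => hψ x (Or.inl hx)
    rw [zeroFace_mergedBody_eq hsub] at hrank hφS ⊢
    have h1 := hs₁ _ (isFaceOfDim_iff.2 ⟨⟨ψ, hψ₁, rfl⟩, hrank⟩)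
    rw [h.sys₁.ncard_facets hd fun x hx => hx.1] at h1
    by_cases hwall : ∀ x ∈ zeroFace K₁ ψ, β₀ (lift x) = 0
    · -- In the wall, the wall and the `i` other facets of the simplex leave no room for `φ`.
      exfalso
      have h2 := h.ncard_vanishing_of_wall hψ₁ hwall
      set S' := {φ ∈ Set.range β | ∀ x ∈ zeroFace K₁ ψ, φ (lift x) = 0}
      have hS'fin : S'.Finite := (Set.finite_range β).subset fun φ hφ => hφ.1
      have hβ₀S' : β₀ ∉ S' := by
        rintro ⟨⟨j, hj⟩, -⟩
        have := h.bary.apex j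
        rw [hj, h.bary.zero_apex] at this
        exact one_ne_zero this
      have hsub' : insert φ (insert β₀ S') ⊆ vanishing Φ₁ (zeroFace K₁ ψ) := by
        rintro χ (rfl | rfl | ⟨⟨j, rfl⟩, hχ⟩)
        exacts [⟨hφ, hφS.2⟩, ⟨h.zero_mem₁, hwall⟩, ⟨h.mem₁ j, hχ⟩]
      have h3 := Set.ncard_le_ncard hsub' (h.sys₁.vanishing_finite _)
      rw [Set.ncard_insert_of_notMem, Set.ncard_insert_of_notMem hβ₀S' hS'fin, h1] at h3
      · omega
      · rintro (hc | hc)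
        exacts [hφ0 hc, hβ hc.1]
    · push Not at hwall
      obtain ⟨x, hx, hx0⟩ := hwall
      rw [h.vanishing_eq_of_off_wall hx hx.1 hx0, h1]
  · have h1 : vanishing (Φ₁ \ {β₀} ∪ Φ₂) (zeroFace (mergedBody v K₁ K₂) ψ) =
        vanishing Φ₂ (zeroFace (mergedBody v K₁ K₂) ψ) :=
      Set.Subset.antisymm (fun φ hφ => ⟨hS hφ, hφ.2⟩) fun φ hφ => ⟨Or.inr hφ.1, hφ.2⟩
    rw [h1]
    rw [hG] at hrank ⊢
    rw [← h.sys₂.ncard_facets hd fun x hx => hx.1]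
    exact hs₂ _ (isFaceOfDim_iff.2 ⟨⟨ψ', hψ', rfl⟩, hrank⟩)
  · have := h.facetSystem.finrank_add hψ hne
    rw [hrank, h.bary.finrank_span_eq_ncard hS] at this
    omega

end IsMergePosition

/-! ### Vertices of the merged body -/

lemma IsDPolytope.le_numVertices {P : Set (Space d)} (hP : IsDPolytope P) :
    d + 1 ≤ numVertices P := by
  have h := hP.liftSpan_eq_top
  have hfin := hP.vertexSet_finite
  have hfin' := (hfin.image lift).fintype
  rw [← hP.convexHull_vertexSet, liftSpan_convexHull, liftSpan] at h
  have h1 := finrank_span_le_card (R := ℝ) (lift '' vertexSet P)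
  rw [h, finrank_top, finrank_lift_space, ← Set.ncard_eq_toFinset_card',
    Set.ncard_image_of_injective _ lift_injective] at h1
  exact h1

lemma IsSimplex.numVertices_le {P : Set (Space d)} {k : ℕ} (hP : IsSimplex k P) :
    numVertices P ≤ k + 1 := by
  obtain ⟨p, -, rfl⟩ := hP
  have hsub : vertexSet (convexHull ℝ (Set.range p)) ⊆ Set.range p := fun x hx =>
    mem_of_mem_vertexSet_of_mem_convexHull hx subset_rfl (vertexSet_subset _ hx)
  refine (Set.ncard_le_ncard hsub (Set.finite_range p)).trans ?_
  rw [← Set.image_univ]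
  exact (Set.ncard_image_le (Set.finite_univ)).trans (by simp [Set.ncard_univ])

namespace IsMergePosition

variable {v : Space d} {u : Fin d → Space d} {β₀ : Module.Dual ℝ (Space d × ℝ)}
  {β : Fin d → Module.Dual ℝ (Space d × ℝ)} {K₁ K₂ : Set (Space d)}
  {Φ₁ Φ₂ : Set (Module.Dual ℝ (Space d × ℝ))}

lemma mem_insert_of_mem₁ (h : IsMergePosition v u β₀ β K₁ K₂ Φ₁ Φ₂) {x : Space d} (hx : x ∈ K₁) :
    x ∈ convexHull ℝ (insert v (Set.range u)) :=
  h.bary.mem_convexHull_insert.2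
    ⟨h.sys₁.nonneg h.zero_mem₁ hx, fun k => h.sys₁.nonneg (h.mem₁ k) hx⟩

/-- If `K₁` is not a simplex, it is not the whole simplex that contains it. -/
lemma apex_notMem (h : IsMergePosition v u β₀ β K₁ K₂ Φ₁ Φ₂) (hn : ¬ IsSimplex d K₁) :
    v ∉ K₁ := by
  intro hv
  apply hn
  have : K₁ = convexHull ℝ (insert v (Set.range u)) := by
    refine Set.Subset.antisymm (fun x hx => h.mem_insert_of_mem₁ hx)
      (convexHull_min ?_ h.poly₁.convex)
    rintro _ (rfl | ⟨k, rfl⟩)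
    exacts [hv, h.base_mem₁ k]
  rw [this]
  exact h.bary.isSimplex_convexHull

/-- The vertices of `K₂` other than the apex are vertices of the merged body, because one of the
facets at such a vertex misses the apex. -/
lemma vertex_of_vertex₂ (h : IsMergePosition v u β₀ β K₁ K₂ Φ₁ Φ₂) {w : Space d}
    (hw : w ∈ vertexSet K₂) (hwv : w ≠ v) : w ∈ vertexSet (mergedBody v K₁ K₂) := by
  obtain ⟨ψ, hψ, hψw⟩ := mem_vertexSet_iff.1 hw
  have hne : (zeroFace K₂ ψ).Nonempty := hψw ▸ Set.singleton_nonempty w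
  have hiff : ∀ {x}, x = w ↔ x ∈ K₂ ∧ ∀ φ ∈ vanishing Φ₂ {w}, φ (lift x) = 0 := by
    intro x
    rw [hψw, ← h.sys₂.mem_zeroFace_iff hψ hne, ← hψw, Set.mem_singleton_iff]
  obtain ⟨φ, hφ, hβ⟩ : ∃ φ ∈ vanishing Φ₂ {w}, φ ∉ Set.range β := by
    by_contra! hcon
    refine hwv (hiff.2 ⟨vertexSet_subset _ h.apex_vertex, fun φ hφ => ?_⟩).symm
    obtain ⟨j, rfl⟩ := hcon φ hφ
    exact h.bary.apex j
  obtain ⟨χ, hχ, hz⟩ := exists_sum_functional (h.sys₂.vanishing_finite {w})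
    (P := mergedBody v K₁ K₂) (fun φ hφ x hx => h.facetSystem.nonneg (Or.inr hφ.1) hx)
  refine mem_vertexSet_iff.2 ⟨χ, hχ, ?_⟩
  rw [hz]
  apply Set.Subset.antisymm
  · rintro _ rfl
    exact ⟨Or.inr (subset_convexHull ℝ _ ⟨hw, hwv⟩), (hiff.1 rfl).2⟩
  · rintro x ⟨hx, hx0⟩
    exact hiff.2 ⟨h.mem₂_of_zero hφ.1 hβ hx (hx0 φ hφ), hx0⟩

lemma mem_range_of_wall (h : IsMergePosition v u β₀ β K₁ K₂ Φ₁ Φ₂) {x : Space d}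
    {K : Set (Space d)} (hx : x ∈ vertexSet K) (hK : ∀ k, u k ∈ K) (hc : Convex ℝ K)
    (hk : ∀ k, 0 ≤ β k (lift x)) (h0 : β₀ (lift x) = 0) : x ∈ Set.range u :=
  mem_of_mem_vertexSet_of_mem_convexHull hx (convexHull_min (Set.range_subset_iff.2 hK) hc)
    (h.bary.mem_convexHull_base h0 hk)

/-- The vertices of `K₁` are vertices of the merged body. Those in the wall are vertices of `K₂`
too; the facets at any other vertex are not all facets of the simplex, unless the
vertex is the apex. -/
lemma vertex_of_vertex₁ (h : IsMergePosition v u β₀ β K₁ K₂ Φ₁ Φ₂) (hn : ¬ IsSimplex d K₁)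
    {w : Space d} (hw : w ∈ vertexSet K₁) : w ∈ vertexSet (mergedBody v K₁ K₂) := by
  have hwK := vertexSet_subset _ hw
  by_cases h0 : β₀ (lift w) = 0
  · obtain ⟨k, rfl⟩ := h.mem_range_of_wall hw h.base_mem₁ h.poly₁.convex
      (fun k => h.sys₁.nonneg (h.mem₁ k) hwK) h0
    exact h.vertex_of_vertex₂ (h.base_vertex k) (h.bary.base_ne_apex k)
  obtain ⟨ψ, hψ, hψw⟩ := mem_vertexSet_iff.1 hw
  have hne : (zeroFace K₁ ψ).Nonempty := hψw ▸ Set.singleton_nonempty w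
  have hiff : ∀ {x}, x = w ↔ x ∈ K₁ ∧ ∀ φ ∈ vanishing Φ₁ {w}, φ (lift x) = 0 := by
    intro x
    rw [hψw, ← h.sys₁.mem_zeroFace_iff hψ hne, ← hψw, Set.mem_singleton_iff]
  have hne0 : ∀ φ ∈ vanishing Φ₁ {w}, φ ≠ β₀ := by
    rintro φ hφ rfl
    exact h0 (hφ.2 w rfl)
  obtain ⟨φ, hφ, hβ⟩ : ∃ φ ∈ vanishing Φ₁ {w}, φ ∉ Set.range β := by
    by_contra! hcon
    by_cases hall : ∀ j, β j ∈ vanishing Φ₁ {w}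
    · apply h.apex_notMem hn
      have h1 := h.bary.sum_eq_one w
      have h2 := h.bary.point_eq w
      have hz : ∀ j, β j (lift w) = 0 := fun j => (hall j).2 w rfl
      simp only [hz, Finset.sum_const_zero, add_zero, zero_smul] at h1 h2
      rw [h1, one_smul] at h2
      rwa [← h2]
    · push Not at hall
      obtain ⟨j, hj⟩ := hall
      have : u j = w := hiff.2 ⟨h.base_mem₁ j, fun φ hφ => by
        obtain ⟨l, rfl⟩ := hcon φ hφ
        rw [h.bary.base, if_neg]
        rintro rfl
        exact hj hφ⟩
      exact h0 (this ▸ h.bary.zero_base j)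
  obtain ⟨χ, hχ, hz⟩ := exists_sum_functional (h.sys₁.vanishing_finite {w})
    (P := mergedBody v K₁ K₂)
    (fun φ hφ x hx => h.facetSystem.nonneg (Or.inl ⟨hφ.1, hne0 φ hφ⟩) hx)
  refine mem_vertexSet_iff.2 ⟨χ, hχ, ?_⟩
  rw [hz]
  apply Set.Subset.antisymm
  · rintro _ rfl
    exact ⟨Or.inl hwK, (hiff.1 rfl).2⟩
  · rintro x ⟨hx, hx0⟩
    exact hiff.2 ⟨h.mem₁_of_zero hφ.1 (hne0 φ hφ) hβ hx (hx0 φ hφ), hx0⟩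

lemma wall_of_mem_of_mem (h : IsMergePosition v u β₀ β K₁ K₂ Φ₁ Φ₂) {x : Space d}
    (h₁ : x ∈ K₁) (h₂ : x ∈ convexHull ℝ (vertexSet K₂ \ {v})) : β₀ (lift x) = 0 :=
  le_antisymm (h.mem_cap_iff.1 h₂).2 (h.sys₁.nonneg h.zero_mem₁ h₁)

/-- The vertices of `K₂` do not all lie in the wall or at the apex, as `K₂` is not a simplex. -/
lemma numVertices_lt (h : IsMergePosition v u β₀ β K₁ K₂ Φ₁ Φ₂) (hn₁ : ¬ IsSimplex d K₁)
    (hn₂ : ¬ IsSimplex d K₂) : numVertices K₁ < numVertices (mergedBody v K₁ K₂) := by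
  obtain ⟨w, hw, hwv, hwK⟩ : ∃ w ∈ vertexSet K₂, w ≠ v ∧ w ∉ K₁ := by
    by_contra! hcon
    apply hn₂
    have : K₂ = convexHull ℝ (insert v (Set.range u)) := by
      apply Set.Subset.antisymm
      · rw [← h.poly₂.convexHull_vertexSet]
        apply convexHull_mono
        intro w hw
        by_cases hwv : w = v
        · exact Or.inl hwv
        · exact Or.inr (h.mem_range_of_wall hw
            (fun k => vertexSet_subset _ (h.base_vertex k)) h.poly₂.convex
            (fun k => h.sys₂.nonneg (h.mem₂ k) (vertexSet_subset _ hw))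
            (h.wall_of_mem_of_mem (hcon w hw hwv) (subset_convexHull ℝ _ ⟨hw, hwv⟩)))
      · refine convexHull_min ?_ h.poly₂.convex
        rintro _ (rfl | ⟨k, rfl⟩)
        exacts [vertexSet_subset _ h.apex_vertex, vertexSet_subset _ (h.base_vertex k)]
    rw [this]
    exact h.bary.isSimplex_convexHull
  apply Set.ncard_lt_ncard _ h.isDPolytope.vertexSet_finite
  exact (Set.ssubset_iff_of_subset fun x hx => h.vertex_of_vertex₁ hn₁ hx).2
    ⟨w, h.vertex_of_vertex₂ hw hwv, fun hw' => hwK (vertexSet_subset _ hw')⟩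

lemma not_isSimplex (h : IsMergePosition v u β₀ β K₁ K₂ Φ₁ Φ₂) (hn₁ : ¬ IsSimplex d K₁)
    (hn₂ : ¬ IsSimplex d K₂) : ¬ IsSimplex d (mergedBody v K₁ K₂) := fun hs => by
  have h1 := h.numVertices_lt hn₁ hn₂
  have h2 := hs.numVertices_le
  have h3 := h.poly₁.le_numVertices
  omega

/-- A facet of `K₂` that misses the apex is a facet of the merged body. -/
lemma isFacet_of_apex_notMem (h : IsMergePosition v u β₀ β K₁ K₂ Φ₁ Φ₂) (hd : 0 < d)
    {F : Set (Space d)} (hF : IsFacet K₂ F) (hvF : v ∉ F) :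
    IsFacet (mergedBody v K₁ K₂) F ∧ F ⊆ convexHull ℝ (vertexSet K₂ \ {v}) := by
  obtain ⟨φ, hφ, rfl⟩ := h.sys₂.exists_of_isFacet hd hF
  have hβ : φ ∉ Set.range β := by
    rintro ⟨j, rfl⟩
    exact hvF ⟨vertexSet_subset _ h.apex_vertex, h.bary.apex j⟩
  rw [← h.zeroFace_mergedBody₂ hφ hβ]
  refine ⟨h.facetSystem.isFacet_zeroFace hd (Or.inr hφ), ?_⟩
  intro x hx
  have hx₂ : x ∈ K₂ := h.mem₂_of_zero hφ hβ hx.1 hx.2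
  refine h.mem_cap_iff.2 ⟨hx₂, ?_⟩
  by_contra! hpos
  exact hpos.ne' ((h.nonneg_inside hφ hβ (fun k => h.sys₂.nonneg (h.mem₂ k) hx₂) hpos.le).2 hx.2)

/-- A simple vertex of `K₁` off the wall is a simple vertex of the merged body. -/
lemma isSimpleVertex_of_off_wall (h : IsMergePosition v u β₀ β K₁ K₂ Φ₁ Φ₂) (hd : 0 < d)
    (hn₁ : ¬ IsSimplex d K₁) {w : Space d} (hw : IsSimpleVertex K₁ w)
    (hw0 : β₀ (lift w) ≠ 0) : IsSimpleVertex (mergedBody v K₁ K₂) w := by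
  have hwK := vertexSet_subset _ hw.1
  refine ⟨h.vertex_of_vertex₁ hn₁ hw.1, ?_⟩
  rw [h.facetSystem.ncard_facets_mem hd (Or.inl hwK),
    h.vanishing_eq_of_off_wall (Set.mem_singleton w) hwK hw0, ← h.sys₁.ncard_facets_mem hd hwK]
  exact hw.2

end IsMergePosition

/-! ### Projective transformations -/

lemma lift_projMap {L : (Space d × ℝ) ≃ₗ[ℝ] (Space d × ℝ)} {x : Space d}
    (hx : (L (lift x)).2 ≠ 0) : lift (projMap L x) = (L (lift x)).2⁻¹ • L (lift x) := by
  ext1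
  · rfl
  · simp [inv_mul_cancel₀ hx]

/-- `K` is the image of `P` under the projective transformation of `L`, where `L` is normalized
by a sign such that the denominators are positive on `P`. -/
structure IsProjImage (L : (Space d × ℝ) ≃ₗ[ℝ] (Space d × ℝ)) (P K : Set (Space d)) : Prop where
  pos : ∀ x ∈ P, 0 < (L (lift x)).2
  eq : K = projMap L '' P

/-- The denominators of a projective transformation that is defined on a convex set have constant
sign there. -/
lemma exists_isProjImage {P : Set (Space d)} (hP : Convex ℝ P)
    (L : (Space d × ℝ) ≃ₗ[ℝ] (Space d × ℝ)) (hL : ∀ x ∈ P, (L (lift x)).2 ≠ 0) :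
    ∃ L', (∀ x, projMap L' x = projMap L x) ∧ IsProjImage L' P (projMap L '' P) := by
  by_cases hpos : ∀ x ∈ P, 0 < (L (lift x)).2
  · exact ⟨L, fun _ => rfl, hpos, rfl⟩
  push Not at hpos
  obtain ⟨x₀, hx₀, hle⟩ := hpos
  have hproj : ∀ x, projMap (L.trans (LinearEquiv.neg ℝ)) x = projMap L x := fun x => by
    simp [projMap, inv_neg]
  refine ⟨L.trans (LinearEquiv.neg ℝ), hproj, fun x hx => ?_, ?_⟩
  · by_contra hneg
    have hx1 : 0 ≤ (L (lift x)).2 := by simpa using hneg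
    have hx2 : 0 < (L (lift x)).2 := hx1.lt_of_ne' (hL x hx)
    have hx3 : (L (lift x₀)).2 < 0 := hle.lt_of_ne (hL x₀ hx₀)
    set a := (L (lift x)).2
    set b := (L (lift x₀)).2
    have hab : 0 < a - b := by linarith
    have hsum : -b / (a - b) + a / (a - b) = 1 := by field_simp; ring
    apply hL _ (hP hx hx₀ (div_nonneg (by linarith) hab.le) (div_nonneg hx1 hab.le) hsum)
    rw [lift_combo hsum, map_add, map_smul, map_smul]
    change (-b / (a - b)) * a + (a / (a - b)) * b = 0
    ring
  · exact (Set.image_congr fun x _ => hproj x).symm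

namespace IsProjImage

variable {L : (Space d × ℝ) ≃ₗ[ℝ] (Space d × ℝ)} {P K : Set (Space d)}

lemma lift_map (h : IsProjImage L P K) {x : Space d} (hx : x ∈ P) :
    lift (projMap L x) = (L (lift x)).2⁻¹ • L (lift x) := lift_projMap (h.pos x hx).ne'

lemma symm_lift (h : IsProjImage L P K) {x : Space d} (hx : x ∈ P) :
    L.symm (lift (projMap L x)) = (L (lift x)).2⁻¹ • lift x := by
  rw [h.lift_map hx, map_smul, L.symm_apply_apply]

lemma left_inv (h : IsProjImage L P K) {x : Space d} (hx : x ∈ P) :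
    projMap L.symm (projMap L x) = x := by
  have hne := (h.pos x hx).ne'
  change (L.symm (lift (projMap L x))).2⁻¹ • (L.symm (lift (projMap L x))).1 = x
  rw [h.symm_lift hx]
  simp [smul_smul, mul_inv_cancel₀ hne]

lemma image_image (h : IsProjImage L P K) {G : Set (Space d)} (hG : G ⊆ P) :
    projMap L.symm '' (projMap L '' G) = G := by
  rw [Set.image_image]
  exact (Set.image_congr fun x hx => h.left_inv (hG hx)).trans (Set.image_id' G)

lemma symm (h : IsProjImage L P K) : IsProjImage L.symm K P := by
  refine ⟨?_, by rw [h.eq, h.image_image subset_rfl]⟩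
  rw [h.eq]
  rintro _ ⟨x, hx, rfl⟩
  rw [h.symm_lift hx]
  simpa using h.pos x hx

lemma mono (h : IsProjImage L P K) {G : Set (Space d)} (hG : G ⊆ P) :
    IsProjImage L G (projMap L '' G) := ⟨fun x hx => h.pos x (hG hx), rfl⟩

lemma map_mem (h : IsProjImage L P K) {x : Space d} (hx : x ∈ P) : projMap L x ∈ K := by
  rw [h.eq]; exact ⟨x, hx, rfl⟩

lemma injOn (h : IsProjImage L P K) : Set.InjOn (projMap L) P := fun x hx y hy hxy => by
  rw [← h.left_inv hx, hxy, h.left_inv hy]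

lemma liftSpan_eq (h : IsProjImage L P K) :
    liftSpan K = (liftSpan P).map (L : (Space d × ℝ) →ₗ[ℝ] (Space d × ℝ)) := by
  have key : ∀ {L : (Space d × ℝ) ≃ₗ[ℝ] (Space d × ℝ)} {P K : Set (Space d)},
      IsProjImage L P K → liftSpan K ≤ (liftSpan P).map (L : (Space d × ℝ) →ₗ[ℝ] _) := by
    intro L P K h
    rw [liftSpan_le, h.eq]
    rintro _ ⟨x, hx, rfl⟩
    rw [h.lift_map hx]
    exact Submodule.smul_mem _ _ ⟨lift x, lift_mem_liftSpan hx, rfl⟩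
  refine le_antisymm (key h) ?_
  rintro _ ⟨y, hy, rfl⟩
  obtain ⟨z, hz, hzy⟩ := key h.symm hy
  rw [← hzy]
  simpa using hz

lemma finrank_liftSpan_eq (h : IsProjImage L P K) :
    Module.finrank ℝ (liftSpan K) = Module.finrank ℝ (liftSpan P) := by
  rw [h.liftSpan_eq]
  exact LinearEquiv.finrank_map_eq L _

lemma apply_symm (h : IsProjImage L P K) (φ : Module.Dual ℝ (Space d × ℝ)) {x : Space d}
    (hx : x ∈ P) : (φ ∘ₗ (L.symm : (Space d × ℝ) →ₗ[ℝ] (Space d × ℝ))) (lift (projMap L x)) =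
      (L (lift x)).2⁻¹ * φ (lift x) := by
  rw [LinearMap.comp_apply, LinearEquiv.coe_coe, h.symm_lift hx, map_smul, smul_eq_mul]

lemma nonneg (h : IsProjImage L P K) {φ : Module.Dual ℝ (Space d × ℝ)}
    (hφ : ∀ x ∈ P, 0 ≤ φ (lift x)) :
    ∀ y ∈ K, 0 ≤ (φ ∘ₗ (L.symm : (Space d × ℝ) →ₗ[ℝ] (Space d × ℝ))) (lift y) := by
  rw [h.eq]
  rintro _ ⟨x, hx, rfl⟩
  rw [h.apply_symm φ hx]
  exact mul_nonneg (inv_nonneg.2 (h.pos x hx).le) (hφ x hx)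

lemma image_zeroFace (h : IsProjImage L P K) (φ : Module.Dual ℝ (Space d × ℝ)) :
    projMap L '' zeroFace P φ =
      zeroFace K (φ ∘ₗ (L.symm : (Space d × ℝ) →ₗ[ℝ] (Space d × ℝ))) := by
  rw [h.eq]
  ext y
  constructor
  · rintro ⟨x, ⟨hx, hx0⟩, rfl⟩
    exact ⟨⟨x, hx, rfl⟩, by rw [h.apply_symm φ hx, hx0, mul_zero]⟩
  · rintro ⟨⟨x, hx, rfl⟩, hx0⟩
    rw [h.apply_symm φ hx] at hx0
    exact ⟨x, ⟨hx, (mul_eq_zero.1 hx0).resolve_left (inv_ne_zero (h.pos x hx).ne')⟩, rfl⟩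

lemma isFaceOfDim (h : IsProjImage L P K) {k : ℕ} {G : Set (Space d)} (hG : IsFaceOfDim P k G) :
    IsFaceOfDim K k (projMap L '' G) := by
  have hsub : G ⊆ P := hG.1.subset
  rw [isFaceOfDim_iff] at hG ⊢
  refine ⟨?_, by rw [(h.mono hsub).finrank_liftSpan_eq, hG.2]⟩
  obtain ⟨⟨φ, hφ, rfl⟩, -⟩ := hG
  exact ⟨_, h.nonneg hφ, h.image_zeroFace φ⟩

/-- Each face of the image is the image of a face. -/
lemma exists_of_isFaceOfDim (h : IsProjImage L P K) {k : ℕ} {G : Set (Space d)}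
    (hG : IsFaceOfDim K k G) : ∃ G₀, IsFaceOfDim P k G₀ ∧ G = projMap L '' G₀ :=
  ⟨_, h.symm.isFaceOfDim hG, by simpa using (h.symm.image_image hG.1.subset).symm⟩

lemma convex (h : IsProjImage L P K) (hP : Convex ℝ P) : Convex ℝ K := by
  rw [h.eq]
  rintro _ ⟨x, hx, rfl⟩ _ ⟨y, hy, rfl⟩ a b ha hb hab
  have hpx := h.pos x hx
  have hpy := h.pos y hy
  set s := (L (lift x)).2 with hs
  set t := (L (lift y)).2 with ht
  set c := a * s⁻¹ + b * t⁻¹ with hc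
  have hc0 : 0 < c := by
    rcases ha.eq_or_lt with h0 | h0
    · have : 0 < b := by linarith
      positivity
    · positivity
  have hsum : a * s⁻¹ / c + b * t⁻¹ / c = 1 := by
    rw [← add_div, div_self hc0.ne']
  have hz : (a * s⁻¹ / c) • x + (b * t⁻¹ / c) • y ∈ P :=
    hP hx hy (by positivity) (by positivity) hsum
  refine ⟨_, hz, ?_⟩
  have hL : L (lift ((a * s⁻¹ / c) • x + (b * t⁻¹ / c) • y)) =
      c⁻¹ • lift (a • projMap L x + b • projMap L y) := by
    rw [lift_combo hsum, lift_combo hab, h.lift_map hx, h.lift_map hy, map_add, map_smul,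
      map_smul, ← hs, ← ht, smul_add, smul_smul, smul_smul, smul_smul, smul_smul]
    congr 2 <;> ring
  have h2 : (L (lift ((a * s⁻¹ / c) • x + (b * t⁻¹ / c) • y))).2⁻¹ = c := by
    rw [hL]; simp
  change (L (lift _)).2⁻¹ • (L (lift _)).1 = _
  rw [h2, hL]
  simp [smul_smul, ← mul_assoc, mul_inv_cancel₀ hc0.ne']

/-- Projective transformations map segments to segments within their domain. -/
lemma image_convexHull {s : Set (Space d)} (h : ∀ x ∈ convexHull ℝ s, 0 < (L (lift x)).2) :
    projMap L '' convexHull ℝ s = convexHull ℝ (projMap L '' s) := by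
  have hI : IsProjImage L (convexHull ℝ s) (projMap L '' convexHull ℝ s) := ⟨h, rfl⟩
  have hsub : convexHull ℝ (projMap L '' s) ⊆ projMap L '' convexHull ℝ s :=
    convexHull_min (Set.image_mono (subset_convexHull ℝ s)) (hI.convex (convex_convexHull ℝ s))
  refine Set.Subset.antisymm ?_ hsub
  have hback := (hI.symm.mono hsub).convex (convex_convexHull ℝ _)
  have h1 : convexHull ℝ s ⊆ projMap L.symm '' convexHull ℝ (projMap L '' s) := by
    refine convexHull_min (fun x hx => ?_) hback
    exact ⟨_, subset_convexHull ℝ _ ⟨x, hx, rfl⟩, hI.left_inv (subset_convexHull ℝ _ hx)⟩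
  have h2 := Set.image_mono (f := projMap L) h1
  have h3 := hI.symm.image_image hsub
  rw [L.symm_symm] at h3
  rwa [h3] at h2

lemma isDPolytope (h : IsProjImage L P K) (hP : IsDPolytope P) : IsDPolytope K := by
  have hne : K.Nonempty := by rw [h.eq]; exact hP.2.1.image _
  refine ⟨?_, hne, ?_⟩
  · obtain ⟨⟨s, hs, rfl⟩, -⟩ := hP
    exact ⟨_, hs.image (projMap L), by rw [h.eq, image_convexHull h.pos]⟩
  · have h1 := h.finrank_liftSpan_eq
    rw [finrank_liftSpan hne, finrank_liftSpan hP.2.1, hP.2.2] at h1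
    omega

lemma isSimplex (h : IsProjImage L P K) {k : ℕ} (hP : IsSimplex k P) : IsSimplex k K := by
  obtain ⟨p, hp, rfl⟩ := hP
  have hmem : ∀ i, p i ∈ convexHull ℝ (Set.range p) := fun i => subset_convexHull ℝ _ ⟨i, rfl⟩
  refine ⟨projMap L ∘ p, ?_, by rw [h.eq, image_convexHull h.pos, Set.range_comp]⟩
  rw [affineIndependent_iff_lift] at hp ⊢
  have h1 : (fun i => lift ((projMap L ∘ p) i)) =
      fun i => (Units.mk0 _ (inv_ne_zero (h.pos _ (hmem i)).ne')) • L (lift (p i)) := by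
    funext i
    exact h.lift_map (hmem i)
  rw [h1]
  exact (hp.map' (L : (Space d × ℝ) →ₗ[ℝ] (Space d × ℝ)) L.ker).units_smul _

lemma isSimplex_iff (h : IsProjImage L P K) {k : ℕ} : IsSimplex k K ↔ IsSimplex k P :=
  ⟨h.symm.isSimplex, h.isSimplex⟩

lemma isSimplicial (h : IsProjImage L P K) {j : ℕ} (hP : IsSimplicial j P) :
    IsSimplicial j K := by
  intro G hG
  obtain ⟨G₀, hG₀, rfl⟩ := h.exists_of_isFaceOfDim hG
  exact (h.mono hG₀.1.subset).isSimplex (hP _ hG₀)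

lemma image_subset_image_iff (h : IsProjImage L P K) {G H : Set (Space d)} (hG : G ⊆ P)
    (hH : H ⊆ P) : projMap L '' G ⊆ projMap L '' H ↔ G ⊆ H := by
  refine ⟨fun hs => ?_, Set.image_mono⟩
  rw [← h.image_image hG, ← h.image_image hH]
  exact Set.image_mono hs

lemma ncard_facets (h : IsProjImage L P K) {G : Set (Space d)} (hG : G ⊆ P) :
    {H | IsFacet K H ∧ projMap L '' G ⊆ H}.ncard = {H | IsFacet P H ∧ G ⊆ H}.ncard := by
  have h1 : {H | IsFacet K H ∧ projMap L '' G ⊆ H} =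
      (projMap L '' ·) '' {H | IsFacet P H ∧ G ⊆ H} := by
    ext H
    constructor
    · rintro ⟨hH, hGH⟩
      obtain ⟨H₀, hH₀, rfl⟩ := h.exists_of_isFaceOfDim hH
      exact ⟨H₀, ⟨hH₀, (h.image_subset_image_iff hG hH₀.1.subset).1 hGH⟩, rfl⟩
    · rintro ⟨H₀, ⟨hH₀, hGH⟩, rfl⟩
      exact ⟨h.isFaceOfDim hH₀, Set.image_mono hGH⟩
  rw [h1]
  apply Set.InjOn.ncard_image
  intro H hH H' hH' heq
  rw [← h.image_image hH.1.1.subset, ← h.image_image hH'.1.1.subset]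
  exact congrArg _ heq

lemma isSimple (h : IsProjImage L P K) {i : ℕ} (hP : IsSimple i P) : IsSimple i K := by
  intro G hG
  obtain ⟨G₀, hG₀, rfl⟩ := h.exists_of_isFaceOfDim hG
  rw [h.ncard_facets hG₀.1.subset, hP _ hG₀]

lemma vertexSet_eq (h : IsProjImage L P K) : vertexSet K = projMap L '' vertexSet P := by
  ext w
  constructor
  · intro hw
    have h1 := h.symm.isFaceOfDim hw
    rw [Set.image_singleton] at h1
    refine ⟨_, h1, ?_⟩
    simpa using h.symm.left_inv (vertexSet_subset _ hw)
  · rintro ⟨v, hv, rfl⟩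
    have h1 := h.isFaceOfDim hv
    rwa [Set.image_singleton] at h1

lemma numVertices_eq (h : IsProjImage L P K) : numVertices K = numVertices P := by
  rw [numVertices, h.vertexSet_eq]
  exact (h.injOn.mono (vertexSet_subset P)).ncard_image

lemma isSimpleVertex (h : IsProjImage L P K) {v : Space d} (hv : IsSimpleVertex P v) :
    IsSimpleVertex K (projMap L v) := by
  refine ⟨by rw [h.vertexSet_eq]; exact ⟨v, hv.1, rfl⟩, ?_⟩
  have h1 := h.ncard_facets (G := {v}) (by simpa using vertexSet_subset _ hv.1)
  simp only [Set.image_singleton, Set.singleton_subset_iff] at h1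
  rw [h1, hv.2]

end IsProjImage

/-- The linear automorphism of `ℝ^d × ℝ` inducing an affine automorphism of `ℝ^d`. -/
noncomputable def homogenize (A : Space d ≃ᵃ[ℝ] Space d) :
    (Space d × ℝ) ≃ₗ[ℝ] (Space d × ℝ) where
  toFun y := (A.linear y.1 + y.2 • A 0, y.2)
  map_add' y z := by
    ext1
    · simp only [Prod.fst_add, Prod.snd_add, map_add]; module
    · rfl
  map_smul' c y := by
    ext1
    · simp only [Prod.smul_fst, Prod.smul_snd, map_smul, smul_eq_mul, RingHom.id_apply]; module
    · rfl
  invFun y := (A.linear.symm (y.1 - y.2 • A 0), y.2)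
  left_inv y := by simp
  right_inv y := by simp

lemma homogenize_lift (A : Space d ≃ᵃ[ℝ] Space d) (x : Space d) :
    homogenize A (lift x) = lift (A x) := by
  have := A.map_vadd 0 x
  simp only [vadd_eq_add, add_zero] at this
  ext1
  · simp [homogenize, this]
  · rfl

lemma projMap_homogenize (A : Space d ≃ᵃ[ℝ] Space d) : projMap (homogenize A) = A := by
  funext x
  change (homogenize A (lift x)).2⁻¹ • (homogenize A (lift x)).1 = A x
  simp [homogenize_lift]

lemma isProjImage_affine (A : Space d ≃ᵃ[ℝ] Space d) (P : Set (Space d)) :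
    IsProjImage (homogenize A) P (A '' P) :=
  ⟨fun x _ => by simp [homogenize_lift], by rw [projMap_homogenize]⟩

/-! ### Simple vertices -/

section SimpleVertex

variable {P : Set (Space d)} {Φ : Set (Module.Dual ℝ (Space d × ℝ))} {v : Space d}

namespace IsFacetSystem

/-- A vertex spans the common kernel of the facet functionals vanishing at it. -/
lemma eq_smul_of_vanishing (hΦ : IsFacetSystem P Φ) (hv : v ∈ vertexSet P) {y : Space d × ℝ}
    (hy : ∀ φ ∈ vanishing Φ {v}, φ y = 0) : y = y.2 • lift v := by
  obtain ⟨ψ, hψ, hψv⟩ := mem_vertexSet_iff.1 hv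
  have h := hΦ.mem_liftSpan_zeroFace_iff hψ (hψv ▸ Set.singleton_nonempty v) (y := y)
  rw [← hψv, liftSpan_singleton, Submodule.mem_span_singleton] at h
  obtain ⟨a, rfl⟩ := h.2 hy
  simp

lemma ncard_vanishing_simple (hΦ : IsFacetSystem P Φ) (hd : 0 < d) (hv : IsSimpleVertex P v) :
    (vanishing Φ {v}).ncard = d := by
  rw [← hΦ.ncard_facets_mem hd (vertexSet_subset _ hv.1), hv.2]

lemma linearIndepOn_simple (hΦ : IsFacetSystem P Φ) (hd : 0 < d) (hv : IsSimpleVertex P v) :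
    LinearIndepOn ℝ id (vanishing Φ {v}) := by
  obtain ⟨ψ, hψ, hψv⟩ := mem_vertexSet_iff.1 hv.1
  have h := hΦ.finrank_add hψ (hψv ▸ Set.singleton_nonempty v)
  rw [← hψv, finrank_liftSpan_singleton] at h
  have := (hΦ.vanishing_finite {v}).fintype
  rw [LinearIndepOn, linearIndependent_iff_card_eq_finrank_span, Set.finrank]
  have hr : Set.range (fun x : vanishing Φ {v} => id (x : Module.Dual ℝ (Space d × ℝ))) =
      vanishing Φ {v} := by simp
  rw [hr, ← Set.toFinset_card, ← Set.ncard_eq_toFinset_card', hΦ.ncard_vanishing_simple hd hv]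
  omega

lemma finrank_span_eq_ncard (hΦ : IsFacetSystem P Φ) (hd : 0 < d) (hv : IsSimpleVertex P v)
    {S : Set (Module.Dual ℝ (Space d × ℝ))} (hS : S ⊆ vanishing Φ {v}) :
    Module.finrank ℝ (Submodule.span ℝ S) = S.ncard := by
  have := ((hΦ.vanishing_finite {v}).subset hS).fintype
  rw [finrank_span_set_eq_card, Set.ncard_eq_toFinset_card']
  exact (hΦ.linearIndepOn_simple hd hv).mono hS

/-- Along the line cut out by all but one of the facets at a vertex, points are determined by the
remaining facet functional. -/
lemma eq_combo (hΦ : IsFacetSystem P Φ) (hv : v ∈ vertexSet P)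
    {φ : Module.Dual ℝ (Space d × ℝ)} (hφ : φ ∈ vanishing Φ {v}) {w x : Space d}
    (hw : ∀ χ ∈ vanishing Φ {v}, χ ≠ φ → χ (lift w) = 0) (hφw : φ (lift w) ≠ 0)
    (hx : ∀ χ ∈ vanishing Φ {v}, χ ≠ φ → χ (lift x) = 0) :
    x = (1 - φ (lift x) / φ (lift w)) • v + (φ (lift x) / φ (lift w)) • w := by
  set t := φ (lift x) / φ (lift w) with ht
  have h1 := hΦ.eq_smul_of_vanishing hv (y := lift x - lift ((1 - t) • v + t • w)) ?_
  · have h2 : lift x = lift ((1 - t) • v + t • w) := by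
      rw [← sub_eq_zero, h1]; simp
    exact lift_injective h2
  · intro χ hχ
    have hχv : χ (lift v) = 0 := hχ.2 v rfl
    rw [lift_combo (by ring), map_sub, map_add, map_smul, map_smul, hχv]
    by_cases hne : χ = φ
    · subst hne
      simp only [smul_eq_mul, ht]
      field_simp
      ring
    · rw [hw χ hχ hne, hx χ hχ hne]
      simp

/-- The other endpoint of an edge at a simple vertex is a vertex, and lies on all but one of the
facets at the simple vertex. -/
lemma edge_endpoint (hΦ : IsFacetSystem P Φ) (hP : IsDPolytope P) (hd : 0 < d)
    (hv : IsSimpleVertex P v) {w : Space d} (hw : IsFaceOfDim P 1 (segment ℝ v w)) :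
    w ∈ vertexSet P ∧ ∃ φ ∈ vanishing Φ {v}, 0 < φ (lift w) ∧
      ∀ χ ∈ vanishing Φ {v}, χ ≠ φ → χ (lift w) = 0 := by
  have hsub := hw.1.subset
  have hwP : w ∈ P := hsub (right_mem_segment ℝ v w)
  rw [isFaceOfDim_iff] at hw
  obtain ⟨⟨ψ, hψ, hseg⟩, hrank⟩ := hw
  have hne : (zeroFace P ψ).Nonempty := hseg ▸ ⟨v, left_mem_segment ℝ v w⟩
  have hadd := hΦ.finrank_add hψ hne
  rw [← hseg, hrank] at hadd
  have hE : vanishing Φ (segment ℝ v w) = {χ ∈ vanishing Φ {v} | χ (lift w) = 0} := by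
    ext χ
    constructor
    · rintro ⟨hχ, h0⟩
      exact ⟨⟨hχ, by rintro _ rfl; exact h0 _ (left_mem_segment ℝ _ w)⟩,
        h0 w (right_mem_segment ℝ v w)⟩
    · rintro ⟨⟨hχ, h0⟩, h1⟩
      refine ⟨hχ, ?_⟩
      rw [← convexHull_pair]
      apply zero_on_convexHull
      rintro _ (rfl | rfl)
      exacts [h0 _ rfl, h1]
  have hEsub : {χ ∈ vanishing Φ {v} | χ (lift w) = 0} ⊆ vanishing Φ {v} := fun χ hχ => hχ.1
  rw [hE, hΦ.finrank_span_eq_ncard hd hv hEsub] at hadd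
  have hdiff := Set.ncard_sdiff_add_ncard_of_subset hEsub (hΦ.vanishing_finite {v})
  rw [hΦ.ncard_vanishing_simple hd hv] at hdiff
  obtain ⟨φ, hφ⟩ := Set.ncard_eq_one.1 (by omega :
    (vanishing Φ {v} \ {χ ∈ vanishing Φ {v} | χ (lift w) = 0}).ncard = 1)
  have hφmem : φ ∈ vanishing Φ {v} \ {χ ∈ vanishing Φ {v} | χ (lift w) = 0} := by
    rw [hφ]; rfl
  have hφv : φ (lift v) = 0 := hφmem.1.2 v rfl
  have hφw : 0 < φ (lift w) := (hΦ.nonneg hφmem.1.1 hwP).lt_of_ne' fun h0 =>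
    hφmem.2 ⟨hφmem.1, h0⟩
  have hrest : ∀ χ ∈ vanishing Φ {v}, χ ≠ φ → χ (lift w) = 0 := by
    intro χ hχ hχφ
    by_contra h0
    have : χ ∈ vanishing Φ {v} \ {χ ∈ vanishing Φ {v} | χ (lift w) = 0} :=
      ⟨hχ, fun h => h0 h.2⟩
    rw [hφ] at this
    exact hχφ this
  refine ⟨?_, φ, hφmem.1, hφw, hrest⟩
  -- The edge is spanned by vertices of `P`; on it, `φ` is largest at `w` only.
  have hvert : zeroFace P ψ = convexHull ℝ {x ∈ vertexSet P | ψ (lift x) = 0} := by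
    conv_lhs => rw [← hP.convexHull_vertexSet]
    exact zeroFace_convexHull fun x hx => hψ x (vertexSet_subset _ hx)
  have hwmem : w ∈ convexHull ℝ {x ∈ vertexSet P | ψ (lift x) = 0} := by
    rw [← hvert, ← hseg]; exact right_mem_segment ℝ v w
  by_contra hwV
  have hlt : ∀ x ∈ {x ∈ vertexSet P | ψ (lift x) = 0}, φ (lift x) < φ (lift w) := by
    intro x hx
    have hxseg : x ∈ segment ℝ v w := by
      rw [hseg]; exact ⟨vertexSet_subset _ hx.1, hx.2⟩
    obtain ⟨a, b, ha, hb, hab, rfl⟩ := hxseg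
    rw [lift_combo hab, map_add, map_smul, map_smul, hφv, smul_eq_mul, smul_eq_mul, mul_zero,
      zero_add]
    rcases ha.eq_or_lt with h0 | h0
    · exfalso
      have hb1 : b = 1 := by linarith
      rw [← h0, hb1, zero_smul, one_smul, zero_add] at hx
      exact hwV hx.1
    · nlinarith
  have hconv : Convex ℝ {x : Space d | φ (lift x) < φ (lift w)} := by
    intro x hx y hy a b ha hb hab
    simp only [Set.mem_ofPred_eq] at *
    rw [lift_combo hab, map_add, map_smul, map_smul, smul_eq_mul, smul_eq_mul]
    rcases ha.eq_or_lt with h0 | h0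
    · have hb1 : b = 1 := by linarith
      rw [← h0, hb1]; linarith
    · nlinarith
  exact lt_irrefl (φ (lift w))
    (convexHull_min (t := {x | φ (lift x) < φ (lift w)}) hlt hconv hwmem)

/-- Edges at a simple vertex on the same facets at this vertex coincide. -/
lemma edge_endpoint_unique (hΦ : IsFacetSystem P Φ) (hv : v ∈ vertexSet P)
    {φ : Module.Dual ℝ (Space d × ℝ)} (hφ : φ ∈ vanishing Φ {v}) {w w' : Space d}
    (hwV : w ∈ vertexSet P) (hwV' : w' ∈ vertexSet P)
    (hw : ∀ χ ∈ vanishing Φ {v}, χ ≠ φ → χ (lift w) = 0) (hφw : 0 < φ (lift w))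
    (hw' : ∀ χ ∈ vanishing Φ {v}, χ ≠ φ → χ (lift w') = 0) (hφw' : 0 < φ (lift w')) :
    w = w' := by
  wlog hle : φ (lift w) ≤ φ (lift w') generalizing w w'
  · exact (this hwV' hwV hw' hφw' hw hφw (le_of_not_ge hle)).symm
  have hcomb := hΦ.eq_combo hv hφ hw' hφw'.ne' hw
  have hseg : w ∈ convexHull ℝ {v, w'} := by
    rw [convexHull_pair, hcomb]
    refine ⟨_, _, ?_, by positivity, by ring, rfl⟩
    rw [sub_nonneg]
    exact (div_le_one hφw').2 hle
  have hPsub : convexHull ℝ {v, w'} ⊆ P := by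
    refine convexHull_min ?_ hΦ.convex
    rintro _ (rfl | rfl)
    exacts [vertexSet_subset _ hv, vertexSet_subset _ hwV']
  rcases mem_of_mem_vertexSet_of_mem_convexHull hwV hPsub hseg with rfl | rfl
  · exact absurd (hφ.2 w rfl) hφw.ne'
  · rfl

/-- Dropping one of the facets at a simple vertex leaves an edge. -/
lemma exists_edge (hΦ : IsFacetSystem P Φ) (hP : IsDPolytope P) (hd : 0 < d)
    (hv : IsSimpleVertex P v) {φ : Module.Dual ℝ (Space d × ℝ)} (hφ : φ ∈ vanishing Φ {v}) :
    ∃ w, IsFaceOfDim P 1 (segment ℝ v w) ∧ 0 < φ (lift w) ∧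
      ∀ χ ∈ vanishing Φ {v}, χ ≠ φ → χ (lift w) = 0 := by
  have hvP := vertexSet_subset _ hv.1
  have hfin := hΦ.vanishing_finite {v}
  set S := vanishing Φ {v} \ {φ} with hS
  have hSfin : S.Finite := hfin.subset Set.sdiff_subset
  obtain ⟨y, hyS, hyφ⟩ : ∃ y : Space d × ℝ, (∀ χ ∈ S, χ y = 0) ∧ 0 < φ y := by
    by_contra! hcon
    have hfinite : Finite S := hSfin
    have hmem : φ ∈ Submodule.span ℝ (Set.range (fun χ : S => (χ : Module.Dual ℝ _))) := by
      apply mem_span_of_iInf_ker_le_ker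
      intro y hy
      simp only [Submodule.mem_iInf, LinearMap.mem_ker, Subtype.forall] at hy
      have h1 := hcon y hy
      have h2 := hcon (-y) fun χ hχ => by rw [map_neg, hy χ hχ, neg_zero]
      rw [map_neg] at h2
      exact le_antisymm h1 (by linarith)
    rw [Subtype.range_coe] at hmem
    have hnot := (hΦ.linearIndepOn_simple hd hv).notMem_span hφ
    rw [Set.image_id] at hnot
    exact hnot hmem
  obtain ⟨ψ, hψ, hz⟩ := exists_sum_functional hSfin (P := P)
    (fun χ hχ x hx => hΦ.nonneg hχ.1.1 hx)
  have hvE : v ∈ zeroFace P ψ := by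
    rw [hz]; exact ⟨hvP, fun χ hχ => hχ.1.2 v rfl⟩
  obtain ⟨ε, hε, c, hc, x₁, hx₁, hcx⟩ := exists_perturb hΦ.finite ((hΦ.mem_iff v).1 hvP) (y := y)
    fun χ hχ h0 => by
      by_cases hχφ : χ = φ
      · rw [hχφ]; exact hyφ.le
      · exact (hyS χ ⟨⟨hχ, by rintro _ rfl; exact h0⟩, hχφ⟩).ge
  have hx₁E : x₁ ∈ zeroFace P ψ := by
    rw [hz]
    refine ⟨(hΦ.mem_iff x₁).2 hx₁, fun χ hχ => ?_⟩
    have := congrArg χ hcx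
    rw [map_smul, map_add, map_smul, hχ.1.2 v rfl, hyS χ hχ, smul_zero, add_zero,
      smul_eq_mul] at this
    exact (mul_eq_zero.1 this).resolve_left hc.ne'
  have hφx₁ : 0 < φ (lift x₁) := by
    have := congrArg φ hcx
    rw [map_smul, map_add, map_smul, hφ.2 v rfl, zero_add, smul_eq_mul, smul_eq_mul] at this
    exact pos_of_mul_pos_right (this ▸ mul_pos hε hyφ) hc.le
  have hvan : vanishing Φ (zeroFace P ψ) = S := by
    apply Set.Subset.antisymm
    · intro χ hχ
      refine ⟨⟨hχ.1, by rintro _ rfl; exact hχ.2 _ hvE⟩, ?_⟩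
      rintro rfl
      exact hφx₁.ne' (hχ.2 _ hx₁E)
    · refine fun χ hχ => ⟨hχ.1.1, fun x hx => ?_⟩
      rw [hz] at hx
      exact hx.2 χ hχ
  have hvert : zeroFace P ψ = convexHull ℝ {x ∈ vertexSet P | ψ (lift x) = 0} := by
    conv_lhs => rw [← hP.convexHull_vertexSet]
    exact zeroFace_convexHull fun x hx => hψ x (vertexSet_subset _ hx)
  have hTfin : {x ∈ vertexSet P | ψ (lift x) = 0}.Finite :=
    hP.vertexSet_finite.subset fun x hx => hx.1
  have hTne : {x ∈ vertexSet P | ψ (lift x) = 0}.Nonempty := by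
    rw [← convexHull_nonempty_iff (𝕜 := ℝ), ← hvert]
    exact ⟨v, hvE⟩
  obtain ⟨w, hw, hmax⟩ := Set.exists_max_image _ (fun x => φ (lift x)) hTfin hTne
  have hle : ∀ x ∈ zeroFace P ψ, φ (lift x) ≤ φ (lift w) := by
    intro x hx
    rw [hvert] at hx
    have := nonneg_on_convexHull (φ := φ (lift w) • LinearMap.snd ℝ _ _ - φ)
      (fun x hx => by simpa using hmax x hx) x hx
    simpa using this
  have hwE : w ∈ zeroFace P ψ := ⟨vertexSet_subset _ hw.1, hw.2⟩
  have hφw : 0 < φ (lift w) := hφx₁.trans_le (hle x₁ hx₁E)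
  have hrest : ∀ x ∈ zeroFace P ψ, ∀ χ ∈ vanishing Φ {v}, χ ≠ φ → χ (lift x) = 0 := by
    intro x hx χ hχ hne
    rw [hz] at hx
    exact hx.2 χ ⟨hχ, hne⟩
  refine ⟨w, ?_, hφw, hrest w hwE⟩
  have hseg : segment ℝ v w = zeroFace P ψ := by
    apply Set.Subset.antisymm
    · exact (convex_zeroFace hΦ.convex ψ).segment_subset hvE hwE
    · intro x hx
      rw [hΦ.eq_combo hv.1 hφ (hrest w hwE) hφw.ne' (hrest x hx)]
      refine ⟨_, _, ?_, div_nonneg (hΦ.nonneg hφ.1 hx.1) hφw.le, by ring, rfl⟩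
      rw [sub_nonneg]
      exact (div_le_one hφw).2 (hle x hx)
  have hadd := hΦ.finrank_add hψ ⟨v, hvE⟩
  rw [hvan, hΦ.finrank_span_eq_ncard hd hv Set.sdiff_subset, ← hS] at hadd
  have hcard := Set.ncard_sdiff_singleton_add_one hφ hfin
  rw [← hS, hΦ.ncard_vanishing_simple hd hv] at hcard
  refine isFaceOfDim_iff.2 ⟨⟨ψ, hψ, hseg⟩, ?_⟩
  rw [hseg]
  omega

end IsFacetSystem

/-- A simple vertex of a `d`-polytope has exactly `d` neighbors. -/
lemma exists_isNeighborOrder (hP : IsDPolytope P) (hd : 0 < d) (hv : IsSimpleVertex P v) :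
    ∃ u, IsNeighborOrder P v u := by
  obtain ⟨Φ, -, hΦ⟩ := hP.exists_facetSystem ∅ (by simp) (by simp)
  have h := fun φ hφ => hΦ.exists_edge hP hd hv (φ := φ) hφ
  choose! w hw1 hw2 hw3 using h
  have hset : {x | IsFaceOfDim P 1 (segment ℝ v x)} = w '' vanishing Φ {v} := by
    ext x
    constructor
    · intro hx
      obtain ⟨hxV, φ, hφ, hpos, hrest⟩ := hΦ.edge_endpoint hP hd hv hx
      refine ⟨φ, hφ, ?_⟩
      exact hΦ.edge_endpoint_unique hv.1 hφ (hΦ.edge_endpoint hP hd hv (hw1 φ hφ)).1 hxV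
        (hw3 φ hφ) (hw2 φ hφ) hrest hpos
    · rintro ⟨φ, hφ, rfl⟩
      exact hw1 φ hφ
  have hinj : Set.InjOn w (vanishing Φ {v}) := by
    intro φ hφ χ hχ heq
    by_contra hne
    have := hw3 χ hχ φ hφ hne
    rw [← heq] at this
    exact (hw2 φ hφ).ne' this
  have hcard : (w '' vanishing Φ {v}).ncard = d := by
    rw [hinj.ncard_image, hΦ.ncard_vanishing_simple hd hv]
  have hfin : Finite (w '' vanishing Φ {v} : Set (Space d)) :=
    (hΦ.vanishing_finite {v}).image w
  have e := Finite.equivFinOfCardEq (α := (w '' vanishing Φ {v} : Set (Space d))) hcard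
  refine ⟨fun k => e.symm k, fun j k hjk => e.symm.injective (Subtype.ext hjk), ?_⟩
  rw [hset]
  ext x
  constructor
  · rintro ⟨k, rfl⟩
    exact (e.symm k).2
  · intro hx
    exact ⟨e ⟨x, hx⟩, by simp⟩

/-- The facets at a simple vertex are given by the barycentric coordinates with respect to the
vertex and its neighbors. -/
lemma exists_barycentric_of_simple (hP : IsDPolytope P) (hd : 0 < d) (hv : IsSimpleVertex P v)
    {u : Fin d → Space d} (hu : IsNeighborOrder P v u) :
    (∀ k, u k ∈ vertexSet P) ∧ ∃ β₀ β, IsBarycentric v u β₀ β ∧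
      ∀ j, IsFacetFunctional P (β j) := by
  obtain ⟨Φ, -, hΦ⟩ := hP.exists_facetSystem ∅ (by simp) (by simp)
  have hedge : ∀ k, IsFaceOfDim P 1 (segment ℝ v (u k)) := fun k => by
    have : u k ∈ {w | IsFaceOfDim P 1 (segment ℝ v w)} := hu.2 ▸ ⟨k, rfl⟩
    exact this
  have h := fun k => hΦ.edge_endpoint hP hd hv (hedge k)
  refine ⟨fun k => (h k).1, ?_⟩
  choose hV σ hσ hpos hrest using h
  have hσinj : Function.Injective σ := by
    intro j k hjk
    apply hu.1
    exact hΦ.edge_endpoint_unique hv.1 (hσ k) (hV j) (hV k) (hjk ▸ hrest j) (hjk ▸ hpos j)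
      (hrest k) (hpos k)
  have hcross : ∀ j k, j ≠ k → σ j (lift (u k)) = 0 := fun j k hjk =>
    hrest k (σ j) (hσ j) fun heq => hjk (hσinj heq)
  have hlin : LinearIndependent ℝ (fun o : Option (Fin d) => lift (o.elim v u)) := by
    rw [Fintype.linearIndependent_iff]
    intro g hg
    rw [Fintype.sum_option] at hg
    have hsome : ∀ k, g (some k) = 0 := by
      intro k
      have h1 := congrArg (σ k) hg
      rw [map_add, map_sum, map_smul, map_zero] at h1
      simp only [Option.elim, map_smul, smul_eq_mul] at h1
      rw [(hσ k).2 v rfl, mul_zero, zero_add, Finset.sum_eq_single k] at h1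
      · exact (mul_eq_zero.1 h1).resolve_right (hpos k).ne'
      · intro j _ hjk
        rw [hcross k j hjk.symm, mul_zero]
      · simp
    intro o
    cases o with
    | none =>
      simp only [hsome, zero_smul, Finset.sum_const_zero, add_zero] at hg
      exact (smul_eq_zero.1 hg).resolve_right (lift_ne_zero _)
    | some k => exact hsome k
  obtain ⟨β₀, β, hβ⟩ := exists_barycentric hlin
  refine ⟨β₀, β, hβ, fun j => ?_⟩
  have heq : σ j = σ j (lift (u j)) • β j := by
    refine LinearMap.ext fun y => ?_
    rw [hβ.apply (σ j) y, (hσ j).2 v rfl, Finset.sum_eq_single j]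
    · simp [mul_comm]
    · intro k _ hkj
      rw [hcross j k hkj.symm, mul_zero]
    · simp
  have hf := hΦ.facet _ (hσ j).1
  have hker : LinearMap.ker (β j) = LinearMap.ker (σ j) := by
    rw [heq, LinearMap.ker_smul _ _ (hpos j).ne']
  refine ⟨?_, fun x hx => ?_, ?_⟩
  · intro h0
    have := hβ.base j j
    simp [h0] at this
  · have := hf.nonneg x hx
    rw [heq, LinearMap.smul_apply, smul_eq_mul] at this
    exact nonneg_of_mul_nonneg_right this (hpos j)
  · rw [zeroFace_congr hker, hf.liftSpan_eq, hker]

end SimpleVertex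

/-! ### Existence and properties of merges -/

lemma IsBarycentric.eq_of_ker_eq {v : Space d} {u : Fin d → Space d}
    {β₀ : Module.Dual ℝ (Space d × ℝ)} {β : Fin d → Module.Dual ℝ (Space d × ℝ)}
    (h : IsBarycentric v u β₀ β) :
    ∀ φ ∈ insert β₀ (Set.range β), ∀ ψ ∈ insert β₀ (Set.range β),
      LinearMap.ker φ = LinearMap.ker ψ → φ = ψ := by
  have h0 : ∀ j, LinearMap.ker β₀ ≠ LinearMap.ker (β j) := by
    intro j hj
    have : lift v ∈ LinearMap.ker β₀ := by rw [hj]; exact h.apex j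
    rw [LinearMap.mem_ker, h.zero_apex] at this
    exact one_ne_zero this
  rintro _ (rfl | ⟨j, rfl⟩) _ (rfl | ⟨k, rfl⟩) hker
  · rfl
  · exact (h0 k hker).elim
  · exact (h0 j hker.symm).elim
  · by_contra hne
    have hjk : j ≠ k := fun hjk => hne (hjk ▸ rfl)
    have : lift (u k) ∈ LinearMap.ker (β k) := by
      rw [← hker, LinearMap.mem_ker, h.base, if_neg hjk]
    rw [LinearMap.mem_ker, h.base, if_pos rfl] at this
    exact one_ne_zero this

/-- A simplex facet has an adjacent facet along each of its ridges. Otherwise one could pass from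
the ridge to points of the facet hyperplane on the far side of the ridge. -/
lemma IsFacetSystem.exists_adjacent {P : Set (Space d)} {Φ : Set (Module.Dual ℝ (Space d × ℝ))}
    (hΦ : IsFacetSystem P Φ) (hP : IsDPolytope P) (hd : 2 ≤ d)
    {φ₀ : Module.Dual ℝ (Space d × ℝ)} (hφ₀ : φ₀ ∈ Φ) {u : Fin d → Space d}
    (hu : AffineIndependent ℝ u) (hF : zeroFace P φ₀ = convexHull ℝ (Set.range u)) (j : Fin d) :
    ∃ η ∈ Φ, 0 < η (lift (u j)) ∧ ∀ k, k ≠ j → η (lift (u k)) = 0 := by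
  rw [affineIndependent_iff_lift] at hu
  have huF : ∀ k, u k ∈ zeroFace P φ₀ := fun k => by
    rw [hF]; exact subset_convexHull ℝ _ ⟨k, rfl⟩
  have hf₀ := hΦ.facet φ₀ hφ₀
  suffices h : ∃ η ∈ Φ, η ≠ φ₀ ∧ ∀ k, k ≠ j → η (lift (u k)) = 0 by
    obtain ⟨η, hη, hne, hz⟩ := h
    refine ⟨η, hη, (hΦ.nonneg hη (huF j).1).lt_of_ne' fun h0 => hne ?_, hz⟩
    apply (hΦ.inj φ₀ hφ₀ η hη _).symm
    apply Submodule.eq_of_le_of_finrank_le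
    · rw [← hf₀.liftSpan_eq, hF, liftSpan_convexHull, liftSpan_le_ker]
      rintro _ ⟨k, rfl⟩
      by_cases hk : k = j
      · rw [hk, h0]
      · exact hz k hk
    · rw [finrank_ker_of_ne_zero hf₀.ne_zero,
        finrank_ker_of_ne_zero (hΦ.facet η hη).ne_zero]
  by_contra! hcon
  -- Coordinates on the hyperplane of `F`, completed by a point `q` of `P` off this hyperplane.
  obtain ⟨q, hq, hq0⟩ := hP.exists_pos hf₀.ne_zero hf₀.nonneg
  obtain ⟨γ₀, γ, hγ⟩ := exists_barycentric (v := q) (u := u) (by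
    rw [Fintype.linearIndependent_iff]
    intro g hg
    rw [Fintype.sum_option] at hg
    have h1 := congrArg φ₀ hg
    simp only [Option.elim, map_add, map_sum, map_smul, (huF _).2, mul_zero,
      Finset.sum_const_zero, add_zero, map_zero, smul_eq_mul] at h1
    have h2 := (mul_eq_zero.1 h1).resolve_right hq0.ne'
    rw [h2, zero_smul, zero_add] at hg
    have h3 := Fintype.linearIndependent_iff.1 hu (fun k => g (some k)) hg
    intro o
    cases o with
    | none => exact h2
    | some k => exact h3 k)
  obtain ⟨l, hl⟩ : ∃ l, l ≠ j := by
    have : Nontrivial (Fin d) := Fin.nontrivial_iff_two_le.2 hd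
    exact exists_ne j
  have hRP : convexHull ℝ (u '' {k | k ≠ j}) ⊆ P := by
    refine convexHull_min ?_ hΦ.convex
    rintro _ ⟨k, -, rfl⟩
    exact (huF k).1
  obtain ⟨x₀, hx₀, hgen⟩ := hΦ.exists_generic (convex_convexHull ℝ (u '' {k | k ≠ j})) hRP
    ⟨u l, subset_convexHull ℝ _ ⟨l, hl, rfl⟩⟩
  have hφx₀ : φ₀ (lift x₀) = 0 := by
    refine zero_on_convexHull ?_ x₀ hx₀
    rintro _ ⟨k, -, rfl⟩
    exact (huF k).2
  have hγx₀ : γ j (lift x₀) = 0 := by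
    refine zero_on_convexHull ?_ x₀ hx₀
    rintro _ ⟨k, hk, rfl⟩
    rw [hγ.base, if_neg (Ne.symm hk)]
  obtain ⟨ε, hε, c, hc, x, hx, hcx⟩ := exists_perturb hΦ.finite
    ((hΦ.mem_iff x₀).1 (hRP hx₀)) (y := lift x₀ - lift (u j)) fun φ hφ h0 => by
      have hvan := hgen φ hφ h0
      have : φ = φ₀ := by
        by_contra hne
        obtain ⟨k, hk, hk0⟩ := hcon φ hφ hne
        exact hk0 (hvan.2 _ (subset_convexHull ℝ _ ⟨k, hk, rfl⟩))
      rw [this, map_sub, hφx₀, (huF j).2, sub_zero]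
  have hxF : x ∈ zeroFace P φ₀ := by
    refine ⟨(hΦ.mem_iff x).2 hx, ?_⟩
    have := congrArg φ₀ hcx
    rw [map_smul, map_add, map_smul, map_sub, hφx₀, (huF j).2, sub_zero, smul_zero, add_zero,
      smul_eq_mul] at this
    exact (mul_eq_zero.1 this).resolve_left hc.ne'
  have hγx : 0 ≤ γ j (lift x) := by
    rw [hF] at hxF
    refine nonneg_on_convexHull ?_ x hxF
    rintro _ ⟨k, rfl⟩
    rw [hγ.base]
    split_ifs <;> norm_num
  have := congrArg (γ j) hcx
  rw [map_smul, map_add, map_smul, map_sub, hγx₀, hγ.base, if_pos rfl, smul_eq_mul,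
    smul_eq_mul] at this
  have h1 := mul_nonneg hc.le hγx
  linarith

/-- The facet hyperplane of the simplex opposite to a base vertex is spanned by the other
vertices. -/
lemma IsBarycentric.liftSpan_opposite {v : Space d} {u : Fin d → Space d}
    {β₀ : Module.Dual ℝ (Space d × ℝ)} {β : Fin d → Module.Dual ℝ (Space d × ℝ)}
    (h : IsBarycentric v u β₀ β) (j : Fin d) :
    liftSpan (insert v (u '' {k | k ≠ j})) = LinearMap.ker (β j) := by
  apply le_antisymm
  · rw [liftSpan_le_ker]
    rintro _ (rfl | ⟨k, hk, rfl⟩)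
    · exact h.apex j
    · rw [h.base, if_neg (Ne.symm hk)]
  · intro y hy
    rw [h.decomp y]
    refine add_mem (Submodule.smul_mem _ _ (lift_mem_liftSpan (Set.mem_insert _ _)))
      (Submodule.sum_mem _ fun k _ => ?_)
    by_cases hk : k = j
    · rw [hk, LinearMap.mem_ker.1 hy, zero_smul]
      exact zero_mem _
    · exact Submodule.smul_mem _ _ (lift_mem_liftSpan (Set.mem_insert_of_mem _ ⟨k, hk, rfl⟩))

/-- The merge exists: in the barycentric coordinates of `v` and its neighbors, the projective
transformation is given by the functionals of `F` and of its adjacent facets. -/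
lemma exists_isOrderedMerge (hd : 2 ≤ d) {P₁ F P₂ : Set (Space d)} {v : Space d}
    (hP₁ : IsDPolytope P₁) (hP₂ : IsDPolytope P₂) (hF : IsFacet P₁ F) (hv : IsSimpleVertex P₂ v)
    {u u' : Fin d → Space d} (hu : IsSimplexWithOrder F u) (hu' : IsNeighborOrder P₂ v u') :
    ∃ Q, IsOrderedMerge P₁ F u P₂ v u' Q := by
  obtain ⟨Φ, -, hΦ⟩ := hP₁.exists_facetSystem ∅ (by simp) (by simp)
  obtain ⟨φ₀, hφ₀, hFφ⟩ := hΦ.exists_of_isFacet (by omega) hF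
  have hz₀ : zeroFace P₁ φ₀ = convexHull ℝ (Set.range u) := by rw [← hFφ, hu.2]
  have huF : ∀ k, u k ∈ zeroFace P₁ φ₀ := fun k => by
    rw [hz₀]; exact subset_convexHull ℝ _ ⟨k, rfl⟩
  have h := hΦ.exists_adjacent hP₁ hd hφ₀ hu.1 hz₀
  choose η hηΦ hηpos hηzero using h
  obtain ⟨-, β₀, β, hβ, -⟩ := exists_barycentric_of_simple hP₂ (by omega) hv hu'
  -- `M` replaces the barycentric coordinates by the facet functionals.
  let M : (Space d × ℝ) →ₗ[ℝ] (Space d × ℝ) :=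
    φ₀.smulRight (lift v) + ∑ k, (η k).smulRight (lift (u' k))
  have hM : ∀ y, M y = φ₀ y • lift v + ∑ k, η k y • lift (u' k) := fun y => by
    simp [M, LinearMap.sum_apply]
  have hβ₀M : ∀ y, β₀ (M y) = φ₀ y := fun y => by
    rw [hM]; simp [hβ.zero_apex, hβ.zero_base]
  have hβM : ∀ j y, β j (M y) = η j y := fun j y => by
    rw [hM]; simp [hβ.apex, hβ.base]
  have hker : ∀ y, φ₀ y = 0 → (∀ k, η k y = 0) → y = 0 := by
    intro y h0 hk
    have hy : y ∈ liftSpan (zeroFace P₁ φ₀) := by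
      rw [(hΦ.facet φ₀ hφ₀).liftSpan_eq]; exact h0
    rw [hz₀, liftSpan_convexHull, liftSpan, ← Set.range_comp,
      Submodule.mem_span_range_iff_exists_fun] at hy
    obtain ⟨c, rfl⟩ := hy
    refine Finset.sum_eq_zero fun j _ => ?_
    have hj := hk j
    rw [map_sum, Finset.sum_eq_single j] at hj
    · rw [map_smul, smul_eq_mul] at hj
      rw [(mul_eq_zero.1 hj).resolve_right (hηpos j).ne', zero_smul]
    · intro k _ hkj
      rw [map_smul, Function.comp_apply, hηzero j k hkj, smul_zero]
    · simp
  have hMinj : Function.Injective M := by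
    rw [injective_iff_map_eq_zero]
    intro y hy
    exact hker y (by rw [← hβ₀M, hy, map_zero]) fun k => by rw [← hβM, hy, map_zero]
  let L : (Space d × ℝ) ≃ₗ[ℝ] (Space d × ℝ) := LinearEquiv.ofInjectiveEndo M hMinj
  have hL : ∀ y, L y = M y := fun y => rfl
  have hpos : ∀ x ∈ P₁, 0 < (L (lift x)).2 := by
    intro x hx
    have h2 : (L (lift x)).2 = φ₀ (lift x) + ∑ k, η k (lift x) := by
      rw [hL, hM]; simp [Prod.snd_sum]
    have n0 := hΦ.nonneg hφ₀ hx
    have nk : ∀ k ∈ Finset.univ, 0 ≤ η k (lift x) := fun k _ => hΦ.nonneg (hηΦ k) hx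
    have ns := Finset.sum_nonneg nk
    rw [h2]
    refine (add_nonneg n0 ns).lt_of_ne' fun hzero => lift_ne_zero x (hker _ (by linarith) ?_)
    exact fun k => (Finset.sum_eq_zero_iff_of_nonneg nk).1 (by linarith) k (Finset.mem_univ k)
  have hI : IsProjImage L P₁ (projMap L '' P₁) := ⟨hpos, rfl⟩
  have hTu : ∀ k, projMap L (u k) = u' k := by
    intro k
    have h1 : L (lift (u k)) = η k (lift (u k)) • lift (u' k) := by
      rw [hL, hM, (huF k).2, zero_smul, zero_add, Finset.sum_eq_single k]
      · intro j _ hjk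
        rw [hηzero j k hjk.symm, zero_smul]
      · simp
    apply lift_injective
    rw [hI.lift_map (huF k).1, h1, smul_smul]
    simp [inv_mul_cancel₀ (hηpos k).ne']
  have hTu' : (fun k => projMap L (u k)) = u' := funext hTu
  refine ⟨_, hF, hu, hv, hu', fun j => zeroFace P₁ (η j), L, AffineEquiv.refl ℝ _,
    fun j => ⟨?_, ?_⟩, fun x hx => (hpos x hx).ne', fun k => (hTu k).symm, fun j => ?_, ?_, rfl⟩
  · exact hΦ.isFacet_zeroFace (by omega) (hηΦ j)
  · have h1 : zeroFace P₁ (η j) ∩ F = zeroFace (convexHull ℝ (Set.range u)) (η j) := by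
      rw [← hz₀, hFφ]
      ext x
      exact ⟨fun hx => ⟨hx.2, hx.1.2⟩, fun hx => ⟨⟨hx.1.1, hx.2⟩, hx.1⟩⟩
    rw [h1, zeroFace_convexHull]
    · congr 1
      ext x
      constructor
      · rintro ⟨⟨k, rfl⟩, hk⟩
        refine ⟨k, ?_, rfl⟩
        rintro rfl
        exact (hηpos k).ne' hk
      · rintro ⟨k, hk, rfl⟩
        exact ⟨⟨k, rfl⟩, hηzero j k hk⟩
    · rintro _ ⟨k, rfl⟩
      exact hΦ.nonneg (hηΦ j) (huF k).1
  · rw [hTu', AffineEquiv.refl_apply]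
    have hspan : liftSpan (projMap L '' zeroFace P₁ (η j)) =
        liftSpan (insert v (u' '' {k | k ≠ j})) := by
      rw [hβ.liftSpan_opposite, (hI.mono fun x hx => hx.1).liftSpan_eq,
        (hΦ.facet _ (hηΦ j)).liftSpan_eq]
      ext y
      rw [Submodule.mem_map_equiv, LinearMap.mem_ker, LinearMap.mem_ker, ← hβM, ← hL,
        L.apply_symm_apply]
    ext x
    have hne : (zeroFace P₁ (η j)).Nonempty := (hΦ.isFacet_zeroFace (by omega) (hηΦ j)).2.1
    rw [mem_affineSpan_iff (hne.image _), mem_affineSpan_iff (Set.insert_nonempty _ _), hspan]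
  · rw [hTu', AffineEquiv.refl_apply]
    rintro _ ⟨x, hx, rfl⟩
    rw [hβ.mem_convexHull_insert, hI.lift_map hx]
    have hc := inv_nonneg.2 (hpos x hx).le
    refine ⟨?_, fun k => ?_⟩
    · rw [map_smul, hL, hβ₀M, smul_eq_mul]
      exact mul_nonneg hc (hΦ.nonneg hφ₀ hx)
    · rw [map_smul, hL, hβM, smul_eq_mul]
      exact mul_nonneg hc (hΦ.nonneg (hηΦ k) hx)

lemma isNeighborOrder_affine {P : Set (Space d)} {v : Space d} {u : Fin d → Space d}
    (A : Space d ≃ᵃ[ℝ] Space d) (hu : IsNeighborOrder P v u) :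
    IsNeighborOrder (A '' P) (A v) (fun k => A (u k)) := by
  have hI := isProjImage_affine A P
  have hseg : ∀ w, A '' segment ℝ v w = segment ℝ (A v) (A w) := fun w =>
    image_segment ℝ A.toAffineMap v w
  refine ⟨A.injective.comp hu.1, ?_⟩
  ext w
  constructor
  · rintro ⟨k, rfl⟩
    have h1 : u k ∈ {w | IsFaceOfDim P 1 (segment ℝ v w)} := hu.2 ▸ ⟨k, rfl⟩
    have h2 := hI.isFaceOfDim h1
    rwa [projMap_homogenize, hseg] at h2
  · intro hw
    obtain ⟨w, rfl⟩ := A.surjective w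
    have h1 : IsFaceOfDim (A '' P) 1 (A '' segment ℝ v w) := by rw [hseg]; exact hw
    have h2 := hI.symm.isFaceOfDim h1
    have hsub : segment ℝ v w ⊆ P := by
      have := h1.1.subset
      rwa [Set.image_subset_image_iff A.injective] at this
    have h3 := hI.image_image hsub
    rw [projMap_homogenize] at h3
    rw [h3] at h2
    have h4 : w ∈ Set.range u := hu.2 ▸ h2
    obtain ⟨k, rfl⟩ := h4
    exact ⟨k, rfl⟩

/-- A merge is, up to a projective transformation of `P₁` and an affine one of `P₂`, the merged
body of two polytopes in position, with `F` mapped to the wall. -/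
lemma IsOrderedMerge.exists_position (hd : 0 < d) {P₁ F P₂ Q : Set (Space d)} {v : Space d}
    {u u' : Fin d → Space d} (hP₁ : IsDPolytope P₁) (hP₂ : IsDPolytope P₂)
    (h : IsOrderedMerge P₁ F u P₂ v u' Q) :
    ∃ (L : (Space d × ℝ) ≃ₗ[ℝ] (Space d × ℝ)) (A : Space d ≃ᵃ[ℝ] Space d) (K₁ : Set (Space d))
      (β₀ : Module.Dual ℝ (Space d × ℝ)) (β : Fin d → Module.Dual ℝ (Space d × ℝ))
      (Φ₁ Φ₂ : Set (Module.Dual ℝ (Space d × ℝ))),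
      IsProjImage L P₁ K₁ ∧
      IsMergePosition (A v) (fun k => A (u' k)) β₀ β K₁ (A '' P₂) Φ₁ Φ₂ ∧
      zeroFace K₁ β₀ = projMap L '' F ∧ Q = mergedBody (A v) K₁ (A '' P₂) := by
  obtain ⟨hF, hu, hv, hu', H, L₀, A, hH, hne, hA, hspan, hsub, hQ⟩ := h
  obtain ⟨L, hLL, hI⟩ := exists_isProjImage hP₁.convex L₀ hne
  have hfun : projMap L₀ = projMap L := (funext hLL).symm
  rw [hfun] at hA hspan hsub hQ hI
  set K₁ := projMap L '' P₁ with hK₁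
  have hI₂ := isProjImage_affine A P₂
  have hPK₁ := hI.isDPolytope hP₁
  have hPK₂ := hI₂.isDPolytope hP₂
  have hTu : (fun k => projMap L (u k)) = fun k => A (u' k) := funext fun k => (hA k).symm
  have hvA : IsSimpleVertex (A '' P₂) (A v) := by
    have := hI₂.isSimpleVertex hv
    rwa [projMap_homogenize] at this
  obtain ⟨hbase, β₀, β, hβ, hβ₂⟩ :=
    exists_barycentric_of_simple hPK₂ hd hvA (isNeighborOrder_affine A hu')
  simp only [hTu] at hspan hsub
  have hnn : ∀ x ∈ K₁, 0 ≤ β₀ (lift x) ∧ ∀ k, 0 ≤ β k (lift x) := fun x hx =>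
    hβ.mem_convexHull_insert.1 (hsub hx)
  have hFconv : projMap L '' F = convexHull ℝ (Set.range fun k => A (u' k)) := by
    rw [hu.2, IsProjImage.image_convexHull, ← Set.range_comp, ← hTu]
    · rfl
    · intro x hx
      rw [← hu.2] at hx
      exact hI.pos x (hF.1.subset hx)
  have hβ_ne : ∀ j, β j ≠ 0 := fun j h0 => by
    have := hβ.base j j
    simp [h0] at this
  have hβ₀_ne : β₀ ≠ 0 := fun h0 => by
    have := hβ.zero_apex
    simp [h0] at this
  have facet_of : ∀ (φ : Module.Dual ℝ (Space d × ℝ)) (G : Set (Space d)), φ ≠ 0 →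
      (∀ x ∈ K₁, 0 ≤ φ (lift x)) → IsFacet P₁ G → (∀ x ∈ projMap L '' G, φ (lift x) = 0) →
      IsFacetFunctional K₁ φ := by
    intro φ G hφ hφnn hG hz
    refine ⟨hφ, hφnn, ?_⟩
    apply Submodule.eq_of_le_of_finrank_le (liftSpan_le_ker.2 fun x hx => hx.2)
    have hfr := (isFaceOfDim_iff.1 (hI.isFaceOfDim hG)).2
    have hle : liftSpan (projMap L '' G) ≤ liftSpan (zeroFace K₁ φ) :=
      liftSpan_mono fun x hx => ⟨(hI.isFaceOfDim hG).1.subset hx, hz x hx⟩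
    have := Submodule.finrank_mono hle
    rw [finrank_ker_of_ne_zero hφ]
    omega
  have hβ₀f : IsFacetFunctional K₁ β₀ := by
    refine facet_of β₀ F hβ₀_ne (fun x hx => (hnn x hx).1) hF ?_
    rw [hFconv]
    apply zero_on_convexHull
    rintro _ ⟨k, rfl⟩
    exact hβ.zero_base k
  have hβf : ∀ j, IsFacetFunctional K₁ (β j) := by
    intro j
    refine facet_of (β j) (H j) (hβ_ne j) (fun x hx => (hnn x hx).2 j) (hH j).1 fun x hx => ?_
    have h1 : x ∈ affineSpan ℝ (projMap L '' H j) := subset_affineSpan ℝ _ hx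
    rw [hspan j, mem_affineSpan_iff (Set.insert_nonempty _ _), hβ.liftSpan_opposite] at h1
    exact h1
  obtain ⟨Φ₁, hB₁, hΦ₁⟩ := hPK₁.exists_facetSystem (insert β₀ (Set.range β))
    (by rintro _ (rfl | ⟨j, rfl⟩); exacts [hβ₀f, hβf j]) hβ.eq_of_ker_eq
  obtain ⟨Φ₂, hB₂, hΦ₂⟩ := hPK₂.exists_facetSystem (Set.range β)
    (by rintro _ ⟨j, rfl⟩; exact hβ₂ j)
    (fun φ hφ ψ hψ => hβ.eq_of_ker_eq φ (Or.inr hφ) ψ (Or.inr hψ))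
  refine ⟨L, A, K₁, β₀, β, Φ₁, Φ₂, hI, ⟨hβ, hPK₁, hPK₂, hΦ₁, hΦ₂, hB₁ (Or.inl rfl),
    fun j => hB₁ (Or.inr ⟨j, rfl⟩), fun j => hB₂ ⟨j, rfl⟩, ?_, hvA.1, hbase, ?_⟩, ?_, ?_⟩
  · intro k
    rw [hA k]
    refine hI.map_mem (hF.1.subset ?_)
    rw [hu.2]
    exact subset_convexHull ℝ _ ⟨k, rfl⟩
  · -- Both sides have `d` elements.
    have hle : Set.range β ⊆ vanishing Φ₂ {A v} := by
      rintro _ ⟨j, rfl⟩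
      refine ⟨hB₂ ⟨j, rfl⟩, ?_⟩
      rintro _ rfl
      exact hβ.apex j
    have heq : Set.range β = vanishing Φ₂ {A v} := by
      refine Set.eq_of_subset_of_ncard_le hle ?_ (hΦ₂.vanishing_finite _)
      rw [hΦ₂.ncard_vanishing_simple hd hvA, ← Set.image_univ,
        Set.ncard_image_of_injective _ hβ.linearIndependent_coords.injective, Set.ncard_univ,
        Nat.card_fin]
    intro φ hφ h0
    rw [heq]
    refine ⟨hφ, ?_⟩
    rintro _ rfl
    exact h0
  · rw [hFconv]
    apply Set.Subset.antisymm
    · exact fun x hx => hβ.mem_convexHull_base hx.2 (hnn x hx.1).2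
    · intro x hx
      refine ⟨?_, zero_on_convexHull (by rintro _ ⟨k, rfl⟩; exact hβ.zero_base k) x hx⟩
      rw [← hFconv] at hx
      exact (hI.isFaceOfDim hF).1.subset hx
  · have hvert := hI₂.vertexSet_eq
    rw [projMap_homogenize] at hvert
    rw [hQ, mergedBody, hvert, ← Set.image_singleton, ← Set.image_sdiff A.injective]
    congr 1
    exact A.toAffineMap.image_convexHull _

/-- Being a nonsimplex `(d - i)`-simplicial `i`-simple `d`-polytope, with a simplex facet `G` and
a simple vertex `w` outside of `G`. -/
structure IsMergeable (i : ℕ) (P G : Set (Space d)) (w : Space d) : Prop where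
  polytope : IsDPolytope P
  simplicial : IsSimplicial (d - i) P
  simple : IsSimple i P
  not_simplex : ¬ IsSimplex d P
  facet : IsFacet P G
  facet_simplex : IsSimplex (d - 1) G
  vertex : IsSimpleVertex P w
  notMem : w ∉ G

/-- The facet of `P₂` away from the cut vertex and the vertex of `P₁` away from the glued facet
survive in the merge. -/
lemma IsMergeable.merge {i : ℕ} (hid : i < d) {P₁ F₁ P₂ F₂ Q : Set (Space d)}
    {v₁ v₂ : Space d} (h₁ : IsMergeable i P₁ F₁ v₁) (h₂ : IsMergeable i P₂ F₂ v₂)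
    (hQ : IsMerge P₁ F₁ P₂ v₂ Q) :
    (∃ G w, IsMergeable i Q G w) ∧ numVertices P₁ < numVertices Q := by
  have hd : 0 < d := by omega
  obtain ⟨u, u', hQ⟩ := hQ
  obtain ⟨L, A, K₁, β₀, β, Φ₁, Φ₂, hI, hpos, hwall, rfl⟩ :=
    hQ.exists_position hd h₁.polytope h₂.polytope
  have hI₂ := isProjImage_affine A P₂
  have hn₁ : ¬ IsSimplex d K₁ := fun hs => h₁.not_simplex (hI.isSimplex_iff.1 hs)
  have hn₂ : ¬ IsSimplex d (A '' P₂) := fun hs => h₂.not_simplex (hI₂.isSimplex_iff.1 hs)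
  have hF₂ : IsFacet (A '' P₂) (A '' F₂) := by
    have := hI₂.isFaceOfDim h₂.facet
    rwa [projMap_homogenize] at this
  obtain ⟨hfacet, hcap⟩ := hpos.isFacet_of_apex_notMem hd hF₂ fun hmem => h₂.notMem (by
    obtain ⟨x, hx, hxv⟩ := hmem
    rwa [← A.injective hxv])
  have hv₁ := vertexSet_subset _ h₁.vertex.1
  have hoff : β₀ (lift (projMap L v₁)) ≠ 0 := by
    intro h0
    have hmem : projMap L v₁ ∈ zeroFace K₁ β₀ := ⟨hI.map_mem hv₁, h0⟩
    rw [hwall] at hmem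
    obtain ⟨x, hx, hxv⟩ := hmem
    rw [hI.injOn (h₁.facet.1.subset hx) hv₁ hxv] at hx
    exact h₁.notMem hx
  refine ⟨⟨A '' F₂, projMap L v₁, hpos.isDPolytope, ?_, ?_, hpos.not_isSimplex hn₁ hn₂,
    hfacet, (isProjImage_affine A F₂).isSimplex h₂.facet_simplex,
    hpos.isSimpleVertex_of_off_wall hd hn₁ (hI.isSimpleVertex h₁.vertex) hoff, ?_⟩, ?_⟩
  · exact hpos.isSimplicial (hI.isSimplicial h₁.simplicial) (hI₂.isSimplicial h₂.simplicial)
  · exact hpos.isSimple hid (hI.isSimple h₁.simple) (hI₂.isSimple h₂.simple)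
  · exact fun hmem => hoff (hpos.wall_of_mem_of_mem (hI.map_mem hv₁) (hcap hmem))
  · rw [← hI.numVertices_eq]
    exact hpos.numVertices_lt hn₁ hn₂

lemma IsMergeable.exists_merge {i : ℕ} (hd : 2 ≤ d) {P₁ F₁ P₂ F₂ : Set (Space d)}
    {v₁ v₂ : Space d} (h₁ : IsMergeable i P₁ F₁ v₁) (h₂ : IsMergeable i P₂ F₂ v₂) :
    ∃ Q, IsMerge P₁ F₁ P₂ v₂ Q := by
  obtain ⟨p, hp, hF⟩ := h₁.facet_simplex
  obtain ⟨u', hu'⟩ := exists_isNeighborOrder h₂.polytope (by omega) h₂.vertex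
  have e : Fin d ≃ Fin (d - 1 + 1) := finCongr (by omega)
  have hu : IsSimplexWithOrder F₁ (p ∘ e) :=
    ⟨hp.comp_embedding e.toEmbedding, by rw [hF, e.surjective.range_comp]⟩
  obtain ⟨Q, hQ⟩ := exists_isOrderedMerge hd h₁.polytope h₂.polytope h₁.facet h₂.vertex hu hu'
  exact ⟨Q, _, _, hQ⟩

end Polytope

theorem corollary4p6 (d i : ℕ) (hd : 2 ≤ d) (hi : 1 ≤ i) (hid : i ≤ d - 1)
    (P F : Set (Polytope.Space d)) (v : Polytope.Space d)
    (hP : Polytope.IsDPolytope P)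
    (hPsimplicial : Polytope.IsSimplicial (d - i) P)
    (hPsimple : Polytope.IsSimple i P)
    (hPnot : ¬ Polytope.IsSimplex d P)
    (hF : Polytope.IsFacet P F) (hFsimplex : Polytope.IsSimplex (d - 1) F)
    (hv : Polytope.IsSimpleVertex P v) (hvF : v ∉ F) :
    -- the merge of `P` with itself along `F` and `v` is defined for all orderings
    (∀ u u' : Fin d → Polytope.Space d,
      Polytope.IsSimplexWithOrder F u → Polytope.IsNeighborOrder P v u' →
        ∃ Q, Polytope.IsOrderedMerge P F u P v u' Q) ∧
    -- every such merge has the same properties as `P`, and more vertices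
    (∀ Q, Polytope.IsMerge P F P v Q →
      Polytope.IsDPolytope Q ∧ Polytope.IsSimplicial (d - i) Q ∧ Polytope.IsSimple i Q ∧
      ¬ Polytope.IsSimplex d Q ∧
      (∃ F' v', Polytope.IsFacet Q F' ∧ Polytope.IsSimplex (d - 1) F' ∧
        Polytope.IsSimpleVertex Q v' ∧ v' ∉ F') ∧
      Polytope.numVertices P < Polytope.numVertices Q) ∧
    -- iterated merging with `P` produces an infinite family
    (∃ (R G : ℕ → Set (Polytope.Space d)) (w : ℕ → Polytope.Space d),
      R 0 = P ∧ G 0 = F ∧ w 0 = v ∧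
      (∀ n, Polytope.IsMerge (R n) (G n) P v (R (n + 1))) ∧
      (∀ n, Polytope.IsDPolytope (R n) ∧ Polytope.IsSimplicial (d - i) (R n) ∧
        Polytope.IsSimple i (R n) ∧ ¬ Polytope.IsSimplex d (R n) ∧
        Polytope.IsFacet (R n) (G n) ∧ Polytope.IsSimplex (d - 1) (G n) ∧
        Polytope.IsSimpleVertex (R n) (w n) ∧ w n ∉ G n) ∧
      StrictMono fun n => Polytope.numVertices (R n)) := by
  have hmer : Polytope.IsMergeable i P F v :=
    ⟨hP, hPsimplicial, hPsimple, hPnot, hF, hFsimplex, hv, hvF⟩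
  have hid' : i < d := by omega
  refine ⟨fun u u' hu hu' => Polytope.exists_isOrderedMerge hd hP hP hF hv hu hu', ?_, ?_⟩
  · intro Q hQ
    obtain ⟨⟨G, w, h⟩, hlt⟩ := hmer.merge hid' hmer hQ
    exact ⟨h.polytope, h.simplicial, h.simple, h.not_simplex,
      ⟨G, w, h.facet, h.facet_simplex, h.vertex, h.notMem⟩, hlt⟩
  · -- A stage of the iteration is a polytope with a marked facet and a marked vertex.
    let S := {t : Set (Polytope.Space d) × Set (Polytope.Space d) × Polytope.Space d //
      Polytope.IsMergeable i t.1 t.2.1 t.2.2}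
    have hstep : ∀ t : S, ∃ t' : S, Polytope.IsMerge t.1.1 t.1.2.1 P v t'.1.1 ∧
        Polytope.numVertices t.1.1 < Polytope.numVertices t'.1.1 := by
      rintro ⟨⟨R, G, w⟩, h⟩
      obtain ⟨Q, hQ⟩ := h.exists_merge hd hmer
      obtain ⟨⟨G', w', h'⟩, hlt⟩ := h.merge hid' hmer hQ
      exact ⟨⟨⟨Q, G', w'⟩, h'⟩, hQ, hlt⟩
    choose next hmerge hlt using hstep
    let f : ℕ → S := fun n => Nat.rec ⟨⟨P, F, v⟩, hmer⟩ (fun _ t => next t) n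
    refine ⟨fun n => (f n).1.1, fun n => (f n).1.2.1, fun n => (f n).1.2.2, rfl, rfl, rfl,
      fun n => hmerge (f n), fun n => ?_, strictMono_nat_of_lt_succ fun n => hlt (f n)⟩
    have h := (f n).2
    exact ⟨h.polytope, h.simplicial, h.simple, h.not_simplex, h.facet, h.facet_simplex, h.vertex,
      h.notMem⟩
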